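/- Let $M>1+\sqrt2$. Then there exists a sequence $\Theta=\{\theta_n\}_{n=1}^\infty$ of real-valued functions in $L^2[0,1]$ (Lebesgue measure) with the following properties. (i) $\Theta$ is a complete orthonormal system in $L^2[0,1]$, i.e. it is orthonormal and its finite linear combinations are dense in $L^2[0,1]$. (ii) $\|\theta_n\|_{L^\infty[0,1]}\le M$ for all $n$. (iii) $\Theta$ is a convergence system: for every real sequence $(a_n)\in\ell^2$ the series $\sum_{n=1}^\infty a_n\theta_n(x)$ converges (to a finite limit) for almost every $x\in[0,1]$. (iv) $\Theta$ is a divergence system: for every real sequence $(a_n)\notin\ell^2$ the series $\sum_{n=1}^\infty a_n\theta_n(x)$ diverges, that is, its partial sums have no finite limit, for almost every $x\in[0,1]$. Consequently, Menshov's representation theorem fails for $\Theta$: it is not true that for every measurable, almost everywhere finite function $f$ on $[0,1]$ there is a real sequence $(a_n)$ such that $\sum_{n=1}^\infty a_n\theta_n(x)=f(x)$ for almost every $x\in[0,1]$. In particular, Menshov's theorem does not extend to uniformly bounded complete orthonormal systems. -/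

import Mathlib

open MeasureTheory Filter Topology

/-- Lebesgue measure on `[0,1]`. -/
noncomputable abbrev unitMeasure : Measure ℝ := volume.restrict (Set.Icc (0 : ℝ) 1)

section Systems

variable {X : Type*} [MeasurableSpace X] {μ : Measure X}

/-- The series `∑ aₙ φₙ(x)` converges at `x` to the (finite) sum `s`, in the sense of partial
sums. -/
def SeriesConvergesTo (φ : ℕ → Lp ℝ 2 μ) (a : ℕ → ℝ) (x : X) (s : ℝ) : Prop :=
  Tendsto (fun N : ℕ => ∑ n ∈ Finset.range N, a n * φ n x) atTop (𝓝 s)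

/-- An orthonormal system is a convergence system if `∑ aₙ φₙ` converges a.e. for every
`a ∈ ℓ²`. -/
def IsConvergenceSystem (φ : ℕ → Lp ℝ 2 μ) : Prop :=
  Orthonormal ℝ φ ∧
    ∀ a : ℕ → ℝ, Memℓp a 2 → ∀ᵐ x ∂μ, ∃ s : ℝ, SeriesConvergesTo φ a x s

/-- An orthonormal system is a divergence system if `∑ aₙ φₙ` diverges a.e. for every
`a ∉ ℓ²`. -/
def IsDivergenceSystem (φ : ℕ → Lp ℝ 2 μ) : Prop :=
  Orthonormal ℝ φ ∧
    ∀ a : ℕ → ℝ, ¬ Memℓp a 2 → ∀ᵐ x ∂μ, ¬ ∃ s : ℝ, SeriesConvergesTo φ a x s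

/-- A Euclidean system is both a convergence system and a divergence system. -/
def IsEuclideanSystem (φ : ℕ → Lp ℝ 2 μ) : Prop :=
  IsConvergenceSystem φ ∧ IsDivergenceSystem φ

/-- Completeness: the finite linear combinations are dense in `L²(μ)`. -/
def IsCompleteSystem (φ : ℕ → Lp ℝ 2 μ) : Prop :=
  (Submodule.span ℝ (Set.range φ)).topologicalClosure = ⊤

/-- The representation property in Menshov's theorem: every measurable, a.e. finite function `f`
is the a.e. sum of some series `∑ aₙ φₙ`. -/
def HasMenshovRepresentation (φ : ℕ → Lp ℝ 2 μ) : Prop :=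
  ∀ f : X → EReal, Measurable f → (∀ᵐ x ∂μ, f x ≠ ⊤ ∧ f x ≠ ⊥) →
    ∃ a : ℕ → ℝ, ∀ᵐ x ∂μ, ∃ s : ℝ, f x = (s : EReal) ∧ SeriesConvergesTo φ a x s

end Systems

/-! Everything is built on bit sequences with a measure invariant under all coordinate flips; binary
digits transport the result to [0,1]. An orthonormal basis is split into functions `radType n`, a
Rademacher sign times a positive weight, and the remaining functions `basisFn (restIndex k)`, for
which only crude bounds are available. Block k of the system arises by rotating one remaining
function and 2^p - 1 functions of Rademacher type with a Haar matrix of order 2^p, where p is large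
compared with k. Each row of this matrix has one nonzero entry 2^((s-p)/2) per level s, and the sum
of these over s < p is at most 1/(√2 - 1) = 1 + √2; the remaining function and the large weights add
an error as small as desired (`abs_theta_le`). Orthogonal matrices preserve orthonormality and span
(`cyl_mem_span`).

A sum of Rademacher functions alone could not reveal a large coefficient hidden in a remaining
function, since the Haar rotation spreads it thinly over the block. Therefore the weight of a node
of low level s has a spike: it is of order 2^(3s/2) on a set of probability 2^(-3s-2), and the
spikes of one block are disjoint.

Convergence for square summable coefficients: over whole blocks the rotation is invisible, and one
faces two ordinary series that converge by martingale arguments (`ae_tendsto_rest_series`,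
`ae_tendsto_radType_series`). Inside a block the oscillation is small by a fourth moment maximal
inequality for the spikeless part and by a weak type estimate on the binary tree for the spikes
(`ae_blockSum_small`).

Divergence: fix δ > 0 and call a block heavy if its remaining function carries at least the
proportion δ of its energy. In a heavy block many partial Haar coefficients are large, and the
spikes turn them into an oscillation of at least 1/8 with conditional probability comparable to δ
times the energy carried by the remaining function, up to truncation. If the heavy energy diverges,
this happens infinitely often (`ae_not_tendsto_of_heavy_rest`). If it converges, the heavy blocks
may be discarded, and in the light ones the Rademacher part dominates: a Zygmund type lower estimate
in L² of an arbitrary set shows that the series converges with probability at most 32δ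
(`measureReal_convergenceSet_le`). Now let δ tend to 0.

A representing series must thus have square summable coefficients, so its sum is in L²; hence
x^(-1/2) is not representable. -/

namespace BitSystem

/-! ### Bits, flips and cylinder functions -/

/-- Switch the `n`-th coordinate. -/
def flipBit (n : ℕ) (ω : ℕ → Bool) : ℕ → Bool := Function.update ω n (!ω n)

/-- The `n`-th Rademacher function on `ℕ → Bool`. -/
def rad (n : ℕ) (ω : ℕ → Bool) : ℝ := if ω n then -1 else 1

/-- `f` depends only on the first `n` coordinates. -/
def Cyl {β : Type*} (n : ℕ) (f : (ℕ → Bool) → β) : Prop :=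
  ∀ ω ω' : ℕ → Bool, (∀ i < n, ω i = ω' i) → f ω = f ω'

/-- Probability measures on `ℕ → Bool` invariant under all coordinate flips. -/
class FlipInvariant (P : Measure (ℕ → Bool)) : Prop extends IsProbabilityMeasure P where
  measurePreserving : ∀ n, MeasurePreserving (flipBit n) P P

@[simp] lemma flipBit_same (n : ℕ) (ω : ℕ → Bool) : flipBit n ω n = !ω n := by
  simp [flipBit]

lemma flipBit_of_ne {n m : ℕ} (h : m ≠ n) (ω : ℕ → Bool) : flipBit n ω m = ω m := by
  simp [flipBit, h]

lemma flipBit_flipBit (n : ℕ) (ω : ℕ → Bool) : flipBit n (flipBit n ω) = ω := by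
  ext m
  by_cases h : m = n
  · subst h; simp
  · simp [flipBit_of_ne h]

lemma rad_flipBit_same (n : ℕ) (ω : ℕ → Bool) : rad n (flipBit n ω) = -rad n ω := by
  cases h : ω n <;> simp [rad, h]

lemma rad_flipBit_of_ne {n m : ℕ} (h : m ≠ n) (ω : ℕ → Bool) :
    rad m (flipBit n ω) = rad m ω := by
  simp [rad, flipBit_of_ne h]

@[simp] lemma rad_mul_self (n : ℕ) (ω : ℕ → Bool) : rad n ω * rad n ω = 1 := by
  cases h : ω n <;> simp [rad, h]

@[simp] lemma rad_sq (n : ℕ) (ω : ℕ → Bool) : rad n ω ^ 2 = 1 := by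
  rw [sq, rad_mul_self]

@[simp] lemma abs_rad (n : ℕ) (ω : ℕ → Bool) : |rad n ω| = 1 := by
  cases h : ω n <;> simp [rad, h]

section Cyl

variable {β γ δ : Type*} {n m : ℕ}

lemma Cyl.mono {f : (ℕ → Bool) → β} (h : Cyl n f) (hnm : n ≤ m) : Cyl m f :=
  fun ω ω' H => h ω ω' fun i hi => H i (hi.trans_le hnm)

lemma Cyl.const (b : β) : Cyl n (fun _ => b) := fun _ _ _ => rfl

lemma Cyl.comp {f : (ℕ → Bool) → β} (h : Cyl n f) (g : β → γ) : Cyl n (fun ω => g (f ω)) :=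
  fun ω ω' H => congrArg g (h ω ω' H)

lemma Cyl.comp₂ {f : (ℕ → Bool) → β} {f' : (ℕ → Bool) → γ} (h : Cyl n f) (h' : Cyl n f')
    (g : β → γ → δ) : Cyl n (fun ω => g (f ω) (f' ω)) :=
  fun ω ω' H => by simp only [h ω ω' H, h' ω ω' H]

lemma Cyl.mul {f g : (ℕ → Bool) → ℝ} (hf : Cyl n f) (hg : Cyl n g) :
    Cyl n (fun ω => f ω * g ω) := hf.comp₂ hg (· * ·)

lemma Cyl.const_mul {f : (ℕ → Bool) → ℝ} (hf : Cyl n f) (c : ℝ) :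
    Cyl n (fun ω => c * f ω) := hf.comp (c * ·)

lemma Cyl.sum {ι : Type*} {s : Finset ι} {f : ι → (ℕ → Bool) → ℝ} (h : ∀ i ∈ s, Cyl n (f i)) :
    Cyl n (fun ω => ∑ i ∈ s, f i ω) :=
  fun ω ω' H => Finset.sum_congr rfl fun i hi => h i hi ω ω' H

lemma Cyl.flip {f : (ℕ → Bool) → β} (h : Cyl n f) (hnm : n ≤ m) (ω : ℕ → Bool) :
    f (flipBit m ω) = f ω :=
  h _ _ fun _ hi => flipBit_of_ne (by omega) ω

lemma cyl_coord (hnm : n < m) : Cyl m (fun ω => ω n) := fun _ _ H => H n hnm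

lemma cyl_rad (hnm : n < m) : Cyl m (rad n) :=
  (cyl_coord hnm).comp fun b => if b then (-1 : ℝ) else 1

lemma Cyl.exists_factor {f : (ℕ → Bool) → β} (h : Cyl n f) :
    ∃ g : (Fin n → Bool) → β, ∀ ω, f ω = g fun i => ω i :=
  ⟨fun x => f fun m => if hm : m < n then x ⟨m, hm⟩ else false,
    fun ω => h _ _ fun i hi => by simp [hi]⟩

lemma Cyl.measurable [MeasurableSpace β] {f : (ℕ → Bool) → β} (h : Cyl n f) : Measurable f := by
  obtain ⟨g, hg⟩ := h.exists_factor
  rw [show f = fun ω => g fun i => ω i from funext hg]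
  exact (measurable_of_finite g).comp (measurable_pi_lambda _ fun i => measurable_pi_apply _)

lemma Cyl.measurableSet {p : (ℕ → Bool) → Prop} (h : Cyl n p) : MeasurableSet {ω | p ω} :=
  measurableSet_setOfPred.2 h.measurable

lemma Cyl.exists_bound {f : (ℕ → Bool) → ℝ} (h : Cyl n f) : ∃ C, ∀ ω, |f ω| ≤ C := by
  obtain ⟨g, hg⟩ := h.exists_factor
  refine ⟨∑ x, |g x|, fun ω => ?_⟩
  rw [hg]
  exact Finset.single_le_sum (f := fun x => |g x|) (fun _ _ => abs_nonneg _) (Finset.mem_univ _)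

lemma Cyl.integrable {f : (ℕ → Bool) → ℝ} (h : Cyl n f) (P : Measure (ℕ → Bool))
    [IsFiniteMeasure P] : Integrable f P := by
  obtain ⟨C, hC⟩ := h.exists_bound
  exact Integrable.of_bound h.measurable.aestronglyMeasurable C
    (Eventually.of_forall fun ω => by simpa using hC ω)

end Cyl

/-! ### Integration against a flip-invariant measure -/

lemma measurable_flipBit (n : ℕ) : Measurable (flipBit n) := by
  refine measurable_pi_lambda _ fun m => ?_
  by_cases h : m = n
  · subst h
    simp only [flipBit_same]
    exact (measurable_of_finite Bool.not).comp (measurable_pi_apply m)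
  · simp only [flipBit_of_ne h]
    exact measurable_pi_apply m

/-- Flipping a coordinate as a measurable equivalence. -/
def flipEquiv (n : ℕ) : (ℕ → Bool) ≃ᵐ (ℕ → Bool) where
  toFun := flipBit n
  invFun := flipBit n
  left_inv := flipBit_flipBit n
  right_inv := flipBit_flipBit n
  measurable_toFun := measurable_flipBit n
  measurable_invFun := measurable_flipBit n

variable {P : Measure (ℕ → Bool)} [FlipInvariant P]

lemma integral_flipBit (n : ℕ) (f : (ℕ → Bool) → ℝ) :
    ∫ ω, f (flipBit n ω) ∂P = ∫ ω, f ω ∂P :=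
  (FlipInvariant.measurePreserving n).integral_comp (flipEquiv n).measurableEmbedding f

/-- The source of every orthogonality relation that comes from signs; independence is never invoked
for them. -/
lemma integral_eq_zero_of_flip {n : ℕ} {f : (ℕ → Bool) → ℝ}
    (h : ∀ ω, f (flipBit n ω) = -f ω) : ∫ ω, f ω ∂P = 0 := by
  have := integral_flipBit (P := P) n f
  simp only [h, integral_neg] at this
  linarith

lemma integral_rad_mul {n : ℕ} {f : (ℕ → Bool) → ℝ} (h : ∀ ω, f (flipBit n ω) = f ω) :
    ∫ ω, rad n ω * f ω ∂P = 0 :=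
  integral_eq_zero_of_flip (n := n) fun ω => by rw [rad_flipBit_same, h]; ring

lemma measureReal_flipBit (n : ℕ) {s : Set (ℕ → Bool)} (hs : MeasurableSet s) :
    P.real (flipBit n ⁻¹' s) = P.real s := by
  simp only [Measure.real, (FlipInvariant.measurePreserving (P := P) n).measure_preimage
    hs.nullMeasurableSet]

lemma measurableSet_coord (n : ℕ) (b : Bool) : MeasurableSet {ω : ℕ → Bool | ω n = b} :=
  ((cyl_coord (Nat.lt_succ_self n)).comp (· = b)).measurableSet

lemma measureReal_inter_coord {n : ℕ} {D : Set (ℕ → Bool)} (hD : MeasurableSet D)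
    (hinv : ∀ ω, flipBit n ω ∈ D ↔ ω ∈ D) (b : Bool) :
    P.real (D ∩ {ω | ω n = b}) = 1 / 2 * P.real D := by
  have key : ∀ b, P.real (D ∩ {ω | ω n = b}) = P.real (D ∩ {ω | ω n = !b}) := fun b => by
    rw [← measureReal_flipBit n (hD.inter (measurableSet_coord n b))]
    congr 1
    ext ω
    simp only [Set.mem_preimage, Set.mem_inter_iff, hinv, Set.mem_ofPred_eq, flipBit_same]
    cases ω n <;> cases b <;> simp
  have hsplit := measureReal_inter_add_sdiff (μ := P) (s := D) (measurableSet_coord n b)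
  have : D \ {ω | ω n = b} = D ∩ {ω | ω n = !b} := by
    ext ω
    simp only [Set.mem_sdiff, Set.mem_inter_iff, Set.mem_ofPred_eq]
    cases ω n <;> cases b <;> simp
  rw [this, ← key b] at hsplit
  linarith

lemma measurableSet_cylinder (pos : ℕ → ℕ) (pat : ℕ → Bool) (l : ℕ) :
    MeasurableSet {ω : ℕ → Bool | ∀ i < l, ω (pos i) = pat i} := by
  have : {ω : ℕ → Bool | ∀ i < l, ω (pos i) = pat i} =
      ⋂ i, ⋂ (_ : i < l), {ω | ω (pos i) = pat i} := by
    ext; simp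
  rw [this]
  exact MeasurableSet.iInter fun i => MeasurableSet.iInter fun _ => measurableSet_coord _ _

lemma measureReal_inter_cylinder {pos : ℕ → ℕ} (hpos : Function.Injective pos) (pat : ℕ → Bool)
    {D : Set (ℕ → Bool)} (hD : MeasurableSet D) (l : ℕ)
    (hinv : ∀ i < l, ∀ ω, flipBit (pos i) ω ∈ D ↔ ω ∈ D) :
    P.real (D ∩ {ω | ∀ i < l, ω (pos i) = pat i}) = (1 / 2) ^ l * P.real D := by
  induction l with
  | zero => simp
  | succ l ih =>
    have h1 : D ∩ {ω | ∀ i < l + 1, ω (pos i) = pat i} =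
        (D ∩ {ω | ∀ i < l, ω (pos i) = pat i}) ∩ {ω | ω (pos l) = pat l} := by
      ext ω
      simp only [Set.mem_inter_iff, Set.mem_ofPred_eq, Order.lt_add_one_iff, and_assoc,
        and_congr_right_iff]
      intro _
      exact ⟨fun h => ⟨fun i hi => h i hi.le, h l le_rfl⟩, fun h i hi =>
        (lt_or_eq_of_le hi).elim (h.1 i) (fun e => e ▸ h.2)⟩
    rw [h1, measureReal_inter_coord (hD.inter (measurableSet_cylinder _ _ _)),
      ih fun i hi => hinv i (by omega)]
    · ring
    · intro ω
      simp only [Set.mem_inter_iff, hinv l (by omega), Set.mem_ofPred_eq]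
      refine and_congr_right fun _ => forall₂_congr fun i hi => ?_
      rw [flipBit_of_ne]
      exact fun h => by have := hpos h; omega

/-- The number whose first `n` binary digits are the first `n` coordinates. -/
def code (n : ℕ) (ω : ℕ → Bool) : ℕ := Nat.ofBits fun i : Fin n => ω i

lemma code_lt (n : ℕ) (ω : ℕ → Bool) : code n ω < 2 ^ n := Nat.ofBits_lt_two_pow _

lemma testBit_code {n i : ℕ} (h : i < n) (ω : ℕ → Bool) : (code n ω).testBit i = ω i := by
  simp [code, h]

lemma code_eq_iff {n j : ℕ} (hj : j < 2 ^ n) (ω : ℕ → Bool) :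
    code n ω = j ↔ ∀ i < n, ω i = j.testBit i := by
  constructor
  · rintro rfl i hi
    rw [testBit_code hi]
  · intro h
    have : (fun i : Fin n => ω i) = fun i : Fin n => j.testBit i := funext fun i => h i i.2
    rw [code, this, Nat.ofBits_testBit, Nat.mod_eq_of_lt hj]

lemma cyl_code (n : ℕ) : Cyl n (code n) := fun ω ω' H => by
  rw [code_eq_iff (code_lt n ω')]
  intro i hi
  rw [testBit_code hi, H i hi]

/-- This identifies functions of the first n coordinates with vectors indexed by `range (2 ^ n)`,
where the finite linear algebra takes place. -/
lemma Cyl.eq_testBit_code {β : Type*} {n : ℕ} {f : (ℕ → Bool) → β} (h : Cyl n f)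
    (ω : ℕ → Bool) : f ω = f (code n ω).testBit :=
  h _ _ fun _ hi => (testBit_code hi ω).symm

lemma measureReal_code {n j : ℕ} (hj : j < 2 ^ n) :
    P.real {ω | code n ω = j} = (1 / 2) ^ n := by
  have := measureReal_inter_cylinder (P := P) (pos := id) Function.injective_id j.testBit
    MeasurableSet.univ n (by simp)
  simp only [Set.univ_inter, id, probReal_univ, mul_one] at this
  rw [← this]
  congr 1
  ext ω
  exact code_eq_iff hj ω

lemma integral_code (n : ℕ) (F : ℕ → ℝ) :
    ∫ ω, F (code n ω) ∂P = (1 / 2) ^ n * ∑ j ∈ Finset.range (2 ^ n), F j := by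
  have h1 : ∀ ω, F (code n ω) = ∑ j ∈ Finset.range (2 ^ n),
      Set.indicator {ω | code n ω = j} (fun _ => F j) ω := fun ω => by
    rw [Finset.sum_eq_single_of_mem (code n ω) (Finset.mem_range.2 (code_lt n ω))]
    · simp
    · intro j _ hj
      simp [hj.symm]
  have hm : ∀ j, MeasurableSet {ω | code n ω = j} := fun j =>
    ((cyl_code n).comp (· = j)).measurableSet
  simp only [h1]
  rw [integral_finsetSum _ fun j _ => (integrable_const (F j)).indicator (hm j), Finset.mul_sum]
  refine Finset.sum_congr rfl fun j hj => ?_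
  rw [integral_indicator_const _ (hm j), measureReal_code (Finset.mem_range.1 hj), smul_eq_mul]

end BitSystem

namespace BitSystem

/-! ### Consecutive blocks of natural numbers -/

/-- The first index of the `k`-th block, when the blocks have sizes `w 0, w 1, …`. -/
def off (w : ℕ → ℕ) (k : ℕ) : ℕ := ∑ j ∈ Finset.range k, w j

/-- The block containing `n`. -/
def blk (w : ℕ → ℕ) (n : ℕ) : ℕ := Nat.findGreatest (fun k => off w k ≤ n) n

/-- The position of `n` inside its block. -/
def pos (w : ℕ → ℕ) (n : ℕ) : ℕ := n - off w (blk w n)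

section Blocks

variable {w : ℕ → ℕ}

@[simp] lemma off_zero : off w 0 = 0 := by simp [off]

lemma off_succ (k : ℕ) : off w (k + 1) = off w k + w k := by simp [off, Finset.sum_range_succ]

lemma off_mono : Monotone (off w) := monotone_nat_of_le_succ fun k => by rw [off_succ]; omega

lemma le_off (hw : ∀ k, 0 < w k) (k : ℕ) : k ≤ off w k := by
  induction k with
  | zero => simp
  | succ k ih => rw [off_succ]; have := hw k; omega

lemma off_blk_le (n : ℕ) : off w (blk w n) ≤ n :=
  Nat.findGreatest_spec (P := fun k => off w k ≤ n) (m := 0) (Nat.zero_le _) (by simp)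

lemma blk_le (n : ℕ) : blk w n ≤ n := Nat.findGreatest_le n

lemma off_blk_add_pos (n : ℕ) : off w (blk w n) + pos w n = n := by
  have := off_blk_le (w := w) n
  simp only [pos]; omega

lemma lt_off_blk_succ (hw : ∀ k, 0 < w k) (n : ℕ) : n < off w (blk w n + 1) := by
  by_contra! h
  have h1 : blk w n + 1 ≤ n := (le_off hw _).trans h
  exact absurd (Nat.le_findGreatest (P := fun k => off w k ≤ n) h1 h) (by simp [blk])

lemma pos_lt (hw : ∀ k, 0 < w k) (n : ℕ) : pos w n < w (blk w n) := by
  have := lt_off_blk_succ hw n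
  rw [off_succ] at this
  have := off_blk_le (w := w) n
  simp only [pos]; omega

lemma blk_off_add (hw : ∀ k, 0 < w k) {k i : ℕ} (hi : i < w k) : blk w (off w k + i) = k := by
  apply le_antisymm
  · by_contra! h
    have h1 := off_mono (w := w) (Nat.succ_le_of_lt h)
    have := off_blk_le (w := w) (off w k + i)
    rw [off_succ] at h1
    omega
  · exact Nat.le_findGreatest ((le_off hw k).trans (by omega)) (by omega)

lemma pos_off_add (hw : ∀ k, 0 < w k) {k i : ℕ} (hi : i < w k) : pos w (off w k + i) = i := by
  simp [pos, blk_off_add hw hi]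

lemma sum_range_off {β : Type*} [AddCommMonoid β] (f : ℕ → β) (k : ℕ) :
    ∑ n ∈ Finset.range (off w k), f n =
      ∑ j ∈ Finset.range k, ∑ i ∈ Finset.range (w j), f (off w j + i) := by
  induction k with
  | zero => simp
  | succ k ih => rw [off_succ, Finset.sum_range_add, Finset.sum_range_succ, ih]

end Blocks

lemma sum_range_mul (f : ℕ → ℝ) (K h : ℕ) :
    ∑ i ∈ Finset.range (K * h), f i =
      ∑ J ∈ Finset.range K, ∑ t ∈ Finset.range h, f (J * h + t) := by
  induction K with
  | zero => simp
  | succ K ih => rw [Nat.succ_mul, Finset.sum_range_add, Finset.sum_range_succ, ih]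

/-- A square matrix with orthogonal rows of equal norm has orthogonal columns. -/
lemma column_orthogonal {N : ℕ} {B : ℕ → ℕ → ℝ} {c : ℝ} (hc : c ≠ 0)
    (h : ∀ i < N, ∀ j < N, ∑ v ∈ Finset.range N, B i v * B j v = if i = j then c else 0) :
    ∀ v < N, ∀ w < N, ∑ i ∈ Finset.range N, B i v * B i w = if v = w then c else 0 := by
  let A : Matrix (Fin N) (Fin N) ℝ := Matrix.of fun i v => B i v
  have h1 : A * (c⁻¹ • A.transpose) = 1 := by
    ext i j
    rw [Matrix.mul_smul, Matrix.smul_apply, Matrix.mul_apply]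
    have := h i i.2 j j.2
    rw [Finset.sum_range] at this
    simp only [A, Matrix.of_apply, Matrix.transpose_apply, this, Matrix.one_apply, Fin.ext_iff, smul_eq_mul]
    split_ifs <;> simp [hc]
  have h2 := mul_eq_one_comm.1 h1
  intro v hv w hw
  have h3 := congrFun (congrFun h2 ⟨v, hv⟩) ⟨w, hw⟩
  rw [Matrix.smul_mul, Matrix.smul_apply, Matrix.mul_apply, Matrix.one_apply] at h3
  simp only [A, Matrix.of_apply, Matrix.transpose_apply, smul_eq_mul, Fin.ext_iff] at h3
  rw [Finset.sum_range]
  rw [inv_mul_eq_iff_eq_mul₀ hc] at h3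
  rw [h3]
  split_ifs <;> simp

/-! ### The Haar matrix -/

/-- Entries of the Haar matrix of order `2 ^ p`. Column `0` is constant and column `2 ^ s + q`
belongs to the `q`-th dyadic interval of length `2 ^ (p - s)`. -/
noncomputable def haar (p i v : ℕ) : ℝ :=
  if v = 0 then 1 / √2 ^ p else
    if i / 2 ^ (p - Nat.log 2 v) = v - 2 ^ Nat.log 2 v then
      (if i / 2 ^ (p - Nat.log 2 v - 1) % 2 = 0 then 1 else -1) *
        (√2 ^ Nat.log 2 v / √2 ^ p) else 0

lemma sum_range_two_pow {β : Type*} [AddCommMonoid β] (f : ℕ → β) (p : ℕ) :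
    ∑ v ∈ Finset.range (2 ^ p), f v =
      f 0 + ∑ s ∈ Finset.range p, ∑ q ∈ Finset.range (2 ^ s), f (2 ^ s + q) := by
  induction p with
  | zero => simp
  | succ p ih => rw [pow_succ, mul_two, Finset.sum_range_add, Finset.sum_range_succ, ih, add_assoc]

lemma log_two_pow_add {s q : ℕ} (hq : q < 2 ^ s) : Nat.log 2 (2 ^ s + q) = s :=
  Nat.log_eq_of_pow_le_of_lt_pow (by omega) (by rw [pow_succ]; omega)

lemma exists_two_pow_add {v : ℕ} (hv : v ≠ 0) :
    v = 2 ^ Nat.log 2 v + (v - 2 ^ Nat.log 2 v) ∧ v - 2 ^ Nat.log 2 v < 2 ^ Nat.log 2 v := by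
  have h1 := Nat.pow_log_le_self 2 hv
  have h2 := Nat.lt_pow_succ_log_self (b := 2) (by norm_num) v
  rw [pow_succ] at h2
  omega

lemma haar_zero (p i : ℕ) : haar p i 0 = 1 / √2 ^ p := by simp [haar]

lemma haar_node (p i : ℕ) {s q : ℕ} (hq : q < 2 ^ s) :
    haar p i (2 ^ s + q) = if i / 2 ^ (p - s) = q then
      (if i / 2 ^ (p - s - 1) % 2 = 0 then 1 else -1) * (√2 ^ s / √2 ^ p) else 0 := by
  have : 2 ^ s + q ≠ 0 := by positivity
  simp only [haar, this, log_two_pow_add hq, if_false, Nat.add_sub_cancel_left]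

lemma sqrt_two_pow_pos (p : ℕ) : 0 < √2 ^ p := by positivity

lemma sqrt_two_pow_mul_self (p : ℕ) : √2 ^ p * √2 ^ p = 2 ^ p := by
  rw [← mul_pow, Real.mul_self_sqrt (by norm_num)]

lemma div_pow_lt {p s i : ℕ} (hs : s ≤ p) (hi : i < 2 ^ p) : i / 2 ^ (p - s) < 2 ^ s := by
  rw [Nat.div_lt_iff_lt_mul (by positivity), ← pow_add]
  rwa [Nat.add_sub_cancel' hs]

/-- Only one dyadic interval of a given level contains i. Boundedness of the final system rests on
this sparsity of the rows. -/
lemma sum_haar_level {p s i : ℕ} (hs : s ≤ p) (hi : i < 2 ^ p) (f : ℕ → ℝ) :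
    ∑ q ∈ Finset.range (2 ^ s), |haar p i (2 ^ s + q)| * f q =
      √2 ^ s / √2 ^ p * f (i / 2 ^ (p - s)) := by
  rw [Finset.sum_eq_single_of_mem _ (Finset.mem_range.2 (div_pow_lt hs hi))]
  · rw [haar_node _ _ (div_pow_lt hs hi), if_pos rfl, abs_mul,
      abs_of_pos (div_pos (sqrt_two_pow_pos s) (sqrt_two_pow_pos p))]
    split_ifs <;> simp
  · intro q hq hne
    rw [haar_node _ _ (Finset.mem_range.1 hq), if_neg hne.symm]; simp

lemma div_two_pow_succ {p s i : ℕ} (hs : s < p) :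
    i / 2 ^ (p - s) = i / 2 ^ (p - s - 1) / 2 := by
  rw [Nat.div_div_eq_div_mul, ← pow_succ]; congr 2; omega

/-- Two rows in a common interval of level s contribute with sign + or - according to whether they
share a half of it. The right side is written as a difference of consecutive levels, so that the sum
over s telescopes. -/
lemma sum_haar_mul_haar_level {p s i j : ℕ} (hs : s < p) (hi : i < 2 ^ p) :
    ∑ q ∈ Finset.range (2 ^ s), haar p i (2 ^ s + q) * haar p j (2 ^ s + q) =
      2 ^ s / 2 ^ p * (2 * (if i / 2 ^ (p - (s + 1)) = j / 2 ^ (p - (s + 1)) then 1 else 0) -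
        (if i / 2 ^ (p - s) = j / 2 ^ (p - s) then 1 else 0)) := by
  have e : (√2 ^ s / √2 ^ p) * (√2 ^ s / √2 ^ p) = 2 ^ s / 2 ^ p := by
    rw [div_mul_div_comm, sqrt_two_pow_mul_self, sqrt_two_pow_mul_self]
  rw [Finset.sum_eq_single_of_mem _ (Finset.mem_range.2 (div_pow_lt hs.le hi))]
  · rw [haar_node _ _ (div_pow_lt hs.le hi), haar_node _ _ (div_pow_lt hs.le hi), if_pos rfl, ← e,
      div_two_pow_succ hs, div_two_pow_succ hs, ← Nat.sub_sub]
    generalize i / 2 ^ (p - s - 1) = x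
    generalize j / 2 ^ (p - s - 1) = y
    generalize √2 ^ s / √2 ^ p = z
    by_cases h1 : x / 2 = y / 2
    · by_cases h2 : x = y
      · subst h2; simp only [if_true]; split_ifs <;> ring
      · rw [if_pos h1.symm, if_neg h2, if_pos h1]
        rcases Nat.mod_two_eq_zero_or_one x with hx | hx <;>
          rcases Nat.mod_two_eq_zero_or_one y with hy | hy
        · omega
        · simp [hx, hy]
        · simp [hx, hy]
        · omega
    · have h2 : x ≠ y := fun h => h1 (by rw [h])
      simp [h1, h2, Ne.symm h1]
  · intro q hq hne
    rw [haar_node _ _ (Finset.mem_range.1 hq), if_neg hne.symm, zero_mul]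

lemma haar_row_orthogonal (p : ℕ) : ∀ i < 2 ^ p, ∀ j < 2 ^ p,
    ∑ v ∈ Finset.range (2 ^ p), haar p i v * haar p j v = if i = j then 1 else 0 := by
  intro i hi j hj
  rw [sum_range_two_pow, haar_zero, haar_zero]
  set δ : ℕ → ℝ := fun s => if i / 2 ^ (p - s) = j / 2 ^ (p - s) then 1 else 0 with hδ
  have h1 : ∑ s ∈ Finset.range p, ∑ q ∈ Finset.range (2 ^ s),
      haar p i (2 ^ s + q) * haar p j (2 ^ s + q) =
      ∑ s ∈ Finset.range p, ((2 ^ (s + 1) / 2 ^ p * δ (s + 1)) - (2 ^ s / 2 ^ p * δ s)) := by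
    refine Finset.sum_congr rfl fun s hs => ?_
    rw [sum_haar_mul_haar_level (Finset.mem_range.1 hs) hi]
    simp only [hδ]; ring
  rw [h1, Finset.sum_range_sub fun s => 2 ^ s / 2 ^ p * δ s, div_mul_div_comm,
    sqrt_two_pow_mul_self]
  simp [hδ, Nat.div_eq_of_lt hi, Nat.div_eq_of_lt hj]

lemma haar_column_orthogonal (p : ℕ) : ∀ v < 2 ^ p, ∀ w < 2 ^ p,
    ∑ i ∈ Finset.range (2 ^ p), haar p i v * haar p i w = if v = w then 1 else 0 :=
  column_orthogonal one_ne_zero (haar_row_orthogonal p)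

/-- Parseval's identity for the Haar matrix. -/
lemma sum_sq_haar_coeff {p : ℕ} {s : Finset ℕ} (hs : s ⊆ Finset.range (2 ^ p)) (a : ℕ → ℝ) :
    ∑ v ∈ Finset.range (2 ^ p), (∑ i ∈ s, a i * haar p i v) ^ 2 = ∑ i ∈ s, a i ^ 2 := by
  have h1 : ∀ v, (∑ i ∈ s, a i * haar p i v) ^ 2 =
      ∑ i ∈ s, ∑ j ∈ s, a i * a j * (haar p i v * haar p j v) := fun v => by
    rw [sq, Finset.sum_mul_sum]
    exact Finset.sum_congr rfl fun i _ => Finset.sum_congr rfl fun j _ => by ring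
  simp only [h1]
  rw [Finset.sum_comm]
  refine Finset.sum_congr rfl fun i hi => ?_
  rw [Finset.sum_comm, Finset.sum_eq_single_of_mem i hi]
  · rw [← Finset.mul_sum, haar_row_orthogonal p i (Finset.mem_range.1 (hs hi)) i
      (Finset.mem_range.1 (hs hi))]; simp [sq]
  · intro j hj hne
    rw [← Finset.mul_sum, haar_row_orthogonal p i (Finset.mem_range.1 (hs hi)) j
      (Finset.mem_range.1 (hs hj)), if_neg hne.symm, mul_zero]

/-- The part of the energy of `a` carried by the `q`-th dyadic interval of length `2 ^ (p - s)`. -/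
noncomputable def nodeEnergy (p : ℕ) (a : ℕ → ℝ) (s q : ℕ) : ℝ :=
  ∑ i ∈ Finset.range (2 ^ p), if i / 2 ^ (p - s) = q then a i ^ 2 else 0

lemma nodeEnergy_nonneg (p : ℕ) (a : ℕ → ℝ) (s q : ℕ) : 0 ≤ nodeEnergy p a s q :=
  Finset.sum_nonneg fun i _ => by split_ifs <;> positivity

lemma nodeEnergy_zero (p : ℕ) (a : ℕ → ℝ) :
    nodeEnergy p a 0 0 = ∑ i ∈ Finset.range (2 ^ p), a i ^ 2 :=
  Finset.sum_congr rfl fun i hi => by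
    rw [Nat.sub_zero, if_pos (Nat.div_eq_of_lt (Finset.mem_range.1 hi))]

lemma nodeEnergy_split {p s : ℕ} (hs : s < p) (a : ℕ → ℝ) (q : ℕ) :
    nodeEnergy p a s q = nodeEnergy p a (s + 1) (2 * q) + nodeEnergy p a (s + 1) (2 * q + 1) := by
  simp only [nodeEnergy]
  rw [← Finset.sum_add_distrib]
  refine Finset.sum_congr rfl fun i _ => ?_
  rw [div_two_pow_succ hs, ← Nat.sub_sub]
  generalize i / 2 ^ (p - s - 1) = x
  by_cases h0 : x = 2 * q
  · rw [if_pos (by omega), if_pos h0, if_neg (by omega), add_zero]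
  · by_cases h1 : x = 2 * q + 1
    · rw [if_pos (by omega), if_neg h0, if_pos h1, zero_add]
    · rw [if_neg (by omega), if_neg h0, if_neg h1, add_zero]

/-- Cauchy–Schwarz on the support of the column, which is a unit vector. The bound does not depend
on the truncation m, so it controls all partial coefficients at once. -/
lemma sq_haar_coeff_le {p s q m : ℕ} (hs : s < p) (hq : q < 2 ^ s) (hm : m ≤ 2 ^ p)
    (a : ℕ → ℝ) :
    (∑ i ∈ Finset.range m, a i * haar p i (2 ^ s + q)) ^ 2 ≤ nodeEnergy p a s q := by
  have hv : 2 ^ s + q < 2 ^ p := by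
    have := Nat.pow_le_pow_right (n := 2) (by norm_num) (Nat.succ_le_of_lt hs)
    rw [pow_succ] at this; omega
  have h1 : ∑ i ∈ Finset.range m, a i * haar p i (2 ^ s + q) = ∑ i ∈ Finset.range m,
      (if i / 2 ^ (p - s) = q then a i else 0) * haar p i (2 ^ s + q) :=
    Finset.sum_congr rfl fun i _ => by
      rw [haar_node _ _ hq]; split_ifs <;> simp
  have h2 : Finset.range m ⊆ Finset.range (2 ^ p) := Finset.range_subset_range.2 hm
  rw [h1]
  calc _ ≤ (∑ i ∈ Finset.range m, (if i / 2 ^ (p - s) = q then a i else 0) ^ 2) *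
        ∑ i ∈ Finset.range m, haar p i (2 ^ s + q) ^ 2 := Finset.sum_mul_sq_le_sq_mul_sq _ _ _
    _ ≤ nodeEnergy p a s q * 1 := by
        refine mul_le_mul ?_ ?_ (Finset.sum_nonneg fun _ _ => sq_nonneg _) (nodeEnergy_nonneg ..)
        · refine (Finset.sum_le_sum_of_subset_of_nonneg h2 fun _ _ _ => sq_nonneg _).trans
            (Finset.sum_le_sum fun i _ => ?_)
          split_ifs <;> simp
        · refine (Finset.sum_le_sum_of_subset_of_nonneg h2 fun _ _ _ => sq_nonneg _).trans_eq ?_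
          have := haar_column_orthogonal p _ hv _ hv
          simpa [sq] using this
    _ = _ := mul_one _

/-- Weak type estimate for the heavy nodes of a binary tree. -/
lemma sum_heavy_nodes_le {E : ℕ → ℕ → ℝ} (h0 : ∀ s q, 0 ≤ E s q) {k : ℕ}
    (hsplit : ∀ s < k, ∀ q, E s q = E (s + 1) (2 * q) + E (s + 1) (2 * q + 1)) {t : ℝ}
    (ht : 0 < t) :
    ∑ s ∈ Finset.range (k + 1), ∑ q ∈ Finset.range (2 ^ s),
      (if t < 8 ^ s * E s q then (1 / 8 : ℝ) ^ s else 0) ≤ 2 * (E 0 0 / t) := by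
  classical
  set g : ℕ → ℕ → ℝ := fun s q => if t < 8 ^ s * E s q then (1 / 8 : ℝ) ^ s else 0 with hg
  -- `F q` is the total weight of the heavy nodes in the subtree below node q of level s. Two bounds
  -- are carried along: at a heavy node the first one for the children gives a total of 1.5 ·
  -- 8^(-s), which is at most 2E/t by heaviness; at a light node the second ones for the children
  -- add up.
  have key : ∀ d s, s + d = k → ∃ F : ℕ → ℝ,
      (∑ j ∈ Finset.range (d + 1), ∑ q ∈ Finset.range (2 ^ (s + j)), g (s + j) q =
        ∑ q ∈ Finset.range (2 ^ s), F q) ∧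
      ∀ q, F q ≤ 2 * (1 / 8) ^ s ∧ F q ≤ 2 * (E s q / t) := by
    intro d
    induction d with
    | zero =>
      intro s hs
      refine ⟨g s, by simp, fun q => ?_⟩
      have h8 : (0 : ℝ) < (1 / 8) ^ s := by positivity
      simp only [hg]
      split_ifs with h
      · refine ⟨by linarith, ?_⟩
        rw [mul_div_assoc', le_div_iff₀ ht]
        have : (1 / 8 : ℝ) ^ s * t ≤ (1 / 8) ^ s * (8 ^ s * E s q) :=
          mul_le_mul_of_nonneg_left h.le h8.le
        rw [← mul_assoc, ← mul_pow] at this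
        norm_num at this
        have := h0 s q
        norm_num; linarith
      · have := h0 s q
        exact ⟨by positivity, by positivity⟩
    | succ d ih =>
      intro s hs
      obtain ⟨F, hF, hb⟩ := ih (s + 1) (by omega)
      refine ⟨fun q => g s q + (F (2 * q) + F (2 * q + 1)), ?_, fun q => ?_⟩
      · rw [Finset.sum_range_succ', add_comm, Finset.sum_add_distrib]
        congr 1
        have e : ∑ q ∈ Finset.range (2 ^ s), (F (2 * q) + F (2 * q + 1)) =
            ∑ q ∈ Finset.range (2 ^ (s + 1)), F q := by
          rw [pow_succ, sum_range_mul]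
          exact Finset.sum_congr rfl fun q _ => by simp [Finset.sum_range_succ, mul_comm]
        rw [e, ← hF]
        refine Finset.sum_congr rfl fun j _ => ?_
        rw [show s + (j + 1) = s + 1 + j by ring]
      · obtain ⟨h1, h2⟩ := hb (2 * q)
        obtain ⟨h3, h4⟩ := hb (2 * q + 1)
        have h8 : (0 : ℝ) < (1 / 8) ^ s := by positivity
        rw [pow_succ] at h1 h3
        have hsum : E s q / t = E (s + 1) (2 * q) / t + E (s + 1) (2 * q + 1) / t := by
          rw [hsplit s (by omega) q, add_div]
        simp only [hg]
        split_ifs with h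
        · refine ⟨by linarith, ?_⟩
          have : (1 / 8 : ℝ) ^ s ≤ E s q / t := by
            rw [le_div_iff₀ ht]
            have := mul_le_mul_of_nonneg_left h.le h8.le
            rw [← mul_assoc (_ ^ s) (8 ^ s), ← mul_pow] at this
            norm_num at this ⊢
            linarith
          linarith
        · exact ⟨by linarith, by rw [hsum]; linarith⟩
  obtain ⟨F, hF, hb⟩ := key k 0 (by omega)
  have := (hb 0).2
  simp only [zero_add, pow_zero, Finset.sum_range_one] at hF
  rw [hF]; exact this

end BitSystem

namespace BitSystem

/-! ### Large partial Haar coefficients, and the peeling basis -/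

lemma haar_node_block {p s q J t : ℕ} (hs : s < p) (hq : q < 2 ^ s) (ht : t < 2 ^ (p - s - 1)) :
    haar p (J * 2 ^ (p - s - 1) + t) (2 ^ s + q) =
      if J / 2 = q then (if J % 2 = 0 then 1 else -1) * (√2 ^ s / √2 ^ p) else 0 := by
  have h : (J * 2 ^ (p - s - 1) + t) / 2 ^ (p - s - 1) = J := by
    rw [mul_comm, Nat.mul_add_div (by positivity), Nat.div_eq_of_lt ht, add_zero]
  rw [haar_node _ _ hq, div_two_pow_succ hs, h]

lemma sum_haar_node_block {p s q K : ℕ} (hs : s < p) (hq : q < 2 ^ s) (a : ℕ → ℝ) :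
    ∑ i ∈ Finset.range (K * 2 ^ (p - s - 1)), a i * haar p i (2 ^ s + q) =
      ∑ J ∈ Finset.range K, (if J / 2 = q then (if J % 2 = 0 then 1 else -1) else 0) *
        (√2 ^ s / √2 ^ p * ∑ t ∈ Finset.range (2 ^ (p - s - 1)), a (J * 2 ^ (p - s - 1) + t)) := by
  rw [sum_range_mul]
  refine Finset.sum_congr rfl fun J _ => ?_
  rw [Finset.mul_sum, Finset.mul_sum]
  refine Finset.sum_congr rfl fun t ht => ?_
  rw [haar_node_block hs hq (Finset.mem_range.1 ht)]
  split_ifs <;> ring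

/-- A vector with a substantial mean has large partial Haar coefficients at a fixed proportion of
the nodes of every level. -/
lemma card_large_haar_coeff {p s : ℕ} (hs : s < p) (a : ℕ → ℝ) {c δ : ℝ}
    (hc : c = ∑ i ∈ Finset.range (2 ^ p), a i * haar p i 0) (hc0 : c ≠ 0)
    (h : δ * ∑ i ∈ Finset.range (2 ^ p), a i ^ 2 ≤ c ^ 2) :
    δ * 2 ^ s / 4 ≤ (((Finset.range (2 ^ s)).filter fun q => ∃ m ≤ 2 ^ p,
      |c| / (8 * √2 ^ s) ≤ |∑ i ∈ Finset.range m, a i * haar p i (2 ^ s + q)|).card : ℝ) := by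
  classical
  set H := 2 ^ (p - s - 1) with hH
  have hKH : 2 ^ (s + 1) * H = 2 ^ p := by rw [hH, ← pow_add]; congr 1; omega
  set σ : ℕ → ℝ := fun J => ∑ t ∈ Finset.range H, a (J * H + t) with hσ
  set E := ∑ i ∈ Finset.range (2 ^ p), a i ^ 2 with hE
  set x := √2 ^ s / √2 ^ p with hx
  have hxpos : 0 < x := div_pos (sqrt_two_pow_pos s) (sqrt_two_pow_pos p)
  have hp := sqrt_two_pow_pos p
  have hps := sqrt_two_pow_pos s
  have hss := sqrt_two_pow_mul_self s
  have hpp := sqrt_two_pow_mul_self p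
  have hC : ∑ J ∈ Finset.range (2 ^ (s + 1)), σ J = c * √2 ^ p := by
    rw [hc, ← sum_range_mul, hKH, Finset.sum_mul]
    refine Finset.sum_congr rfl fun i _ => ?_
    rw [haar_zero]; field_simp
  have hσ2 : ∑ J ∈ Finset.range (2 ^ (s + 1)), σ J ^ 2 ≤ H * E := by
    rw [hE, ← hKH, sum_range_mul, Finset.mul_sum]
    refine Finset.sum_le_sum fun J _ => ?_
    have := sq_sum_le_card_mul_sum_sq (s := Finset.range H) (f := fun t => a (J * H + t))
    simpa using this
  -- The threshold is half the absolute average of the sums over half-intervals. Those below it make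
  -- up at most half of the total, so Cauchy–Schwarz on the others bounds their number from below.
  set G := (Finset.range (2 ^ (s + 1))).filter
    fun J => |c| * √2 ^ p / (2 * 2 ^ (s + 1)) ≤ |σ J| with hG
  have hG1 : |c| * √2 ^ p / 2 ≤ ∑ J ∈ G, |σ J| := by
    have h1 : |c| * √2 ^ p ≤ ∑ J ∈ Finset.range (2 ^ (s + 1)), |σ J| := by
      rw [← abs_of_pos hp, ← abs_mul, ← hC]
      exact Finset.abs_sum_le_sum_abs _ _
    rw [← Finset.sum_filter_add_sum_filter_not _
      (fun J => |c| * √2 ^ p / (2 * 2 ^ (s + 1)) ≤ |σ J|)] at h1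
    have h2 : ∑ J ∈ (Finset.range (2 ^ (s + 1))).filter
        (fun J => ¬ |c| * √2 ^ p / (2 * 2 ^ (s + 1)) ≤ |σ J|), |σ J| ≤ |c| * √2 ^ p / 2 := by
      refine (Finset.sum_le_card_nsmul _ _ (|c| * √2 ^ p / (2 * 2 ^ (s + 1))) ?_).trans ?_
      · intro J hJ
        exact (not_le.1 (Finset.mem_filter.1 hJ).2).le
      · rw [nsmul_eq_mul]
        have h3 : (((Finset.range (2 ^ (s + 1))).filter
          (fun J => ¬ |c| * √2 ^ p / (2 * 2 ^ (s + 1)) ≤ |σ J|)).card : ℝ) ≤ 2 ^ (s + 1) := by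
          have := Finset.card_filter_le (Finset.range (2 ^ (s + 1)))
            (fun J => ¬ |c| * √2 ^ p / (2 * 2 ^ (s + 1)) ≤ |σ J|)
          rw [Finset.card_range] at this
          exact_mod_cast this
        calc _ ≤ 2 ^ (s + 1) * (|c| * √2 ^ p / (2 * 2 ^ (s + 1))) := by gcongr
          _ = _ := by field_simp
    linarith
  have hG2 : c ^ 2 * 2 ^ (s + 1) / 4 ≤ G.card * E := by
    have h1 : (∑ J ∈ G, |σ J|) ^ 2 ≤ G.card * (H * E) := by
      refine sq_sum_le_card_mul_sum_sq.trans ?_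
      gcongr
      refine le_trans ?_ hσ2
      simp only [sq_abs]
      exact Finset.sum_le_sum_of_subset_of_nonneg (Finset.filter_subset _ _)
        fun _ _ _ => sq_nonneg _
    have h2 : (|c| * √2 ^ p / 2) ^ 2 ≤ G.card * (H * E) :=
      (pow_le_pow_left₀ (by positivity) hG1 2).trans h1
    have h3 : (|c| * √2 ^ p / 2) ^ 2 = (c ^ 2 * 2 ^ (s + 1) / 4) * H := by
      have : (2 : ℝ) ^ p = 2 ^ (s + 1) * H := by exact_mod_cast hKH.symm
      rw [div_pow, mul_pow, sq_abs, sq (√2 ^ p), hpp, this]; ring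
    have hHpos : (0 : ℝ) < H := by rw [hH]; positivity
    rw [h3, show (G.card : ℝ) * (H * E) = G.card * E * H by ring] at h2
    exact le_of_mul_le_mul_right h2 hHpos
  have hEpos : 0 < E := by
    have h1 : 0 < c ^ 2 * 2 ^ (s + 1) / 4 := by positivity
    have h2 : 0 ≤ E := Finset.sum_nonneg fun _ _ => sq_nonneg _
    rcases h2.eq_or_lt with h3 | h3
    · rw [← h3, mul_zero] at hG2; linarith
    · exact h3
  have hG3 : δ * 2 ^ s / 2 ≤ G.card := by
    have : δ * 2 ^ s / 2 * E ≤ G.card * E := by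
      refine le_trans ?_ hG2
      have := mul_le_mul_of_nonneg_right h (by positivity : (0 : ℝ) ≤ 2 ^ s / 2)
      calc _ = δ * E * (2 ^ s / 2) := by ring
        _ ≤ _ := this
        _ = _ := by rw [pow_succ]; ring
    exact le_of_mul_le_mul_right this hEpos
  have hcard : G.card ≤ 2 * (G.image (· / 2)).card := by
    refine Finset.card_le_mul_card_image _ 2 fun q _ => ?_
    refine (Finset.card_le_card (t := {2 * q, 2 * q + 1}) fun J hJ => ?_).trans Finset.card_le_two
    have := (Finset.mem_filter.1 hJ).2
    simp only [Finset.mem_insert, Finset.mem_singleton]; omega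
  have himg : G.image (· / 2) ⊆ (Finset.range (2 ^ s)).filter fun q => ∃ m ≤ 2 ^ p,
      |c| / (8 * √2 ^ s) ≤ |∑ i ∈ Finset.range m, a i * haar p i (2 ^ s + q)| := by
    intro q hq
    obtain ⟨J, hJ, rfl⟩ := Finset.mem_image.1 hq
    obtain ⟨hJ1, hJ2⟩ := Finset.mem_filter.1 hJ
    have hJ3 := Finset.mem_range.1 hJ1
    rw [pow_succ] at hJ3
    have hq2 : J / 2 < 2 ^ s := by omega
    refine Finset.mem_filter.2 ⟨Finset.mem_range.2 hq2, ?_⟩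
    set q := J / 2 with hqdef
    have hlarge : |c| / (4 * √2 ^ s) ≤ x * |σ J| := by
      have := mul_le_mul_of_nonneg_left hJ2 hxpos.le
      refine le_trans (le_of_eq ?_) this
      rw [hx, pow_succ, ← hss]; field_simp; ring
    -- Truncation at the midpoint of the interval gives xσ(2q), at its right end xσ(2q) - xσ(2q+1).
    -- If either half-sum is large, one of these two truncations is at least half as large.
    have hmid : ∑ i ∈ Finset.range ((2 * q + 1) * H), a i * haar p i (2 ^ s + q) =
        x * σ (2 * q) := by
      rw [sum_haar_node_block hs hq2, Finset.sum_range_succ, Finset.sum_eq_zero, zero_add]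
      · simp [hσ, hx, hH]
      · intro J' hJ'
        have := Finset.mem_range.1 hJ'
        rw [if_neg (by omega), zero_mul]
    have hend : ∑ i ∈ Finset.range ((2 * q + 2) * H), a i * haar p i (2 ^ s + q) =
        x * σ (2 * q) - x * σ (2 * q + 1) := by
      rw [sum_haar_node_block hs hq2, Finset.sum_range_succ, ← sum_haar_node_block hs hq2, hmid,
        if_pos (by omega), if_neg (by omega)]
      ring
    have hm2 : (2 * q + 2) * H ≤ 2 ^ p := by
      rw [← hKH]; refine Nat.mul_le_mul_right _ ?_; rw [pow_succ]; omega
    have hm1 : (2 * q + 1) * H ≤ 2 ^ p := (Nat.mul_le_mul_right _ (by omega)).trans hm2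
    have hhalf : |c| / (8 * √2 ^ s) = |c| / (4 * √2 ^ s) / 2 := by
      rw [div_div]; congr 1; ring
    have hnn : 0 ≤ |c| / (4 * √2 ^ s) := by positivity
    by_cases hbig : |c| / (8 * √2 ^ s) ≤ |x * σ (2 * q)|
    · exact ⟨_, hm1, by rw [hmid]; exact hbig⟩
    · refine ⟨_, hm2, ?_⟩
      rw [hend]
      rw [← abs_of_pos hxpos, ← abs_mul] at hlarge
      rcases Nat.mod_two_eq_zero_or_one J with hJm | hJm
      · have : J = 2 * q := by omega
        rw [this] at hlarge
        linarith
      · have : J = 2 * q + 1 := by omega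
        rw [this] at hlarge
        have := abs_sub_abs_le_abs_sub (x * σ (2 * q + 1)) (x * σ (2 * q))
        rw [abs_sub_comm] at this
        rw [hhalf] at hbig ⊢
        push Not at hbig
        linarith
  have := Finset.card_le_card himg
  have h5 : (G.card : ℝ) ≤ 2 * ((Finset.range (2 ^ s)).filter fun q => ∃ m ≤ 2 ^ p,
      |c| / (8 * √2 ^ s) ≤ |∑ i ∈ Finset.range m, a i * haar p i (2 ^ s + q)|).card := by
    exact_mod_cast hcard.trans (Nat.mul_le_mul_left 2 this)
  linarith

/-! ### An orthogonal basis obtained by peeling off one point at a time -/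

/-- The sum of `φ ^ 2` over `[j, N)`. -/
noncomputable def tailSq (N : ℕ) (φ : ℕ → ℝ) (j : ℕ) : ℝ := ∑ i ∈ Finset.Ico j N, φ i ^ 2

/-- A function vanishing before `j` and proportional to `φ` after `j`, orthogonal to `φ`. -/
noncomputable def peel (N : ℕ) (φ : ℕ → ℝ) (j i : ℕ) : ℝ :=
  if i < j then 0 else if i = j then √(tailSq N φ (j + 1)) / √(tailSq N φ j) else
    -(φ j / (√(tailSq N φ (j + 1)) * √(tailSq N φ j))) * φ i

/-- The function `φ`, followed by the normalised functions `peel N φ j`. -/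
noncomputable def peelBasis (N : ℕ) (φ : ℕ → ℝ) (j i : ℕ) : ℝ :=
  if j = 0 then φ i else √N * peel N φ (j - 1) i

section Peel

variable {N : ℕ} {φ : ℕ → ℝ}

lemma tailSq_succ {j : ℕ} (hj : j < N) : tailSq N φ j = φ j ^ 2 + tailSq N φ (j + 1) := by
  rw [tailSq, Finset.sum_eq_sum_Ico_succ_bot hj]; rfl

lemma tailSq_pos (hφ : ∀ i < N, 0 < φ i) {j : ℕ} (hj : j < N) : 0 < tailSq N φ j := by
  refine Finset.sum_pos (fun i hi => pow_pos (hφ i (Finset.mem_Ico.1 hi).2) 2)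
    ⟨j, Finset.mem_Ico.2 ⟨le_rfl, hj⟩⟩

lemma sum_mul_peel (f : ℕ → ℝ) {j : ℕ} (hj : j < N) :
    ∑ i ∈ Finset.range N, f i * peel N φ j i =
      f j * (√(tailSq N φ (j + 1)) / √(tailSq N φ j)) +
      -(φ j / (√(tailSq N φ (j + 1)) * √(tailSq N φ j))) *
        ∑ i ∈ Finset.Ico (j + 1) N, f i * φ i := by
  rw [Finset.range_eq_Ico, ← Finset.sum_Ico_consecutive _ (Nat.zero_le j) hj.le,
    Finset.sum_eq_zero, zero_add, Finset.sum_eq_sum_Ico_succ_bot hj]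
  · congr 1
    · simp [peel]
    · rw [Finset.mul_sum]
      refine Finset.sum_congr rfl fun i hi => ?_
      have := (Finset.mem_Ico.1 hi).1
      rw [peel, if_neg (by omega), if_neg (by omega)]; ring
  · intro i hi
    rw [peel, if_pos (Finset.mem_Ico.1 hi).2, mul_zero]

lemma sum_phi_mul_peel (hφ : ∀ i < N, 0 < φ i) {j : ℕ} (hj : j + 1 < N) :
    ∑ i ∈ Finset.range N, φ i * peel N φ j i = 0 := by
  rw [sum_mul_peel φ (by omega)]
  have h1 := tailSq_pos hφ hj
  have h2 := tailSq_pos hφ (show j < N by omega)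
  have h3 : ∑ i ∈ Finset.Ico (j + 1) N, φ i * φ i = tailSq N φ (j + 1) :=
    Finset.sum_congr rfl fun _ _ => by ring
  rw [h3]
  have h4 := Real.sqrt_pos.2 h1
  have h5 := Real.sqrt_pos.2 h2
  nth_rewrite 3 [← Real.mul_self_sqrt h1.le]
  field_simp
  ring

/-- For j < l, the vector `peel N φ j` is a multiple of φ on the support of `peel N φ l`, which is
orthogonal to φ. -/
lemma sum_peel_mul_peel (hφ : ∀ i < N, 0 < φ i) {j l : ℕ} (hj : j + 1 < N) (hl : l + 1 < N) :
    ∑ i ∈ Finset.range N, peel N φ j i * peel N φ l i = if j = l then 1 else 0 := by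
  wlog hjl : j ≤ l generalizing j l
  · refine (Finset.sum_congr rfl fun i _ => mul_comm _ _).trans ?_
    rw [this hl hj (by omega)]
    simp only [eq_comm]
  rcases hjl.eq_or_lt with rfl | hlt
  · rw [if_pos rfl, sum_mul_peel _ (by omega)]
    have h1 := tailSq_pos hφ hj
    have h2 := tailSq_pos hφ (show j < N by omega)
    have h4 := Real.sqrt_pos.2 h1
    have h5 := Real.sqrt_pos.2 h2
    have h3 : ∑ i ∈ Finset.Ico (j + 1) N, peel N φ j i * φ i =
        -(φ j / (√(tailSq N φ (j + 1)) * √(tailSq N φ j))) * tailSq N φ (j + 1) := by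
      rw [tailSq, Finset.mul_sum]
      refine Finset.sum_congr rfl fun i hi => ?_
      have := (Finset.mem_Ico.1 hi).1
      rw [peel, if_neg (by omega), if_neg (by omega), tailSq]; ring
    have h6 : peel N φ j j = √(tailSq N φ (j + 1)) / √(tailSq N φ j) := by simp [peel]
    rw [h3, h6]
    have h7 := Real.sq_sqrt h1.le
    have h8 := Real.sq_sqrt h2.le
    have h9 := tailSq_succ (φ := φ) (show j < N by omega)
    have h10 : tailSq N φ (j + 1) = √(tailSq N φ (j + 1)) ^ 2 := h7.symm
    rw [h9] at h8
    set X := √(tailSq N φ (j + 1))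
    set Y := √(φ j ^ 2 + tailSq N φ (j + 1)) with hY
    rw [h9, h10] 
    rw [h10] at h8 hY
    rw [← hY]
    have hYpos : 0 < Y := by rw [hY, ← h10, ← h9]; exact h5
    field_simp
    rw [h8]; ring
  · rw [if_neg hlt.ne]
    have h0 := sum_phi_mul_peel hφ hl
    have : ∀ i ∈ Finset.range N, peel N φ j i * peel N φ l i =
        -(φ j / (√(tailSq N φ (j + 1)) * √(tailSq N φ j))) * (φ i * peel N φ l i) := by
      intro i _
      by_cases hi : i < l
      · rw [show peel N φ l i = 0 by rw [peel, if_pos hi]]; ring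
      · rw [show peel N φ j i = _ by rw [peel, if_neg (by omega), if_neg (by omega)]]; ring
    rw [Finset.sum_congr rfl this, ← Finset.mul_sum, h0, mul_zero]

lemma peelBasis_orthogonal (hφ : ∀ i < N, 0 < φ i)
    (hN : ∑ i ∈ Finset.range N, φ i ^ 2 = N) : ∀ j < N, ∀ l < N,
    ∑ i ∈ Finset.range N, peelBasis N φ j i * peelBasis N φ l i = if j = l then (N : ℝ) else 0 := by
  have hNN : √(N : ℝ) * √(N : ℝ) = N := Real.mul_self_sqrt (Nat.cast_nonneg N)
  intro j hj l hl
  rcases j with _ | j <;> rcases l with _ | l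
  · simpa [peelBasis, sq] using hN
  · have := sum_phi_mul_peel hφ hl
    rw [if_neg (by omega)]
    simp only [peelBasis, if_true, Nat.succ_ne_zero, if_false, Nat.add_sub_cancel,
      mul_left_comm _ (√(N : ℝ)), ← Finset.mul_sum]
    rw [this, mul_zero]
  · have := sum_phi_mul_peel hφ hj
    rw [if_neg (by omega)]
    simp only [peelBasis, if_true, Nat.succ_ne_zero, if_false, Nat.add_sub_cancel, mul_assoc,
      ← Finset.mul_sum]
    rw [← this]
    simp only [mul_comm]
    rw [this]; simp
  · have := sum_peel_mul_peel hφ hj hl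
    simp only [peelBasis, Nat.succ_ne_zero, if_false, Nat.add_sub_cancel]
    have e : ∀ i, √(N : ℝ) * peel N φ j i * (√(N : ℝ) * peel N φ l i) =
        N * (peel N φ j i * peel N φ l i) := fun i => by
      rw [mul_mul_mul_comm, hNN]
    simp only [e, ← Finset.mul_sum, this]
    simp

lemma abs_peelBasis_le (hφ : ∀ i < N, 0 < φ i) (hN : ∑ i ∈ Finset.range N, φ i ^ 2 = N)
    {j i : ℕ} (hj : j < N) (hi : i < N) : |peelBasis N φ j i| ≤ √N := by
  refine Real.abs_le_sqrt ?_
  have := peelBasis_orthogonal hφ hN j hj j hj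
  rw [if_pos rfl] at this
  rw [← this, sq]
  exact Finset.single_le_sum (f := fun i => peelBasis N φ j i * peelBasis N φ j i)
    (fun _ _ => mul_self_nonneg _) (Finset.mem_range.2 hi)

lemma peelBasis_eq_zero {j i : ℕ} (h : i + 1 < j) : peelBasis N φ j i = 0 := by
  rw [peelBasis, if_neg (by omega), peel, if_pos (by omega), mul_zero]

/-- Until the point i is peeled off, a partial sum at i depends on i only through φ i. This is what
makes a maximal inequality possible without logarithmic loss. -/
lemma exists_peelBasis_eq_mul : ∃ κ : ℕ → ℝ, ∀ j i, j ≤ i → peelBasis N φ j i = κ j * φ i := by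
  refine ⟨fun j => if j = 0 then 1 else √N *
    -(φ (j - 1) / (√(tailSq N φ (j - 1 + 1)) * √(tailSq N φ (j - 1)))), fun j i hji => ?_⟩
  rcases j with _ | j
  · simp [peelBasis]
  · simp only [peelBasis, Nat.succ_ne_zero, if_false, Nat.add_sub_cancel]
    rw [peel, if_neg (by omega), if_neg (by omega)]; ring

lemma sum_sq_peelBasis (hφ : ∀ i < N, 0 < φ i) (hN : ∑ i ∈ Finset.range N, φ i ^ 2 = N)
    (d : ℕ → ℝ) {m : ℕ} (hm : m ≤ N) :
    ∑ i ∈ Finset.range N, (∑ j ∈ Finset.range m, d j * peelBasis N φ j i) ^ 2 =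
      N * ∑ j ∈ Finset.range m, d j ^ 2 := by
  have h1 : ∀ i, (∑ j ∈ Finset.range m, d j * peelBasis N φ j i) ^ 2 =
      ∑ j ∈ Finset.range m, ∑ l ∈ Finset.range m,
        d j * d l * (peelBasis N φ j i * peelBasis N φ l i) := fun i => by
    rw [sq, Finset.sum_mul_sum]
    exact Finset.sum_congr rfl fun i _ => Finset.sum_congr rfl fun j _ => by ring
  simp only [h1]
  rw [Finset.sum_comm, Finset.mul_sum]
  refine Finset.sum_congr rfl fun j hj => ?_
  have hj' := Finset.mem_range.1 hj
  rw [Finset.sum_comm, Finset.sum_eq_single_of_mem j hj]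
  · rw [← Finset.mul_sum, peelBasis_orthogonal hφ hN j (by omega) j (by omega), if_pos rfl]; ring
  · intro l hl hne
    have hl' := Finset.mem_range.1 hl
    rw [← Finset.mul_sum, peelBasis_orthogonal hφ hN j (by omega) l (by omega),
      if_neg hne.symm, mul_zero]

/-- Weak type maximal inequality on the set where `φ` takes a given value. -/
lemma card_peelBasis_maximal_aux (hφ : ∀ i < N, 0 < φ i)
    (hN : ∑ i ∈ Finset.range N, φ i ^ 2 = N) (d : ℕ → ℝ) {t : ℝ} (ht : 0 < t) (Z : ℝ) :
    t ^ 2 * (((Finset.range N).filter fun i => φ i = Z ∧ ∃ m ≤ N,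
      t < |∑ j ∈ Finset.range m, d j * peelBasis N φ j i|).card : ℝ) ≤
      N * ∑ j ∈ Finset.range N, d j ^ 2 := by
  classical
  obtain ⟨κ, hκ⟩ := exists_peelBasis_eq_mul (N := N) (φ := φ)
  set g : ℕ → ℕ → ℝ := fun m i => ∑ j ∈ Finset.range m, d j * peelBasis N φ j i with hg
  set σ : ℕ → ℝ := fun m => ∑ j ∈ Finset.range m, d j * κ j with hσ
  have hlow : ∀ m i, m ≤ i + 1 → g m i = σ m * φ i := fun m i h => by
    simp only [hg, hσ, Finset.sum_mul]
    refine Finset.sum_congr rfl fun j hj => ?_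
    rw [hκ j i (by have := Finset.mem_range.1 hj; omega)]; ring
  have hhigh : ∀ m i, i + 2 ≤ m → g m i = g (i + 2) i := fun m i h => by
    simp only [hg]
    refine (Finset.sum_subset (Finset.range_subset_range.2 h) fun j _ hj => ?_).symm
    rw [peelBasis_eq_zero (by rw [Finset.mem_range] at hj; omega), mul_zero]
  -- One stopping index serves the whole level set of φ: the first m with t < |σ m · Z|, or N if
  -- there is none. A point not yet peeled off at τ has the value σ τ · Z; at any other point the
  -- partial sums are frozen from i + 2 on, and by minimality the excess occurred after freezing.
  have main : ∃ τ ≤ N, ∀ i < N, φ i = Z → (∃ m ≤ N, t < |g m i|) → t < |g τ i| := by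
    by_cases hex : ∃ m, m ≤ N ∧ t < |σ m * Z|
    · refine ⟨Nat.find hex, (Nat.find_spec hex).1, fun i hi hZ ⟨m, hm, hlt⟩ => ?_⟩
      have hspec := (Nat.find_spec hex).2
      by_cases hτ : Nat.find hex ≤ i + 1
      · rw [hlow _ _ hτ, hZ]; exact hspec
      · push Not at hτ
        have hm2 : i + 2 ≤ m := by
          by_contra! hcon
          have : t < |σ m * Z| := by rw [← hZ, ← hlow m i (by omega)]; exact hlt
          have := Nat.find_min' hex ⟨hm, this⟩
          omega
        rw [hhigh _ _ hτ, ← hhigh m i hm2]; exact hlt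
    · push Not at hex
      refine ⟨N, le_rfl, fun i hi hZ ⟨m, hm, hlt⟩ => ?_⟩
      have hm2 : i + 2 ≤ m := by
        by_contra! hcon
        have := hex m hm
        rw [← hZ, ← hlow m i (by omega)] at this
        linarith
      rw [hhigh N i (by omega), ← hhigh m i hm2]; exact hlt
  obtain ⟨τ, hτ, hmain⟩ := main
  have h1 : t ^ 2 * (((Finset.range N).filter fun i => φ i = Z ∧ ∃ m ≤ N, t < |g m i|).card : ℝ) ≤
      ∑ i ∈ (Finset.range N).filter (fun i => φ i = Z ∧ ∃ m ≤ N, t < |g m i|), g τ i ^ 2 := by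
    rw [mul_comm, ← nsmul_eq_mul]
    refine Finset.card_nsmul_le_sum _ _ _ fun i hi => ?_
    obtain ⟨hi1, hi2, hi3⟩ := Finset.mem_filter.1 hi
    rw [← sq_abs (g τ i)]
    exact pow_le_pow_left₀ ht.le (hmain i (Finset.mem_range.1 hi1) hi2 hi3).le 2
  refine h1.trans ?_
  calc _ ≤ ∑ i ∈ Finset.range N, g τ i ^ 2 :=
        Finset.sum_le_sum_of_subset_of_nonneg (Finset.filter_subset _ _) fun _ _ _ => sq_nonneg _
    _ = N * ∑ j ∈ Finset.range τ, d j ^ 2 := sum_sq_peelBasis hφ hN d hτ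
    _ ≤ _ := by
      gcongr

lemma card_peelBasis_maximal (hφ : ∀ i < N, 0 < φ i)
    (hN : ∑ i ∈ Finset.range N, φ i ^ 2 = N) (d : ℕ → ℝ) {t : ℝ} (ht : 0 < t) {Z₁ Z₂ : ℝ}
    (hZ : ∀ i < N, φ i = Z₁ ∨ φ i = Z₂) :
    t ^ 2 * (((Finset.range N).filter fun i => ∃ m ≤ N,
      t < |∑ j ∈ Finset.range m, d j * peelBasis N φ j i|).card : ℝ) ≤
      2 * N * ∑ j ∈ Finset.range N, d j ^ 2 := by
  classical
  have h1 := card_peelBasis_maximal_aux hφ hN d ht Z₁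
  have h2 := card_peelBasis_maximal_aux hφ hN d ht Z₂
  set p : ℕ → Prop := fun i => ∃ m ≤ N, t < |∑ j ∈ Finset.range m, d j * peelBasis N φ j i|
  have h3 : (Finset.range N).filter p ⊆ (Finset.range N).filter (fun i => φ i = Z₁ ∧ p i) ∪
      (Finset.range N).filter (fun i => φ i = Z₂ ∧ p i) := by
    intro i hi
    obtain ⟨hi1, hi2⟩ := Finset.mem_filter.1 hi
    rcases hZ i (Finset.mem_range.1 hi1) with h | h
    · exact Finset.mem_union_left _ (Finset.mem_filter.2 ⟨hi1, h, hi2⟩)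
    · exact Finset.mem_union_right _ (Finset.mem_filter.2 ⟨hi1, h, hi2⟩)
  have h4 : (((Finset.range N).filter p).card : ℝ) ≤
      ((Finset.range N).filter (fun i => φ i = Z₁ ∧ p i)).card +
      ((Finset.range N).filter (fun i => φ i = Z₂ ∧ p i)).card := by
    exact_mod_cast (Finset.card_le_card h3).trans (Finset.card_union_le _ _)
  have := mul_le_mul_of_nonneg_left h4 (sq_nonneg t)
  linarith

end Peel

end BitSystem

namespace BitSystem

/-! ### Fourth moment maximal inequality, Chebyshev and Borel–Cantelli -/

section General

variable {Ω : Type*} [MeasurableSpace Ω] {μ : Measure Ω}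

/-- In the halving argument below a constant K must satisfy K/4 + 613 + 2K/4 ≤ K. The coefficient of
y^4 therefore has to be less than 3, and the value 2 leads to K = 4 · 613 = 2452. -/
lemma add_pow_four_le (x y : ℝ) : (x + y) ^ 4 ≤ 613 * x ^ 4 + 2 * y ^ 4 := by
  have h1 : (x + y) ^ 2 ≤ 7 / 2 * x ^ 2 + 7 / 5 * y ^ 2 := by
    nlinarith [sq_nonneg (5 * x - 2 * y)]
  have h2 : ((x + y) ^ 2) ^ 2 ≤ (7 / 2 * x ^ 2 + 7 / 5 * y ^ 2) ^ 2 :=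
    pow_le_pow_left₀ (sq_nonneg _) h1 2
  nlinarith [sq_nonneg (49 / 2 * x ^ 2 - 1 / 5 * y ^ 2), sq_nonneg (x ^ 2)]

/-- Maximal inequality for sums with fourth moments controlled by the square of an additive
function of the interval of summation. -/
lemma exists_maximal_bound {Y : ℕ → Ω → ℝ} {q : ℕ → ℝ} {N : ℕ} {C : ℝ} (hq : ∀ i, 0 ≤ q i)
    (hC : 0 ≤ C)
    (hint : ∀ l m, Integrable (fun ω => (∑ i ∈ Finset.Ico l m, Y i ω) ^ 4) μ)
    (h4 : ∀ l m, m ≤ N → ∫ ω, (∑ i ∈ Finset.Ico l m, Y i ω) ^ 4 ∂μ ≤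
      C * (∑ i ∈ Finset.Ico l m, q i) ^ 2) :
    ∀ n l m, m ≤ N → m - l ≤ n → ∃ B : Ω → ℝ, Integrable B μ ∧ (∀ ω, 0 ≤ B ω) ∧
      (∀ j ≤ m, ∀ ω, (∑ i ∈ Finset.Ico l j, Y i ω) ^ 4 ≤ B ω) ∧
      ∫ ω, B ω ∂μ ≤ 2452 * C * (∑ i ∈ Finset.Ico l m, q i) ^ 2 := by
  intro n
  induction n with
  | zero =>
    intro l m _ hml
    refine ⟨fun _ => 0, integrable_zero _ _ _, fun _ => le_rfl, fun j hj ω => ?_, ?_⟩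
    · rw [Finset.Ico_eq_empty (by omega)]; simp
    · simp; positivity
  | succ n ih =>
    intro l m hmN hml
    by_cases hlm : m ≤ l
    · exact ih l m hmN (by omega)
    push Not at hlm
    set u := ∑ i ∈ Finset.Ico l m, q i with hu
    have hu0 : 0 ≤ u := Finset.sum_nonneg fun i _ => hq i
    -- The interval is cut at the first index h where half of the mass is reached. Both `Ico l h`
    -- and `Ico (h + 1) m` then have mass at most u/2, while the single index h goes into the sum S.
    have hex : ∃ h, l ≤ h ∧ u / 2 ≤ ∑ i ∈ Finset.Ico l (h + 1), q i :=
      ⟨m - 1, by omega, by rw [Nat.sub_add_cancel (by omega)]; linarith⟩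
    set h := Nat.find hex with hh
    obtain ⟨hlh, hhu⟩ := Nat.find_spec hex
    have hhm : h < m := by
      have := Nat.find_min' hex (m := m - 1)
        ⟨by omega, by rw [Nat.sub_add_cancel (by omega)]; linarith⟩
      omega
    have hleft : ∑ i ∈ Finset.Ico l h, q i ≤ u / 2 := by
      rcases hlh.eq_or_lt with he | hlt
      · rw [hh, ← he]; simp; linarith
      · by_contra! hcon
        have := Nat.find_min' hex (m := h - 1)
          ⟨by omega, by rw [Nat.sub_add_cancel (by omega)]; exact hcon.le⟩
        omega
    have hright : ∑ i ∈ Finset.Ico (h + 1) m, q i ≤ u / 2 := by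
      have := Finset.sum_Ico_consecutive q (show l ≤ h + 1 by omega) (show h + 1 ≤ m by omega)
      linarith
    obtain ⟨B₁, hB₁, hB₁0, hB₁m, hB₁i⟩ := ih l h (by omega) (by omega)
    obtain ⟨B₂, hB₂, hB₂0, hB₂m, hB₂i⟩ := ih (h + 1) m hmN (by omega)
    set S : Ω → ℝ := fun ω => (∑ i ∈ Finset.Ico l (h + 1), Y i ω) ^ 4 with hS
    have hSi : Integrable S μ := hint l (h + 1)
    have hS0 : ∀ ω, 0 ≤ S ω := fun ω => by simp only [hS]; positivity
    refine ⟨fun ω => B₁ ω + (613 * S ω + 2 * B₂ ω),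
      hB₁.add ((hSi.const_mul _).add (hB₂.const_mul _)),
      fun ω => by have := hB₁0 ω; have := hB₂0 ω; have := hS0 ω; positivity, fun j hj ω => ?_, ?_⟩
    · have := hB₁0 ω; have := hB₂0 ω; have := hS0 ω
      by_cases hjh : j ≤ h
      · have := hB₁m j hjh ω
        linarith
      · rw [← Finset.sum_Ico_consecutive (fun i => Y i ω) (show l ≤ h + 1 by omega)
          (show h + 1 ≤ j by omega)]
        have h1 := add_pow_four_le (∑ i ∈ Finset.Ico l (h + 1), Y i ω)
          (∑ i ∈ Finset.Ico (h + 1) j, Y i ω)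
        have h2 := hB₂m j hj ω
        simp only [hS] at *
        linarith
    · have hint2 : Integrable (fun ω => 613 * S ω + 2 * B₂ ω) μ :=
        (hSi.const_mul _).add (hB₂.const_mul _)
      rw [integral_add hB₁ hint2,
        integral_add (hSi.const_mul _) (hB₂.const_mul _), integral_const_mul, integral_const_mul]
      have h1 : ∫ ω, S ω ∂μ ≤ C * u ^ 2 := by
        refine (h4 l (h + 1) (by omega)).trans ?_
        gcongr
        · exact Finset.sum_nonneg fun i _ => hq i
        · exact Finset.sum_le_sum_of_subset_of_nonneg (Finset.Ico_subset_Ico_right hhm)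
            fun i _ _ => hq i
      have h2 : ∫ ω, B₁ ω ∂μ ≤ 2452 * C * (u / 2) ^ 2 := by
        refine hB₁i.trans ?_
        gcongr
        exact Finset.sum_nonneg fun i _ => hq i
      have h3 : ∫ ω, B₂ ω ∂μ ≤ 2452 * C * (u / 2) ^ 2 := by
        refine hB₂i.trans ?_
        gcongr
        exact Finset.sum_nonneg fun i _ => hq i
      nlinarith

lemma measureReal_lt_abs_le [IsFiniteMeasure μ] {f : Ω → ℝ} (hf : Integrable (fun ω => f ω ^ 2) μ)
    {t : ℝ} (ht : 0 < t) : μ.real {ω | t < |f ω|} ≤ (∫ ω, f ω ^ 2 ∂μ) / t ^ 2 := by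
  rw [le_div_iff₀ (by positivity), mul_comm]
  refine le_trans ?_ (mul_meas_ge_le_integral_of_nonneg
    (Eventually.of_forall fun ω => sq_nonneg (f ω)) hf (t ^ 2))
  refine mul_le_mul_of_nonneg_left (measureReal_mono fun ω hω => ?_) (sq_nonneg t)
  have : t < |f ω| := hω
  change t ^ 2 ≤ f ω ^ 2
  rw [← sq_abs (f ω)]
  exact pow_le_pow_left₀ ht.le this.le 2

/-- Borel–Cantelli for a family of exceptional sets decreasing in a positive parameter. -/
lemma ae_eventually_notMem_of_summable [IsFiniteMeasure μ] {B : ℕ → ℝ → Set Ω}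
    (hanti : ∀ k η η', η ≤ η' → B k η' ⊆ B k η)
    (hB : ∀ η > 0, Summable fun k => μ.real (B k η)) :
    ∀ᵐ ω ∂μ, ∀ η > 0, ∀ᶠ k in atTop, ω ∉ B k η := by
  have h1 : ∀ j : ℕ, ∀ᵐ ω ∂μ, ∀ᶠ k in atTop, ω ∉ B k (1 / (j + 1)) := fun j => by
    refine ae_eventually_notMem ?_
    have := (hB (1 / (j + 1)) (by positivity)).tsum_ofReal_ne_top
    simpa [Measure.real, ENNReal.ofReal_toReal] using this
  filter_upwards [ae_all_iff.2 h1] with ω hω η hη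
  obtain ⟨j, hj⟩ := exists_nat_one_div_lt hη
  filter_upwards [hω j] with k hk hmem
  exact hk (hanti k _ _ hj.le hmem)

end General

/-! ### Rademacher series with predictable coefficients -/

/-- The filtration of sets invariant under all flips of index at least `n`. -/
def flipFiltration : Filtration ℕ (inferInstance : MeasurableSpace (ℕ → Bool)) where
  seq n :=
    { MeasurableSet' := fun s => MeasurableSet s ∧ ∀ m, n ≤ m → ∀ ω, flipBit m ω ∈ s ↔ ω ∈ s
      measurableSet_empty := ⟨MeasurableSet.empty, by simp⟩
      measurableSet_compl := fun s hs => ⟨hs.1.compl, fun m hm ω => by simp [hs.2 m hm ω]⟩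
      measurableSet_iUnion := fun f hf => ⟨MeasurableSet.iUnion fun i => (hf i).1,
        fun m hm ω => by simp [fun i => (hf i).2 m hm ω]⟩ }
  mono' := fun _ _ hnm _ hs => ⟨hs.1, fun k hk => hs.2 k (hnm.trans hk)⟩
  le' := fun _ _ hs => hs.1

lemma Cyl.stronglyMeasurable {n : ℕ} {f : (ℕ → Bool) → ℝ} (h : Cyl n f) :
    StronglyMeasurable[flipFiltration n] f := by
  refine Measurable.stronglyMeasurable ?_
  intro t ht
  refine ⟨h.measurable ht, fun m hm ω => ?_⟩
  simp only [Set.mem_preimage, h.flip hm]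

lemma cyl_rad_sum {g : ℕ → (ℕ → Bool) → ℝ} (hg : ∀ n, Cyl n (g n)) (n : ℕ) :
    Cyl n (fun ω => ∑ i ∈ Finset.range n, rad i ω * g i ω) :=
  Cyl.sum fun i hi => ((cyl_rad (Finset.mem_range.1 hi)).mul
    ((hg i).mono (Finset.mem_range.1 hi).le))

variable {P : Measure (ℕ → Bool)} [FlipInvariant P]

lemma integral_rad_mul_cyl {n : ℕ} {f : (ℕ → Bool) → ℝ} (h : Cyl n f) :
    ∫ ω, rad n ω * f ω ∂P = 0 := integral_rad_mul (h.flip le_rfl)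

lemma integral_sq_rad_sum {g : ℕ → (ℕ → Bool) → ℝ} (hg : ∀ n, Cyl n (g n)) (n : ℕ) :
    ∫ ω, (∑ i ∈ Finset.range n, rad i ω * g i ω) ^ 2 ∂P =
      ∑ i ∈ Finset.range n, ∫ ω, g i ω ^ 2 ∂P := by
  induction n with
  | zero => simp
  | succ n ih =>
    have hS := cyl_rad_sum hg n
    have h1 : ∀ ω, (∑ i ∈ Finset.range (n + 1), rad i ω * g i ω) ^ 2 =
        ((∑ i ∈ Finset.range n, rad i ω * g i ω) ^ 2 + g n ω ^ 2) +
          rad n ω * (2 * ((∑ i ∈ Finset.range n, rad i ω * g i ω) * g n ω)) := fun ω => by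
      rw [Finset.sum_range_succ, add_sq, mul_pow, rad_sq]; ring
    simp only [h1]
    have hc : Cyl n fun ω => 2 * ((∑ i ∈ Finset.range n, rad i ω * g i ω) * g n ω) :=
      (hS.mul (hg n)).const_mul 2
    rw [integral_add, integral_add, integral_rad_mul_cyl hc, ih, Finset.sum_range_succ, add_zero]
    · exact (hS.comp (· ^ 2)).integrable P
    · exact ((hg n).comp (· ^ 2)).integrable P
    · exact ((hS.comp (· ^ 2)).integrable P).add (((hg n).comp (· ^ 2)).integrable P)
    · exact ((cyl_rad (Nat.lt_succ_self n)).mul (hc.mono (Nat.le_succ n))).integrable P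

lemma martingale_rad_sum {g : ℕ → (ℕ → Bool) → ℝ} (hg : ∀ n, Cyl n (g n)) :
    Martingale (fun n ω => ∑ i ∈ Finset.range n, rad i ω * g i ω) flipFiltration P := by
  refine martingale_of_setIntegral_eq_succ (fun n => (cyl_rad_sum hg n).stronglyMeasurable)
    (fun n => (cyl_rad_sum hg n).integrable P) fun n s hs => ?_
  have hi : Integrable (fun ω => rad n ω * g n ω) P :=
    ((cyl_rad (Nat.lt_succ_self n)).mul ((hg n).mono (Nat.le_succ n))).integrable P
  simp only [Finset.sum_range_succ]
  rw [integral_add ((cyl_rad_sum hg n).integrable P).integrableOn hi.integrableOn]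
  have h0 : ∫ ω in s, rad n ω * g n ω ∂P = 0 := by
    rw [← integral_indicator hs.1]
    refine integral_eq_zero_of_flip (n := n) fun ω => ?_
    by_cases hω : ω ∈ s
    · rw [Set.indicator_of_mem hω, Set.indicator_of_mem ((hs.2 n le_rfl ω).2 hω),
        rad_flipBit_same, (hg n).flip le_rfl]; ring
    · rw [Set.indicator_of_notMem hω, Set.indicator_of_notMem fun h => hω ((hs.2 n le_rfl ω).1 h),
        neg_zero]
  rw [h0, add_zero]

/-- A Rademacher series with predictable square summable coefficients converges a.e. -/
lemma ae_tendsto_rad_sum {g : ℕ → (ℕ → Bool) → ℝ} (hg : ∀ n, Cyl n (g n))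
    (hs : Summable fun n => ∫ ω, g n ω ^ 2 ∂P) :
    ∀ᵐ ω ∂P, ∃ s, Tendsto (fun n => ∑ i ∈ Finset.range n, rad i ω * g i ω) atTop (𝓝 s) := by
  have hb : ∀ n, eLpNorm (fun ω => ∑ i ∈ Finset.range n, rad i ω * g i ω) 1 P ≤
      ((1 + ∑' n, ∫ ω, g n ω ^ 2 ∂P).toNNReal : ENNReal) := fun n => by
    have hc := cyl_rad_sum hg n
    rw [eLpNorm_one_eq_lintegral_enorm, ← ofReal_integral_norm_eq_lintegral_enorm (hc.integrable P)]
    refine ENNReal.ofReal_le_ofReal ?_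
    have h1 : ∫ ω, ‖∑ i ∈ Finset.range n, rad i ω * g i ω‖ ∂P ≤
        ∫ ω, (1 + (∑ i ∈ Finset.range n, rad i ω * g i ω) ^ 2) ∂P := by
      refine integral_mono (hc.integrable P).norm
        ((integrable_const _).add ((hc.comp (· ^ 2)).integrable P)) fun ω => ?_
      simp only [Real.norm_eq_abs]
      nlinarith [sq_abs (∑ i ∈ Finset.range n, rad i ω * g i ω),
        sq_nonneg (|∑ i ∈ Finset.range n, rad i ω * g i ω| - 1)]
    rw [integral_add (integrable_const _) ((hc.comp (· ^ 2)).integrable P),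
      integral_sq_rad_sum hg] at h1
    refine h1.trans ?_
    simp only [integral_const, probReal_univ, smul_eq_mul, mul_one]
    have := hs.sum_le_tsum (Finset.range n) fun i _ => integral_nonneg fun ω => sq_nonneg (g i ω)
    linarith
  exact (martingale_rad_sum hg).submartingale.exists_ae_tendsto_of_bdd hb

/-! ### Fourth moments of Rademacher sums -/

lemma cyl_weighted_rad_sum {s : Finset ℕ} {n : ℕ → ℕ} {N : ℕ} (hN : ∀ v ∈ s, n v < N) (b : ℕ → ℝ) :
    Cyl N (fun ω => ∑ v ∈ s, b v * rad (n v) ω) :=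
  Cyl.sum fun v hv => (cyl_rad (hN v hv)).const_mul _

/-- Khinchin's inequality, one sign at a time: terms odd in the new sign integrate to zero, and the
surviving cross term 6b²X² is exactly that of 3(A + b²)². -/
lemma moments_rad_sum {s : Finset ℕ} {n : ℕ → ℕ} (hn : Set.InjOn n s) (b : ℕ → ℝ) :
    ∫ ω, (∑ v ∈ s, b v * rad (n v) ω) ^ 2 ∂P = ∑ v ∈ s, b v ^ 2 ∧
    ∫ ω, (∑ v ∈ s, b v * rad (n v) ω) ^ 4 ∂P ≤ 3 * (∑ v ∈ s, b v ^ 2) ^ 2 := by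
  classical
  induction s using Finset.induction_on with
  | empty => simp
  | insert v s hv ih =>
    obtain ⟨ih2, ih4⟩ := ih (hn.mono (by simp))
    obtain ⟨N, hN⟩ : ∃ N, ∀ w ∈ insert v s, n w < N :=
      ⟨(insert v s).sup n + 1, fun w hw => Nat.lt_succ_of_le (Finset.le_sup hw)⟩
    have hX : Cyl N (fun ω => ∑ w ∈ s, b w * rad (n w) ω) :=
      cyl_weighted_rad_sum (fun w hw => hN w (Finset.mem_insert_of_mem hw)) b
    have hr : Cyl N (rad (n v)) := cyl_rad (hN v (Finset.mem_insert_self v s))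
    have hflip : ∀ ω, ∑ w ∈ s, b w * rad (n w) (flipBit (n v) ω) =
        ∑ w ∈ s, b w * rad (n w) ω := fun ω => Finset.sum_congr rfl fun w hw => by
      rw [rad_flipBit_of_ne]
      intro h
      exact hv (hn (by simp [hw]) (by simp) h ▸ hw)
    set X : (ℕ → Bool) → ℝ := fun ω => ∑ w ∈ s, b w * rad (n w) ω with hXdef
    have e2 : ∀ ω, (∑ w ∈ insert v s, b w * rad (n w) ω) ^ 2 =
        (X ω ^ 2 + b v ^ 2) + rad (n v) ω * (2 * b v * X ω) := fun ω => by
      rw [Finset.sum_insert hv]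
      linear_combination (b v ^ 2) * rad_sq (n v) ω
    have e4 : ∀ ω, (∑ w ∈ insert v s, b w * rad (n w) ω) ^ 4 =
        (X ω ^ 4 + (6 * b v ^ 2 * X ω ^ 2 + b v ^ 4)) +
          rad (n v) ω * (4 * b v * X ω ^ 3 + 4 * b v ^ 3 * X ω) := fun ω => by
      rw [Finset.sum_insert hv]
      have h := rad_sq (n v) ω
      simp only [hXdef]
      set x := ∑ w ∈ s, b w * rad (n w) ω
      linear_combination (6 * b v ^ 2 * x ^ 2 + 4 * b v ^ 3 * rad (n v) ω * x +
        b v ^ 4 * (rad (n v) ω ^ 2 + 1)) * h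
    simp only [e2, e4]
    have z2 : ∫ ω, rad (n v) ω * (2 * b v * X ω) ∂P = 0 :=
      integral_rad_mul fun ω => by simp only [hXdef, hflip]
    have z4 : ∫ ω, rad (n v) ω * (4 * b v * X ω ^ 3 + 4 * b v ^ 3 * X ω) ∂P = 0 :=
      integral_rad_mul fun ω => by simp only [hXdef, hflip]
    have i2 := (hX.comp (· ^ 2)).integrable P
    have i4 := (hX.comp (· ^ 4)).integrable P
    have j2 := (hX.comp fun x => x ^ 2 + b v ^ 2).integrable P
    have j3 := (hX.comp fun x => 6 * b v ^ 2 * x ^ 2 + b v ^ 4).integrable P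
    have j4 := (hX.comp fun x => x ^ 4 + (6 * b v ^ 2 * x ^ 2 + b v ^ 4)).integrable P
    constructor
    · rw [integral_add j2 ((hr.mul (hX.const_mul _)).integrable P), z2, integral_add i2 (integrable_const _), ih2,
        Finset.sum_insert hv]
      simp; ring
    · rw [integral_add j4
        ((hr.mul (hX.comp fun x => 4 * b v * x ^ 3 + 4 * b v ^ 3 * x)).integrable P), z4,
        integral_add i4 j3,
        integral_add (i2.const_mul _) (integrable_const _), integral_const_mul, ih2,
        Finset.sum_insert hv]
      simp only [integral_const, probReal_univ, smul_eq_mul, one_mul, add_zero]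
      nlinarith [sq_nonneg (b v ^ 2)]

/-! ### Recurrence and Bessel's inequality -/

/-- Events each of which has a conditional probability bounded below by the terms of a divergent
series occur infinitely often. -/
lemma ae_frequently_mem {B : ℕ → Set (ℕ → Bool)} {N : ℕ → ℕ} (hN : Monotone N)
    (hB : ∀ k, Cyl (N (k + 1)) (· ∈ B k)) {q : ℕ → ℝ} (hq0 : ∀ k, 0 ≤ q k)
    (hq : ∀ k, ∀ D : Set (ℕ → Bool), Cyl (N k) (· ∈ D) → q k * P.real D ≤ P.real (D ∩ B k))
    (hdiv : ¬ Summable q) : ∀ᵐ ω ∂P, ∃ᶠ k in atTop, ω ∈ B k := by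
  have key : ∀ K, P.real {ω | ∀ k, K ≤ k → ω ∉ B k} = 0 := fun K => by
    set D : ℕ → Set (ℕ → Bool) := fun j => {ω | ∀ k, K ≤ k → k < j → ω ∉ B k} with hD
    have hDc : ∀ j, Cyl (N j) (· ∈ D j) := fun j ω ω' H => by
      simp only [hD, Set.mem_ofPred_eq, eq_iff_iff]
      refine forall₃_congr fun k _ hkj => ?_
      exact not_congr ((hB k).mono (hN hkj) ω ω' H).to_iff
    -- Each step multiplies the probability of avoidance by at most 1 - q ≤ exp(-q). The sum over
    -- `range K` compensates for the indices before K, which are not tested.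
    have hDb : ∀ j, P.real (D j) ≤
        Real.exp (-(∑ k ∈ Finset.range j, q k) + ∑ k ∈ Finset.range K, q k) := fun j => by
      by_cases hjK : j ≤ K
      · refine measureReal_le_one.trans (Real.one_le_exp ?_)
        have := Finset.sum_le_sum_of_subset_of_nonneg (Finset.range_subset_range.2 hjK)
          fun i _ _ => hq0 i
        linarith
      · push Not at hjK
        obtain ⟨d, rfl⟩ : ∃ d, j = K + d := ⟨j - K, by omega⟩
        clear hjK
        induction d with
        | zero => simp [measureReal_le_one]
        | succ d ih =>
          have h1 : D (K + (d + 1)) = D (K + d) \ B (K + d) := by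
            ext ω
            simp only [hD, Set.mem_ofPred_eq, Set.mem_sdiff]
            constructor
            · exact fun h => ⟨fun k h1 h2 => h k h1 (by omega), h _ (by omega) (by omega)⟩
            · rintro ⟨h, h'⟩ k h1 h2
              rcases Nat.lt_succ_iff_lt_or_eq.1 h2 with h3 | rfl
              · exact h k h1 h3
              · exact h'
          have h2 := measureReal_inter_add_sdiff (μ := P) (s := D (K + d)) (hB (K + d)).measurableSet
          have h3 := hq (K + d) _ (hDc (K + d))
          have h4 : P.real (D (K + (d + 1))) ≤ (1 - q (K + d)) * P.real (D (K + d)) := by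
            rw [h1]
            have e : {ω | ω ∈ B (K + d)} = B (K + d) := rfl
            rw [e] at h2
            linarith
          refine h4.trans ?_
          have h5 : 1 - q (K + d) ≤ Real.exp (-q (K + d)) := Real.one_sub_le_exp_neg _
          calc _ ≤ Real.exp (-q (K + d)) * P.real (D (K + d)) :=
                mul_le_mul_of_nonneg_right h5 measureReal_nonneg
            _ ≤ _ := mul_le_mul_of_nonneg_left ih (Real.exp_pos _).le
            _ = _ := by
              rw [← Real.exp_add, ← add_assoc K d 1, Finset.sum_range_succ]; congr 1; ring
    have hlim : Tendsto (fun j => Real.exp (-(∑ k ∈ Finset.range j, q k) +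
        ∑ k ∈ Finset.range K, q k)) atTop (𝓝 0) := by
      refine Real.tendsto_exp_atBot.comp (tendsto_atBot_add_const_right _ _ ?_)
      exact tendsto_neg_atTop_atBot.comp
        ((not_summable_iff_tendsto_nat_atTop_of_nonneg hq0).1 hdiv)
    refine le_antisymm (ge_of_tendsto' hlim fun j => ?_) measureReal_nonneg
    exact (measureReal_mono (show {ω | ∀ k, K ≤ k → ω ∉ B k} ⊆ D j from
      fun ω (hω : ∀ k, K ≤ k → ω ∉ B k) k h1 _ => hω k h1)).trans (hDb j)
  have key' : ∀ K, ∀ᵐ ω ∂P, ¬ ∀ k, K ≤ k → ω ∉ B k := fun K => by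
    rw [ae_iff]
    simp only [not_not]
    exact (measureReal_eq_zero_iff (measure_ne_top _ _)).1 (key K)
  filter_upwards [ae_all_iff.2 key'] with ω hω
  rw [Filter.frequently_atTop]
  intro K
  have := hω K
  push Not at this
  exact this

/-- Bessel's inequality for the indicator function of a set. -/
lemma sum_sq_setIntegral_le {ι : Type*} {s : Finset ι} {f : ι → (ℕ → Bool) → ℝ}
    (hc : ∀ i, ∃ n, Cyl n (f i)) (horth : ∀ i j, i ≠ j → ∫ ω, f i ω * f j ω ∂P = 0)
    (hnorm : ∀ i ∈ s, ∫ ω, f i ω * f i ω ∂P ≤ 1) (D : Set (ℕ → Bool)) :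
    ∑ i ∈ s, (∫ ω in D, f i ω ∂P) ^ 2 ≤ 1 := by
  classical
  set c : ι → ℝ := fun i => ∫ ω in D, f i ω ∂P with hcdef
  obtain ⟨n, hn⟩ : ∃ n, ∀ i ∈ s, Cyl n (f i) := by
    choose N hN using hc
    exact ⟨s.sup N, fun i hi => (hN i).mono (Finset.le_sup hi)⟩
  have hF : Cyl n (fun ω => ∑ i ∈ s, c i * f i ω) := Cyl.sum fun i hi => (hn i hi).const_mul _
  have hF2 : ∫ ω, (∑ i ∈ s, c i * f i ω) ^ 2 ∂P ≤ ∑ i ∈ s, c i ^ 2 := by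
    have h1 : ∀ ω, (∑ i ∈ s, c i * f i ω) ^ 2 = ∑ i ∈ s, ∑ j ∈ s, c i * c j * (f i ω * f j ω) :=
      fun ω => by
        rw [sq, Finset.sum_mul_sum]
        exact Finset.sum_congr rfl fun i _ => Finset.sum_congr rfl fun j _ => by ring
    have hi : ∀ i ∈ s, ∀ j ∈ s, Integrable (fun ω => c i * c j * (f i ω * f j ω)) P :=
      fun i hi j hj => (((hn i hi).mul (hn j hj)).const_mul _).integrable P
    simp only [h1]
    rw [integral_finsetSum _ fun i hi' => integrable_finsetSum _ fun j hj => hi i hi' j hj]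
    refine Finset.sum_le_sum fun i hi' => ?_
    rw [integral_finsetSum _ fun j hj => hi i hi' j hj, Finset.sum_eq_single_of_mem i hi']
    · rw [integral_const_mul, ← sq]
      exact mul_le_of_le_one_right (sq_nonneg _) (hnorm i hi')
    · intro j _ hj
      rw [integral_const_mul, horth i j hj.symm, mul_zero]
  have hFD : ∫ ω in D, (∑ i ∈ s, c i * f i ω) ∂P = ∑ i ∈ s, c i ^ 2 := by
    rw [integral_finsetSum _ fun i hi => (((hn i hi).const_mul _).integrable P).integrableOn]
    exact Finset.sum_congr rfl fun i _ => by rw [integral_const_mul, sq]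
  have h0 : 0 ≤ ∫ ω in D, (1 - ∑ i ∈ s, c i * f i ω) ^ 2 ∂P := integral_nonneg fun _ => sq_nonneg _
  have h1 : ∀ ω, (1 - ∑ i ∈ s, c i * f i ω) ^ 2 =
      (1 - 2 * ∑ i ∈ s, c i * f i ω) + (∑ i ∈ s, c i * f i ω) ^ 2 := fun ω => by ring
  have iF := hF.integrable P
  have iF2 := (hF.comp (· ^ 2)).integrable P
  simp only [h1] at h0
  have iF1 := (hF.comp fun x => 1 - 2 * x).integrable P
  rw [integral_add iF1.integrableOn iF2.integrableOn,
    integral_sub (integrable_const _).integrableOn (iF.const_mul 2).integrableOn,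
    integral_const_mul, hFD] at h0
  have h2 : ∫ ω in D, (∑ i ∈ s, c i * f i ω) ^ 2 ∂P ≤ ∫ ω, (∑ i ∈ s, c i * f i ω) ^ 2 ∂P :=
    setIntegral_le_integral iF2 (Eventually.of_forall fun _ => sq_nonneg _)
  have h3 : ∫ ω in D, (1 : ℝ) ∂P ≤ 1 := by simp [measureReal_le_one]
  linarith

end BitSystem

namespace BitSystem

/-! ### The system -/

section Definitions

variable (Q : ℕ)

/-- The logarithm of the size of the `k`-th block. -/
def ord (k : ℕ) : ℕ := 4 * k + 2 * (Q + 4)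

/-- The size of the `k`-th block. -/
def blockSize (k : ℕ) : ℕ := 2 ^ ord Q k

/-- The number of Rademacher-type functions used in the `k`-th block. -/
def radSize (k : ℕ) : ℕ := 2 ^ ord Q k - 1

/-- The index of the Rademacher-type function attached to the node `v` of the `k`-th block. -/
def radIndex (k v : ℕ) : ℕ := off (radSize Q) k + (2 ^ ord Q k - 1 - v)

/-- A prefix code for the nodes of the infinite binary tree. -/
def nodePattern (v i : ℕ) : Bool :=
  -- The level s is written in unary and closed by a zero; the binary digits of v follow. They are
  -- padded with zeros to the total length 3s + 2.
  if i < Nat.log 2 v then true else if i = Nat.log 2 v then false else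
    v.testBit (i - Nat.log 2 v - 1)

/-- The length of the code word of a node. -/
def codeLength (v : ℕ) : ℕ := 3 * Nat.log 2 v + 2

/-- The set on which the function attached to the node `v` of the `k`-th block is large. -/
def spike (k v : ℕ) : Set (ℕ → Bool) :=
  {ω | ∀ i < codeLength v, ω (2 * (off (radSize Q) k + i)) = nodePattern v i}

/-- The modulus of the function attached to the node `v` of the `k`-th block. -/
noncomputable def nodeWeight (k v : ℕ) (ω : ℕ → Bool) : ℝ :=
  -- The square is 1/2 plus a spike of integral 1/2, so its mean is 1. The constant half gives a
  -- lower bound at every point, which the divergence argument needs on arbitrary sets.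
  if Nat.log 2 v ≤ k then
    √(1 / 2) * √(1 + 2 ^ codeLength v * (spike Q k v).indicator (fun _ => 1) ω) else 1

/-- The modulus of the `n`-th Rademacher-type function. -/
noncomputable def weight (n : ℕ) : (ℕ → Bool) → ℝ :=
  nodeWeight Q (blk (radSize Q) n)
    (2 ^ ord Q (blk (radSize Q) n) - 1 - pos (radSize Q) n)

/-- The `n`-th Rademacher-type function. -/
noncomputable def radType (n : ℕ) (ω : ℕ → Bool) : ℝ := rad (2 * n + 1) ω * weight Q n ω

/-- The weight attached to the coordinate `m`. -/
noncomputable def levelWeight (m : ℕ) (ω : ℕ → Bool) : ℝ :=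
  if m % 2 = 0 then 1 else weight Q (m / 2) ω

/-- An orthonormal basis of the functions of the first `m` coordinates. -/
noncomputable def levelBasis (m j : ℕ) (ω : ℕ → Bool) : ℝ :=
  peelBasis (2 ^ m) (fun i => levelWeight Q m i.testBit) j (code m ω)

/-- An orthonormal basis of the square integrable functions. -/
noncomputable def basisFn : Option (ℕ × ℕ) → (ℕ → Bool) → ℝ
  | none => fun _ => 1
  | some x => fun ω => rad x.1 ω * levelBasis Q x.1 x.2 ω

/-- The number of basis functions at level `m` which are not of Rademacher type. -/
def restSize (m : ℕ) : ℕ := 2 ^ m - m % 2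

/-- The index of the `k`-th basis function which is not of Rademacher type. -/
def restIndex : ℕ → Option (ℕ × ℕ)
  | 0 => none
  -- At an odd level the basis function of index 0 is of Rademacher type and is skipped by the
  -- shift.
  | k + 1 => some (blk restSize k, pos restSize k + blk restSize k % 2)

/-- The index of the basis function in column `v` of the `k`-th block. -/
def columnIndex (k v : ℕ) : Option (ℕ × ℕ) :=
  if v = 0 then restIndex k else some (2 * radIndex Q k v + 1, 0)

/-- The bounded orthonormal system. -/
noncomputable def theta (n : ℕ) (ω : ℕ → Bool) : ℝ :=
  ∑ v ∈ Finset.range (2 ^ ord Q (blk (blockSize Q) n)),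
    haar (ord Q (blk (blockSize Q) n)) (pos (blockSize Q) n) v *
      basisFn Q (columnIndex Q (blk (blockSize Q) n) v) ω

end Definitions

section Weights

variable {Q : ℕ}

lemma blockSize_pos (k : ℕ) : 0 < blockSize Q k := by unfold blockSize; positivity

lemma two_pow_ord_ge (k : ℕ) : 2 ^ (k + 1) + 3 * k + 3 ≤ 2 ^ ord Q k := by
  have h1 : 2 ^ (k + 3) ≤ 2 ^ ord Q k := Nat.pow_le_pow_right (by norm_num) (by unfold ord; omega)
  have h2 : 2 ^ (k + 3) = 4 * 2 ^ (k + 1) := by rw [pow_add, pow_add]; ring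
  have h3 : k + 1 < 2 ^ (k + 1) := Nat.lt_two_pow_self
  omega

lemma lt_ord (k : ℕ) : k < ord Q k := by unfold ord; omega

lemma radSize_pos (k : ℕ) : 0 < radSize Q k := by
  have := two_pow_ord_ge (Q := Q) k
  have := Nat.one_le_two_pow (n := k)
  unfold radSize; omega

lemma restSize_pos (m : ℕ) : 0 < restSize m := by
  unfold restSize
  rcases m with _ | m
  · simp
  · have : m + 1 < 2 ^ (m + 1) := Nat.lt_two_pow_self
    omega

lemma weight_radIndex {k v : ℕ} (hv0 : v ≠ 0) (hv : v < 2 ^ ord Q k) :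
    weight Q (radIndex Q k v) = nodeWeight Q k v := by
  have h : 2 ^ ord Q k - 1 - v < radSize Q k := by unfold radSize; omega
  unfold weight radIndex
  rw [blk_off_add radSize_pos h, pos_off_add radSize_pos h,
    show 2 ^ ord Q k - 1 - (2 ^ ord Q k - 1 - v) = v by omega]

lemma exists_radIndex (n : ℕ) : ∃ k v, v ≠ 0 ∧ v < 2 ^ ord Q k ∧ radIndex Q k v = n := by
  have h1 := pos_lt (radSize_pos (Q := Q)) n
  have h2 := off_blk_add_pos (w := radSize Q) n
  change _ < 2 ^ _ - 1 at h1
  refine ⟨blk (radSize Q) n, 2 ^ ord Q (blk (radSize Q) n) - 1 - pos (radSize Q) n, ?_, ?_, ?_⟩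
  · omega
  · omega
  · unfold radIndex; omega

lemma radIndex_inj {k v k' v' : ℕ} (hv0 : v ≠ 0) (hv : v < 2 ^ ord Q k) (hv0' : v' ≠ 0)
    (hv' : v' < 2 ^ ord Q k') (h : radIndex Q k v = radIndex Q k' v') : k = k' ∧ v = v' := by
  have h1 : 2 ^ ord Q k - 1 - v < radSize Q k := by unfold radSize; omega
  have h2 : 2 ^ ord Q k' - 1 - v' < radSize Q k' := by unfold radSize; omega
  have e1 := congrArg (blk (radSize Q)) h
  have e2 := congrArg (pos (radSize Q)) h
  unfold radIndex at e1 e2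
  rw [blk_off_add radSize_pos h1, blk_off_add radSize_pos h2] at e1
  rw [pos_off_add radSize_pos h1, pos_off_add radSize_pos h2] at e2
  subst e1
  omega

lemma off_le_radIndex (k v : ℕ) : off (radSize Q) k ≤ radIndex Q k v := by unfold radIndex; omega

lemma radIndex_lt {k v : ℕ} (hv0 : v ≠ 0) : radIndex Q k v < off (radSize Q) (k + 1) := by
  have := radSize_pos (Q := Q) k
  rw [off_succ]; unfold radIndex radSize at *; omega

lemma nodeWeight_pos (k v : ℕ) (ω : ℕ → Bool) : 0 < nodeWeight Q k v ω := by
  unfold nodeWeight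
  split_ifs
  · have : 0 ≤ (spike Q k v).indicator (fun _ => (1 : ℝ)) ω :=
      Set.indicator_nonneg (fun _ _ => zero_le_one) ω
    positivity
  · exact one_pos

lemma nodeWeight_sq {k v : ℕ} (h : Nat.log 2 v ≤ k) (ω : ℕ → Bool) :
    nodeWeight Q k v ω ^ 2 =
      1 / 2 + 1 / 2 * (2 ^ codeLength v * (spike Q k v).indicator (fun _ => 1) ω) := by
  have : 0 ≤ (spike Q k v).indicator (fun _ => (1 : ℝ)) ω :=
    Set.indicator_nonneg (fun _ _ => zero_le_one) ω
  rw [nodeWeight, if_pos h, mul_pow, Real.sq_sqrt (by norm_num), Real.sq_sqrt (by positivity)]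
  ring

lemma half_le_nodeWeight_sq (k v : ℕ) (ω : ℕ → Bool) : 1 / 2 ≤ nodeWeight Q k v ω ^ 2 := by
  by_cases h : Nat.log 2 v ≤ k
  · have : 0 ≤ (spike Q k v).indicator (fun _ => (1 : ℝ)) ω :=
      Set.indicator_nonneg (fun _ _ => zero_le_one) ω
    rw [nodeWeight_sq h]
    have : 0 ≤ 1 / 2 * (2 ^ codeLength v * (spike Q k v).indicator (fun _ => (1 : ℝ)) ω) := by
      positivity
    linarith
  · rw [nodeWeight, if_neg h]; norm_num

lemma nodeWeight_two_values (k v : ℕ) : ∃ Z₁ Z₂ : ℝ, ∀ ω, nodeWeight Q k v ω = Z₁ ∨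
    nodeWeight Q k v ω = Z₂ := by
  by_cases h : Nat.log 2 v ≤ k
  · refine ⟨√(1 / 2) * √(1 + 2 ^ codeLength v * 1), √(1 / 2) * √(1 + 2 ^ codeLength v * 0),
      fun ω => ?_⟩
    simp only [nodeWeight, if_pos h]
    by_cases hω : ω ∈ spike Q k v
    · rw [Set.indicator_of_mem hω]; exact Or.inl rfl
    · rw [Set.indicator_of_notMem hω]; exact Or.inr rfl
  · exact ⟨1, 1, fun ω => by simp [nodeWeight, h]⟩

lemma measurableSet_spike (k v : ℕ) : MeasurableSet (spike Q k v) :=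
  measurableSet_cylinder (fun i => 2 * (off (radSize Q) k + i)) (nodePattern v) (codeLength v)

lemma cyl_spike (k v : ℕ) : Cyl (2 * (off (radSize Q) k + codeLength v)) (· ∈ spike Q k v) := by
  intro ω ω' H
  simp only [spike, Set.mem_ofPred_eq, eq_iff_iff]
  refine forall₂_congr fun i hi => ?_
  rw [H _ (by omega)]

lemma spike_flip_odd (k v m : ℕ) (ω : ℕ → Bool) :
    flipBit (2 * m + 1) ω ∈ spike Q k v ↔ ω ∈ spike Q k v := by
  simp only [spike, Set.mem_ofPred_eq]
  refine forall₂_congr fun i hi => ?_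
  rw [flipBit_of_ne (by omega)]

lemma indicator_spike_congr {k v : ℕ} {ω ω' : ℕ → Bool} (h : ω ∈ spike Q k v ↔ ω' ∈ spike Q k v) :
    (spike Q k v).indicator (fun _ => (1 : ℝ)) ω = (spike Q k v).indicator (fun _ => 1) ω' := by
  by_cases hω : ω ∈ spike Q k v
  · rw [Set.indicator_of_mem hω, Set.indicator_of_mem (h.1 hω)]
  · rw [Set.indicator_of_notMem hω, Set.indicator_of_notMem fun h' => hω (h.2 h')]

lemma nodeWeight_flip_odd (k v m : ℕ) (ω : ℕ → Bool) :
    nodeWeight Q k v (flipBit (2 * m + 1) ω) = nodeWeight Q k v ω := by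
  simp only [nodeWeight, indicator_spike_congr (spike_flip_odd k v m ω)]

lemma codeLength_le {k v : ℕ} (hvk : Nat.log 2 v ≤ k) : codeLength v ≤ 3 * k + 2 := by
  unfold codeLength; omega

lemma lt_of_log_le {k v : ℕ} (hvk : Nat.log 2 v ≤ k) : v < 2 ^ (k + 1) :=
  (Nat.lt_pow_succ_log_self (by norm_num) v).trans_le
    (Nat.pow_le_pow_right (by norm_num) (by omega))

/-- The reversed order in `radIndex` matters: nodes of low level come last in their block, after the
even coordinates that decide their spikes. Hence each weight is known before its sign, which is what
makes the series predictable. -/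
lemma cyl_nodeWeight (k v : ℕ) : Cyl (2 * radIndex Q k v + 1) (nodeWeight Q k v) := by
  by_cases h : Nat.log 2 v ≤ k
  · have h1 := codeLength_le h
    have h2 := lt_of_log_le h
    have h3 := two_pow_ord_ge (Q := Q) k
    have h4 := (cyl_spike (Q := Q) k v).mono
      (show _ ≤ 2 * radIndex Q k v + 1 by unfold radIndex; omega)
    intro ω ω' H
    simp only [nodeWeight, indicator_spike_congr (h4 ω ω' H).to_iff]
  · intro ω ω' _
    simp only [nodeWeight, if_neg h]

lemma cyl_weight (n : ℕ) : Cyl (2 * n + 1) (weight Q n) := by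
  obtain ⟨k, v, h0, hv, rfl⟩ := exists_radIndex (Q := Q) n
  rw [weight_radIndex h0 hv]
  exact cyl_nodeWeight k v

lemma weight_flip_odd (n m : ℕ) (ω : ℕ → Bool) :
    weight Q n (flipBit (2 * m + 1) ω) = weight Q n ω := nodeWeight_flip_odd _ _ _ _

lemma weight_pos (n : ℕ) (ω : ℕ → Bool) : 0 < weight Q n ω := nodeWeight_pos _ _ _

lemma half_le_weight_sq (n : ℕ) (ω : ℕ → Bool) : 1 / 2 ≤ weight Q n ω ^ 2 :=
  half_le_nodeWeight_sq _ _ _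

variable {P : Measure (ℕ → Bool)} [FlipInvariant P]

/-- The spikes of block k only read even coordinates from `2 * off (radSize Q) k` on, so they are
independent of the preceding blocks. -/
lemma measureReal_inter_spike {D : Set (ℕ → Bool)} {k : ℕ}
    (hD : Cyl (2 * off (radSize Q) k) (· ∈ D)) (v : ℕ) :
    P.real (D ∩ spike Q k v) = (1 / 2) ^ codeLength v * P.real D :=
  measureReal_inter_cylinder (pos := fun i => 2 * (off (radSize Q) k + i))
    (fun i j h => by simp only at h; omega) _ hD.measurableSet _
    fun i _ ω => (hD.flip (by omega) ω).to_iff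

lemma measureReal_spike (k v : ℕ) : P.real (spike Q k v) = (1 / 2) ^ codeLength v := by
  have := measureReal_inter_spike (P := P) (D := Set.univ) (Q := Q) (k := k)
    (fun _ _ _ => rfl) v
  simpa using this

lemma integral_nodeWeight_sq (k v : ℕ) : ∫ ω, nodeWeight Q k v ω ^ 2 ∂P = 1 := by
  by_cases h : Nat.log 2 v ≤ k
  · simp only [nodeWeight_sq h]
    have hi : Integrable ((spike Q k v).indicator fun _ => (1 : ℝ)) P :=
      (integrable_const _).indicator (measurableSet_spike k v)
    rw [integral_add (integrable_const _) ((hi.const_mul _).const_mul _), integral_const_mul,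
      integral_const_mul, integral_indicator_const _ (measurableSet_spike k v), measureReal_spike]
    simp only [integral_const, probReal_univ, smul_eq_mul, one_mul, mul_one]
    rw [← mul_pow]; norm_num
  · simp [nodeWeight, h]

lemma integral_weight_sq (n : ℕ) : ∫ ω, weight Q n ω ^ 2 ∂P = 1 := integral_nodeWeight_sq _ _

/-! ### The orthonormal basis -/

lemma levelWeight_odd (n : ℕ) : levelWeight Q (2 * n + 1) = weight Q n := by
  ext ω
  rw [levelWeight, if_neg (by omega), show (2 * n + 1) / 2 = n by omega]

lemma cyl_levelWeight (m : ℕ) : Cyl m (levelWeight Q m) := by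
  rcases Nat.even_or_odd' m with ⟨n, rfl | rfl⟩
  · intro ω ω' _
    simp [levelWeight]
  · rw [levelWeight_odd]; exact cyl_weight n

lemma levelWeight_pos (m : ℕ) (ω : ℕ → Bool) : 0 < levelWeight Q m ω := by
  unfold levelWeight; split_ifs
  · exact one_pos
  · exact weight_pos _ _

lemma levelWeight_two_values (m : ℕ) : ∃ Z₁ Z₂ : ℝ, ∀ ω, levelWeight Q m ω = Z₁ ∨
    levelWeight Q m ω = Z₂ := by
  by_cases h : m % 2 = 0
  · exact ⟨1, 1, fun ω => by simp [levelWeight, h]⟩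
  · obtain ⟨Z₁, Z₂, hZ⟩ := nodeWeight_two_values (Q := Q) (blk (radSize Q) (m / 2))
      (2 ^ ord Q (blk (radSize Q) (m / 2)) - 1 - pos (radSize Q) (m / 2))
    exact ⟨Z₁, Z₂, fun ω => by simpa only [levelWeight, if_neg h, weight] using hZ ω⟩

/-- The normalisation required by `peelBasis`. The assertion is purely finite; the measure serves
only to evaluate the sum as 2^m times an integral. -/
lemma sum_levelWeight_sq (P : Measure (ℕ → Bool)) [FlipInvariant P] (m : ℕ) :
    ∑ i ∈ Finset.range (2 ^ m), levelWeight Q m i.testBit ^ 2 = (2 ^ m : ℕ) := by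
  have h1 : ∫ ω, levelWeight Q m ω ^ 2 ∂P = 1 := by
    unfold levelWeight
    split_ifs
    · simp
    · exact integral_weight_sq _
  have h2 : ∀ ω, levelWeight Q m ω ^ 2 = (fun i : ℕ => levelWeight Q m i.testBit ^ 2) (code m ω) :=
    fun ω => by simp only [(cyl_levelWeight m).eq_testBit_code ω]
  rw [show (fun ω => levelWeight Q m ω ^ 2) = fun ω =>
    (fun i : ℕ => levelWeight Q m i.testBit ^ 2) (code m ω) from funext h2] at h1
  rw [integral_code m fun i => levelWeight Q m i.testBit ^ 2] at h1
  push_cast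
  rw [one_div, inv_pow, inv_mul_eq_iff_eq_mul₀ (by positivity), mul_one] at h1
  exact h1

lemma cyl_levelBasis (m j : ℕ) : Cyl m (levelBasis Q m j) := (cyl_code m).comp _

lemma levelBasis_zero (m : ℕ) : levelBasis Q m 0 = levelWeight Q m := by
  ext ω
  simp only [levelBasis, peelBasis, if_true]
  exact ((cyl_levelWeight m).eq_testBit_code ω).symm

lemma abs_levelBasis_le (P : Measure (ℕ → Bool)) [FlipInvariant P] {m j : ℕ} (hj : j < 2 ^ m) (ω : ℕ → Bool) :
    |levelBasis Q m j ω| ≤ √2 ^ m := by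
  have := abs_peelBasis_le (fun i _ => levelWeight_pos m _) (sum_levelWeight_sq (Q := Q) P m) hj
    (code_lt m ω)
  refine this.trans_eq ?_
  push_cast
  rw [← sqrt_two_pow_mul_self, Real.sqrt_mul_self (by positivity)]

lemma integral_levelBasis_mul {m j l : ℕ} (hj : j < 2 ^ m) (hl : l < 2 ^ m) :
    ∫ ω, levelBasis Q m j ω * levelBasis Q m l ω ∂P = if j = l then 1 else 0 := by
  have := peelBasis_orthogonal (fun i _ => levelWeight_pos m _) (sum_levelWeight_sq (Q := Q) P m)
    j hj l hl
  simp only [levelBasis]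
  rw [integral_code m fun i => peelBasis (2 ^ m) (fun i => levelWeight Q m i.testBit) j i *
    peelBasis (2 ^ m) (fun i => levelWeight Q m i.testBit) l i, this]
  split_ifs
  · push_cast; rw [← mul_pow]; norm_num
  · simp

/-- Admissible indices of basis functions. -/
def ValidIndex : Option (ℕ × ℕ) → Prop
  | none => True
  | some x => x.2 < 2 ^ x.1

/-- At different levels the sign of the higher level is odd under its own flip while all else is
unaffected; at the same level the signs cancel and orthonormality of the peeling basis remains. -/
lemma integral_basisFn_mul {x y : Option (ℕ × ℕ)} (hx : ValidIndex x) (hy : ValidIndex y) :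
    ∫ ω, basisFn Q x ω * basisFn Q y ω ∂P = if x = y then 1 else 0 := by
  have key : ∀ m j m' j', m < m' → ∫ ω, basisFn Q (some (m, j)) ω * basisFn Q (some (m', j')) ω ∂P
      = 0 := fun m j m' j' h => by
    have e : ∀ ω, basisFn Q (some (m, j)) ω * basisFn Q (some (m', j')) ω =
        rad m' ω * (rad m ω * levelBasis Q m j ω * levelBasis Q m' j' ω) := fun ω => by
      simp only [basisFn]; ring
    simp only [e]
    exact integral_rad_mul_cyl (((cyl_rad h).mul ((cyl_levelBasis m j).mono h.le)).mul
      (cyl_levelBasis m' j'))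
  rcases x with _ | ⟨m, j⟩ <;> rcases y with _ | ⟨m', j'⟩
  · simp [basisFn]
  · simpa [basisFn] using integral_rad_mul_cyl (P := P) (cyl_levelBasis (Q := Q) m' j')
  · simpa [basisFn] using integral_rad_mul_cyl (P := P) (cyl_levelBasis (Q := Q) m j)
  · rcases lt_trichotomy m m' with h | rfl | h
    · rw [key m j m' j' h, if_neg (by simp; omega)]
    · have e : ∀ ω, basisFn Q (some (m, j)) ω * basisFn Q (some (m, j')) ω =
          levelBasis Q m j ω * levelBasis Q m j' ω := fun ω => by
        simp only [basisFn]
        linear_combination (levelBasis Q m j ω * levelBasis Q m j' ω) * rad_mul_self m ω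
      simp only [e]
      rw [integral_levelBasis_mul hx hy]
      simp
    · simp only [mul_comm (basisFn Q (some (m, j)) _)]
      rw [key m' j' m j h, if_neg (by simp; omega)]

lemma basisFn_radType (n : ℕ) : basisFn Q (some (2 * n + 1, 0)) = radType Q n := by
  ext ω
  simp only [basisFn, levelBasis_zero, levelWeight_odd, radType]

lemma restIndex_valid (k : ℕ) : ValidIndex (restIndex k) := by
  rcases k with _ | k
  · trivial
  · have := pos_lt restSize_pos k
    simp only [restIndex, ValidIndex]
    change pos _ k < 2 ^ _ - _ at this
    omega

lemma columnIndex_valid (k v : ℕ) : ValidIndex (columnIndex Q k v) := by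
  unfold columnIndex
  split_ifs
  · exact restIndex_valid k
  · simp [ValidIndex]

lemma restIndex_inj {k k' : ℕ} (h : restIndex k = restIndex k') : k = k' := by
  rcases k with _ | k <;> rcases k' with _ | k'
  · rfl
  · simp [restIndex] at h
  · simp [restIndex] at h
  · simp only [restIndex, Option.some.injEq, Prod.mk.injEq] at h
    have h1 := off_blk_add_pos (w := restSize) k
    have h2 := off_blk_add_pos (w := restSize) k'
    rw [h.1] at h1 h
    omega

lemma restIndex_ne (k n : ℕ) : restIndex k ≠ some (2 * n + 1, 0) := by
  rcases k with _ | k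
  · simp [restIndex]
  · simp only [restIndex, ne_eq, Option.some.injEq, Prod.mk.injEq, not_and]
    intro h
    rw [h]; omega

lemma columnIndex_inj {k v k' v' : ℕ} (hv : v < 2 ^ ord Q k) (hv' : v' < 2 ^ ord Q k')
    (h : columnIndex Q k v = columnIndex Q k' v') : k = k' ∧ v = v' := by
  unfold columnIndex at h
  split_ifs at h with h1 h2 h2
  · exact ⟨restIndex_inj h, by rw [h1, h2]⟩
  · exact absurd h (restIndex_ne _ _)
  · exact absurd h.symm (restIndex_ne _ _)
  · simp only [Option.some.injEq, Prod.mk.injEq, and_true] at h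
    exact radIndex_inj h1 hv h2 hv' (by omega)

lemma exists_columnIndex {x : Option (ℕ × ℕ)} (hx : ValidIndex x) :
    ∃ k v, v < 2 ^ ord Q k ∧ columnIndex Q k v = x := by
  rcases x with _ | ⟨m, j⟩
  · exact ⟨0, 0, by positivity, by simp [columnIndex, restIndex]⟩
  · by_cases h : m % 2 = 1 ∧ j = 0
    · obtain ⟨k, v, h0, hv, he⟩ := exists_radIndex (Q := Q) (m / 2)
      refine ⟨k, v, hv, ?_⟩
      rw [columnIndex, if_neg h0, he, h.2, show 2 * (m / 2) + 1 = m by omega]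
    · have hj : j - m % 2 < restSize m := by
        simp only [ValidIndex] at hx
        unfold restSize; omega
      refine ⟨off restSize m + (j - m % 2) + 1, 0, by positivity, ?_⟩
      rw [columnIndex, if_pos rfl]
      simp only [restIndex]
      rw [blk_off_add restSize_pos hj, pos_off_add restSize_pos hj]
      rw [show j - m % 2 + m % 2 = j by omega]

lemma cyl_basisFn_restIndex (k : ℕ) : Cyl k (basisFn Q (restIndex k)) := by
  rcases k with _ | k
  · exact Cyl.const 1
  · have := blk_le (w := restSize) k
    simp only [restIndex, basisFn]
    exact (cyl_rad (by omega)).mul ((cyl_levelBasis _ _).mono (by omega))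

lemma cyl_radType {n m : ℕ} (h : n < m) : Cyl (2 * m) (radType Q n) :=
  (cyl_rad (by omega)).mul ((cyl_weight n).mono (by omega))

lemma le_off_radSize (k : ℕ) : k ≤ off (radSize Q) k := le_off radSize_pos k

lemma cyl_column {k v : ℕ} :
    Cyl (2 * off (radSize Q) (k + 1)) (basisFn Q (columnIndex Q k v)) := by
  unfold columnIndex
  split_ifs with h
  · refine (cyl_basisFn_restIndex k).mono ?_
    have := le_off_radSize (Q := Q) (k + 1)
    omega
  · rw [basisFn_radType]
    exact cyl_radType (radIndex_lt h)

lemma abs_basisFn_restIndex_le (P : Measure (ℕ → Bool)) [FlipInvariant P] (k : ℕ) (ω : ℕ → Bool) :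
    |basisFn Q (restIndex k) ω| ≤ √2 ^ k := by
  have h1 : (1 : ℝ) ≤ √2 := Real.one_le_sqrt.2 (by norm_num)
  rcases k with _ | k
  · simp [restIndex, basisFn]
  · have hv := restIndex_valid (k + 1)
    simp only [restIndex, basisFn, ValidIndex] at hv ⊢
    rw [abs_mul, abs_rad, one_mul]
    refine (abs_levelBasis_le P hv ω).trans (pow_le_pow_right₀ h1 ?_)
    have := blk_le (w := restSize) k
    omega

/-! ### Orthonormality, boundedness and completeness of the system -/

lemma theta_off_add {k i : ℕ} (hi : i < 2 ^ ord Q k) (ω : ℕ → Bool) :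
    theta Q (off (blockSize Q) k + i) ω = ∑ v ∈ Finset.range (2 ^ ord Q k),
      haar (ord Q k) i v * basisFn Q (columnIndex Q k v) ω := by
  rw [theta, blk_off_add blockSize_pos hi, pos_off_add blockSize_pos hi]

lemma exists_theta_index (n : ℕ) : ∃ k i, i < 2 ^ ord Q k ∧ off (blockSize Q) k + i = n :=
  ⟨_, _, pos_lt blockSize_pos n, off_blk_add_pos n⟩

lemma cyl_theta_block {k i : ℕ} (hi : i < 2 ^ ord Q k) :
    Cyl (2 * off (radSize Q) (k + 1)) (theta Q (off (blockSize Q) k + i)) := by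
  rw [funext (theta_off_add hi)]
  exact Cyl.sum fun v _ => cyl_column.const_mul _

lemma exists_cyl_theta (n : ℕ) : ∃ m, Cyl m (theta Q n) := by
  obtain ⟨k, i, hi, rfl⟩ := exists_theta_index (Q := Q) n
  exact ⟨_, cyl_theta_block hi⟩

lemma integral_theta_mul (n n' : ℕ) :
    ∫ ω, theta Q n ω * theta Q n' ω ∂P = if n = n' then 1 else 0 := by
  obtain ⟨k, i, hi, rfl⟩ := exists_theta_index (Q := Q) n
  obtain ⟨k', i', hi', rfl⟩ := exists_theta_index (Q := Q) n'
  simp only [theta_off_add hi, theta_off_add hi']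
  have e : ∀ ω, (∑ v ∈ Finset.range (2 ^ ord Q k),
      haar (ord Q k) i v * basisFn Q (columnIndex Q k v) ω) *
      (∑ v ∈ Finset.range (2 ^ ord Q k'),
      haar (ord Q k') i' v * basisFn Q (columnIndex Q k' v) ω) =
      ∑ v ∈ Finset.range (2 ^ ord Q k), ∑ v' ∈ Finset.range (2 ^ ord Q k'),
        haar (ord Q k) i v * haar (ord Q k') i' v' *
          (basisFn Q (columnIndex Q k v) ω * basisFn Q (columnIndex Q k' v') ω) := fun ω => by
    rw [Finset.sum_mul_sum]
    exact Finset.sum_congr rfl fun _ _ => Finset.sum_congr rfl fun _ _ => by ring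
  have hint : ∀ v v' : ℕ, Integrable (fun ω => haar (ord Q k) i v * haar (ord Q k') i' v' *
      (basisFn Q (columnIndex Q k v) ω * basisFn Q (columnIndex Q k' v') ω)) P := fun v v' => by
    have h1 := (cyl_column (Q := Q) (k := k) (v := v)).mono
      (le_max_left _ (2 * off (radSize Q) (k' + 1)))
    have h2 := (cyl_column (Q := Q) (k := k') (v := v')).mono
      (le_max_right (2 * off (radSize Q) (k + 1)) _)
    exact ((h1.mul h2).const_mul _).integrable P
  simp only [e]
  rw [integral_finsetSum _ fun v _ => integrable_finsetSum _ fun v' _ => hint v v']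
  simp only [fun v => integral_finsetSum (μ := P) (Finset.range (2 ^ ord Q k'))
    fun v' _ => hint v v', integral_const_mul,
    integral_basisFn_mul (columnIndex_valid _ _) (columnIndex_valid _ _)]
  by_cases hk : k = k'
  · subst hk
    have h1 : ∀ v ∈ Finset.range (2 ^ ord Q k), ∑ v' ∈ Finset.range (2 ^ ord Q k),
        haar (ord Q k) i v * haar (ord Q k) i' v' *
          (if columnIndex Q k v = columnIndex Q k v' then (1 : ℝ) else 0) =
        haar (ord Q k) i v * haar (ord Q k) i' v := fun v hv => by
      rw [Finset.sum_eq_single_of_mem v hv]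
      · simp
      · intro v' hv' hne
        rw [if_neg, mul_zero]
        exact fun h => hne (columnIndex_inj (Finset.mem_range.1 hv) (Finset.mem_range.1 hv') h).2.symm
    rw [Finset.sum_congr rfl h1, haar_row_orthogonal _ _ hi _ hi']
    simp
  · rw [if_neg, Finset.sum_eq_zero]
    · intro v hv
      refine Finset.sum_eq_zero fun v' hv' => ?_
      rw [if_neg, mul_zero]
      exact fun h => hk (columnIndex_inj (Finset.mem_range.1 hv) (Finset.mem_range.1 hv') h).1
    · intro h
      have := congrArg (blk (blockSize Q)) h
      rw [blk_off_add blockSize_pos hi, blk_off_add blockSize_pos hi'] at this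
      exact hk this

end Weights

end BitSystem

namespace BitSystem

/-! ### Uniform bound and span of the system -/

variable {Q : ℕ}

lemma nodeWeight_le (k v : ℕ) (ω : ℕ → Bool) : nodeWeight Q k v ω ≤ √2 ^ codeLength v := by
  have h2 : (1 : ℝ) ≤ 2 ^ codeLength v := one_le_pow₀ (by norm_num)
  refine (pow_le_pow_iff_left₀ (nodeWeight_pos _ _ _).le (by positivity) two_ne_zero).1 ?_
  rw [sq (√2 ^ _), sqrt_two_pow_mul_self]
  by_cases h : Nat.log 2 v ≤ k
  · rw [nodeWeight_sq h]
    have : (spike Q k v).indicator (fun _ => (1 : ℝ)) ω ≤ 1 :=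
      Set.indicator_le_self' (fun _ _ => zero_le_one) ω
    have := mul_le_mul_of_nonneg_left this (show (0 : ℝ) ≤ 2 ^ codeLength v by positivity)
    linarith
  · rw [nodeWeight, if_neg h]; linarith

/-- The growth that the Haar normalisation has to absorb: entry times peak of the weight is of order
4^s / √2^p, and spikes occur only up to level k. -/
lemma sqrt_two_pow_codeLength_node {s q : ℕ} (hq : q < 2 ^ s) :
    √2 ^ s * √2 ^ codeLength (2 ^ s + q) = 2 * 4 ^ s := by
  rw [codeLength, log_two_pow_add hq, ← pow_add, show s + (3 * s + 2) = 2 * (2 * s + 1) by ring,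
    pow_mul, Real.sq_sqrt (by norm_num), pow_succ, pow_mul]
  norm_num; ring

/-- A geometric sum below 1/(√2 - 1); this is where the constant 1 + √2 comes from. -/
lemma sum_sqrt_two_pow_le (p : ℕ) :
    ∑ s ∈ Finset.range p, √2 ^ s / √2 ^ p ≤ 1 + √2 := by
  have h1 : (1 : ℝ) < √2 := by
    rw [Real.lt_sqrt] <;> norm_num
  have h2 := Real.mul_self_sqrt (show (0 : ℝ) ≤ 2 by norm_num)
  have hp := sqrt_two_pow_pos p
  rw [← Finset.sum_div, geom_sum_eq h1.ne', div_div, div_le_iff₀ (by nlinarith)]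
  nlinarith

lemma abs_theta_le (P : Measure (ℕ → Bool)) [FlipInvariant P] (n : ℕ) (ω : ℕ → Bool) :
    |theta Q n ω| ≤ 1 + √2 + (1 / 2) ^ Q := by
  obtain ⟨k, i, hi, rfl⟩ := exists_theta_index (Q := Q) n
  rw [theta_off_add hi]
  set p := ord Q k with hp
  have hpp := sqrt_two_pow_pos p
  refine (Finset.abs_sum_le_sum_abs _ _).trans ?_
  simp only [abs_mul]
  rw [sum_range_two_pow, haar_zero]
  have hlevel : ∀ s ∈ Finset.range p, ∑ q ∈ Finset.range (2 ^ s), |haar p i (2 ^ s + q)| *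
      |basisFn Q (columnIndex Q k (2 ^ s + q)) ω| ≤
      √2 ^ s / √2 ^ p + if s ∈ Finset.range (k + 1) then 2 * 4 ^ s / √2 ^ p else 0 := by
    intro s hs
    have hsp := Finset.mem_range.1 hs
    rw [sum_haar_level hsp.le hi fun q => |basisFn Q (columnIndex Q k (2 ^ s + q)) ω|]
    have hq := div_pow_lt hsp.le hi
    set q := i / 2 ^ (p - s)
    have hv0 : 2 ^ s + q ≠ 0 := by positivity
    have hv : 2 ^ s + q < 2 ^ ord Q k := by
      have := Nat.pow_le_pow_right (n := 2) (by norm_num) (Nat.succ_le_of_lt hsp)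
      rw [pow_succ] at this
      rw [← hp]; omega
    rw [columnIndex, if_neg hv0, basisFn_radType, radType, weight_radIndex hv0 hv, abs_mul,
      abs_rad, one_mul, abs_of_pos (nodeWeight_pos _ _ _)]
    split_ifs with hk
    · have h1 := nodeWeight_le (Q := Q) k (2 ^ s + q) ω
      calc _ ≤ √2 ^ s / √2 ^ p * √2 ^ codeLength (2 ^ s + q) := by gcongr
        _ = 2 * 4 ^ s / √2 ^ p := by
          rw [div_mul_eq_mul_div, sqrt_two_pow_codeLength_node hq]
        _ ≤ _ := le_add_of_nonneg_left (by positivity)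
    · rw [nodeWeight, if_neg, mul_one, add_zero]
      rw [log_two_pow_add hq]
      rw [Finset.mem_range] at hk
      omega
  refine (add_le_add_right (Finset.sum_le_sum hlevel) _).trans ?_
  rw [Finset.sum_add_distrib, ← Finset.sum_filter]
  have hfil : (Finset.range p).filter (· ∈ Finset.range (k + 1)) = Finset.range (k + 1) := by
    ext s
    have := lt_ord (Q := Q) k
    simp only [Finset.mem_filter, Finset.mem_range]; omega
  rw [hfil]
  have h1 : ∑ s ∈ Finset.range (k + 1), 2 * (4 : ℝ) ^ s / √2 ^ p ≤ 4 * 4 ^ k / √2 ^ p := by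
    rw [← Finset.sum_div, ← Finset.mul_sum, geom_sum_eq (by norm_num)]
    refine div_le_div_of_nonneg_right ?_ hpp.le
    rw [pow_succ]
    have : (0 : ℝ) < 4 ^ k := by positivity
    linarith
  have h2 : |1 / √2 ^ p| * |basisFn Q (columnIndex Q k 0) ω| ≤ 4 ^ k / √2 ^ p := by
    rw [columnIndex, if_pos rfl, abs_of_pos (by positivity), one_div_mul_eq_div]
    gcongr
    refine (abs_basisFn_restIndex_le P k ω).trans (pow_le_pow_left₀ (Real.sqrt_nonneg 2) ?_ k)
    rw [Real.sqrt_le_left] <;> norm_num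
  have h3 := sum_sqrt_two_pow_le p
  -- The choice of `ord` makes √2^p = 16 · 4^k · 2^Q, so that 5/16 of the allowed error is used.
  have h4 : 4 ^ k / √2 ^ p + 4 * 4 ^ k / √2 ^ p ≤ (1 / 2 : ℝ) ^ Q := by
    rw [← add_div, div_le_iff₀ hpp, hp, ord, show 4 * k + 2 * (Q + 4) = 2 * (2 * k + (Q + 4)) by ring,
      pow_mul, Real.sq_sqrt (by norm_num), pow_add, pow_add, mul_comm ((2 : ℝ) ^ (2 * k)),
      ← mul_assoc, ← mul_assoc, ← mul_pow, pow_mul]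
    norm_num
    have : (0 : ℝ) < 4 ^ k := by positivity
    linarith
  linarith

variable {P : Measure (ℕ → Bool)} [FlipInvariant P]

/-- The transpose of the Haar matrix undoes the rotation of the block that contains x. -/
lemma basisFn_mem_span {x : Option (ℕ × ℕ)} (hx : ValidIndex x) :
    basisFn Q x ∈ Submodule.span ℝ (Set.range (theta Q)) := by
  obtain ⟨k, v, hv, rfl⟩ := exists_columnIndex (Q := Q) hx
  have : basisFn Q (columnIndex Q k v) = ∑ i ∈ Finset.range (2 ^ ord Q k),
      haar (ord Q k) i v • theta Q (off (blockSize Q) k + i) := by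
    ext ω
    rw [Finset.sum_apply]
    have h1 : ∀ i ∈ Finset.range (2 ^ ord Q k),
        (haar (ord Q k) i v • theta Q (off (blockSize Q) k + i)) ω =
        ∑ w ∈ Finset.range (2 ^ ord Q k), (haar (ord Q k) i v * haar (ord Q k) i w) *
          basisFn Q (columnIndex Q k w) ω := fun i hi => by
      rw [Pi.smul_apply, theta_off_add (Finset.mem_range.1 hi), smul_eq_mul, Finset.mul_sum]
      exact Finset.sum_congr rfl fun _ _ => by ring
    rw [Finset.sum_congr rfl h1, Finset.sum_comm, Finset.sum_eq_single_of_mem v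
      (Finset.mem_range.2 hv)]
    · rw [← Finset.sum_mul, haar_column_orthogonal _ v hv v hv, if_pos rfl, one_mul]
    · intro w hw hne
      rw [← Finset.sum_mul, haar_column_orthogonal _ v hv w (Finset.mem_range.1 hw),
        if_neg hne.symm, zero_mul]
  rw [this]
  exact Submodule.sum_mem _ fun i _ => Submodule.smul_mem _ _ (Submodule.subset_span ⟨_, rfl⟩)

/-- Every cylinder function is a linear combination of the system. -/
lemma cyl_mem_span (P : Measure (ℕ → Bool)) [FlipInvariant P] {n : ℕ} {f : (ℕ → Bool) → ℝ}
    (hf : Cyl n f) : f ∈ Submodule.span ℝ (Set.range (theta Q)) := by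
  induction n generalizing f with
  | zero =>
    have : f = f (fun _ => false) • basisFn Q none := by
      ext ω
      simp only [basisFn, Pi.smul_apply, smul_eq_mul, mul_one]
      exact hf _ _ (by simp)
    rw [this]
    exact Submodule.smul_mem _ _ (basisFn_mem_span trivial)
  | succ n ih =>
    -- Even and odd parts in the coordinate n. The odd part is `rad n` times a function of the first
    -- n coordinates, which is expanded in the basis of level n.
    set g : (ℕ → Bool) → ℝ := fun ω =>
      (f (Function.update ω n false) + f (Function.update ω n true)) / 2 with hg
    set h : (ℕ → Bool) → ℝ := fun ω =>
      (f (Function.update ω n false) - f (Function.update ω n true)) / 2 with hh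
    have hu : ∀ b, Cyl n (fun ω => f (Function.update ω n b)) := fun b ω ω' H => by
      refine hf _ _ fun i hi => ?_
      by_cases hin : i = n
      · subst hin; simp
      · simp only [Function.update_of_ne hin]; exact H i (by omega)
    have hgc : Cyl n g := (hu false).comp₂ (hu true) fun x y => (x + y) / 2
    have hhc : Cyl n h := (hu false).comp₂ (hu true) fun x y => (x - y) / 2
    have hfeq : f = g + fun ω => rad n ω * h ω := by
      ext ω
      have : f ω = f (Function.update ω n (ω n)) := by rw [Function.update_eq_self]
      simp only [hg, hh, Pi.add_apply, rad]
      rw [this]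
      cases ω n <;> simp <;> ring
    rw [hfeq]
    refine Submodule.add_mem _ (ih hgc) ?_
    set φ : ℕ → ℝ := fun i => levelWeight Q n i.testBit
    have hcol := column_orthogonal (B := peelBasis (2 ^ n) φ)
      (c := ((2 ^ n : ℕ) : ℝ)) (by positivity)
      (peelBasis_orthogonal (fun i _ => levelWeight_pos n _) (sum_levelWeight_sq (Q := Q) P n))
    have hexp : (fun ω => rad n ω * h ω) = ∑ j ∈ Finset.range (2 ^ n),
        ((((2 ^ n : ℕ) : ℝ)⁻¹) * ∑ i ∈ Finset.range (2 ^ n), h i.testBit * peelBasis (2 ^ n) φ j i) •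
          basisFn Q (some (n, j)) := by
      ext ω
      rw [Finset.sum_apply]
      simp only [Pi.smul_apply, basisFn, smul_eq_mul, levelBasis]
      have e : ∀ j ∈ Finset.range (2 ^ n), (((2 ^ n : ℕ) : ℝ)⁻¹ *
          ∑ i ∈ Finset.range (2 ^ n), h i.testBit * peelBasis (2 ^ n) φ j i) *
          (rad n ω * peelBasis (2 ^ n) φ j (code n ω)) =
          ∑ i ∈ Finset.range (2 ^ n), ((2 ^ n : ℕ) : ℝ)⁻¹ * rad n ω * h i.testBit *
            (peelBasis (2 ^ n) φ j i * peelBasis (2 ^ n) φ j (code n ω)) := fun j _ => by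
        rw [Finset.mul_sum, Finset.sum_mul]
        exact Finset.sum_congr rfl fun _ _ => by ring
      rw [Finset.sum_congr rfl e, Finset.sum_comm, Finset.sum_eq_single_of_mem (code n ω)
        (Finset.mem_range.2 (code_lt n ω))]
      · rw [← Finset.mul_sum, hcol _ (code_lt n ω) _ (code_lt n ω), if_pos rfl,
          ← hhc.eq_testBit_code ω]
        field_simp
      · intro i hi hne
        rw [← Finset.mul_sum, hcol _ (Finset.mem_range.1 hi) _ (code_lt n ω), if_neg hne, mul_zero]
    rw [hexp]
    exact Submodule.sum_mem _ fun j hj => Submodule.smul_mem _ _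
      (basisFn_mem_span (Finset.mem_range.1 hj))

end BitSystem

namespace BitSystem

/-! ### Almost everywhere convergence -/

section Coefficients

variable (Q : ℕ)

/-- Partial Haar coefficients of the `k`-th block of `a`. -/
noncomputable def haarCoeff (a : ℕ → ℝ) (k m v : ℕ) : ℝ :=
  ∑ i ∈ Finset.range m, a (off (blockSize Q) k + i) * haar (ord Q k) i v

/-- The energy of the `k`-th block of `a`. -/
noncomputable def energy (a : ℕ → ℝ) (k : ℕ) : ℝ :=
  ∑ i ∈ Finset.range (2 ^ ord Q k), a (off (blockSize Q) k + i) ^ 2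

/-- Partial sums inside the `k`-th block. -/
noncomputable def blockSum (a : ℕ → ℝ) (k m : ℕ) (ω : ℕ → Bool) : ℝ :=
  ∑ i ∈ Finset.range m, a (off (blockSize Q) k + i) * theta Q (off (blockSize Q) k + i) ω

/-- The coefficient of the `k`-th function which is not of Rademacher type. -/
noncomputable def restCoeff (a : ℕ → ℝ) (k : ℕ) : ℝ := haarCoeff Q a k (2 ^ ord Q k) 0

/-- The coefficient of the `n`-th function of Rademacher type. -/
noncomputable def radCoeff (a : ℕ → ℝ) (n : ℕ) : ℝ :=
  haarCoeff Q a (blk (radSize Q) n) (2 ^ ord Q (blk (radSize Q) n))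
    (2 ^ ord Q (blk (radSize Q) n) - 1 - pos (radSize Q) n)

end Coefficients

variable {Q : ℕ}

lemma energy_nonneg (a : ℕ → ℝ) (k : ℕ) : 0 ≤ energy Q a k :=
  Finset.sum_nonneg fun _ _ => sq_nonneg _

lemma sum_energy (a : ℕ → ℝ) (K : ℕ) :
    ∑ k ∈ Finset.range K, energy Q a k = ∑ n ∈ Finset.range (off (blockSize Q) K), a n ^ 2 :=
  (sum_range_off (w := blockSize Q) (fun n => a n ^ 2) K).symm

lemma summable_energy_iff (a : ℕ → ℝ) :
    Summable (energy Q a) ↔ Summable fun n => a n ^ 2 := by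
  constructor
  · intro h
    refine summable_of_sum_range_le (c := ∑' k, energy Q a k) (fun n => sq_nonneg _) fun n => ?_
    refine le_trans ?_ (h.sum_le_tsum (Finset.range n) fun k _ => energy_nonneg a k)
    rw [sum_energy]
    exact Finset.sum_le_sum_of_subset_of_nonneg
      (Finset.range_subset_range.2 (le_off blockSize_pos n)) fun _ _ _ => sq_nonneg _
  · intro h
    refine summable_of_sum_range_le (c := ∑' n, a n ^ 2) (energy_nonneg a) fun n => ?_
    rw [sum_energy]
    exact h.sum_le_tsum _ fun _ _ => sq_nonneg _

lemma sum_sq_haarCoeff_Ico (a : ℕ → ℝ) (k l : ℕ) {m : ℕ} (hm : m ≤ 2 ^ ord Q k) :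
    ∑ v ∈ Finset.range (2 ^ ord Q k), (∑ i ∈ Finset.Ico l m,
      a (off (blockSize Q) k + i) * haar (ord Q k) i v) ^ 2 =
      ∑ i ∈ Finset.Ico l m, a (off (blockSize Q) k + i) ^ 2 :=
  sum_sq_haar_coeff (fun i hi => by simp only [Finset.mem_Ico, Finset.mem_range] at *; omega)
    fun i => a (off (blockSize Q) k + i)

lemma sum_sq_haarCoeff (a : ℕ → ℝ) (k : ℕ) :
    ∑ v ∈ Finset.range (2 ^ ord Q k), haarCoeff Q a k (2 ^ ord Q k) v ^ 2 = energy Q a k :=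
  sum_sq_haar_coeff subset_rfl fun i => a (off (blockSize Q) k + i)

lemma sq_haarCoeff_zero_le (a : ℕ → ℝ) (k : ℕ) {m : ℕ} (hm : m ≤ 2 ^ ord Q k) :
    haarCoeff Q a k m 0 ^ 2 ≤ energy Q a k := by
  have h1 := sum_sq_haar_coeff (Finset.range_subset_range.2 hm)
    fun i => a (off (blockSize Q) k + i)
  have h2 : haarCoeff Q a k m 0 ^ 2 ≤
      ∑ v ∈ Finset.range (2 ^ ord Q k), haarCoeff Q a k m v ^ 2 :=
    Finset.single_le_sum (f := fun v => haarCoeff Q a k m v ^ 2) (fun _ _ => sq_nonneg _)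
      (Finset.mem_range.2 (by positivity))
  refine (h2.trans_eq h1).trans ?_
  exact Finset.sum_le_sum_of_subset_of_nonneg (Finset.range_subset_range.2 hm)
    fun _ _ _ => sq_nonneg _

lemma radCoeff_radIndex (a : ℕ → ℝ) {k v : ℕ} (hv0 : v ≠ 0) (hv : v < 2 ^ ord Q k) :
    radCoeff Q a (radIndex Q k v) = haarCoeff Q a k (2 ^ ord Q k) v := by
  have h : 2 ^ ord Q k - 1 - v < radSize Q k := by unfold radSize; omega
  unfold radCoeff radIndex
  rw [blk_off_add radSize_pos h, pos_off_add radSize_pos h,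
    show 2 ^ ord Q k - 1 - (2 ^ ord Q k - 1 - v) = v by omega]

lemma sum_radIndex (f : ℕ → ℝ) (k : ℕ) :
    ∑ v ∈ Finset.Ico 1 (2 ^ ord Q k), f (radIndex Q k v) =
      ∑ i ∈ Finset.range (radSize Q k), f (off (radSize Q) k + i) := by
  rw [Finset.sum_Ico_eq_sum_range, ← Finset.sum_range_reflect, radSize]
  refine Finset.sum_congr rfl fun j hj => ?_
  have hj' : j < 2 ^ ord Q k - 1 := Finset.mem_range.1 hj
  rw [radIndex, show 2 ^ ord Q k - 1 - (1 + (2 ^ ord Q k - 1 - 1 - j)) = j by omega]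

lemma range_two_pow_eq (p : ℕ) : Finset.range (2 ^ p) = insert 0 (Finset.Ico 1 (2 ^ p)) := by
  ext v
  have : 0 < 2 ^ p := by positivity
  simp only [Finset.mem_range, Finset.mem_insert, Finset.mem_Ico]; omega

lemma sum_range_two_pow_eq (f : ℕ → ℝ) (p : ℕ) :
    ∑ v ∈ Finset.range (2 ^ p), f v = f 0 + ∑ v ∈ Finset.Ico 1 (2 ^ p), f v := by
  rw [range_two_pow_eq, Finset.sum_insert (by simp)]

lemma restCoeff_sq_add_sum (a : ℕ → ℝ) (k : ℕ) :
    restCoeff Q a k ^ 2 + ∑ i ∈ Finset.range (radSize Q k),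
      radCoeff Q a (off (radSize Q) k + i) ^ 2 = energy Q a k := by
  rw [← sum_sq_haarCoeff, sum_range_two_pow_eq, ← sum_radIndex fun n => radCoeff Q a n ^ 2,
    restCoeff]
  refine congrArg (_ + ·) (Finset.sum_congr rfl fun v hv => ?_)
  rw [Finset.mem_Ico] at hv
  rw [radCoeff_radIndex a (by omega) hv.2]

lemma blockSum_eq (a : ℕ → ℝ) (k : ℕ) {m : ℕ} (hm : m ≤ 2 ^ ord Q k) (ω : ℕ → Bool) :
    blockSum Q a k m ω = haarCoeff Q a k m 0 * basisFn Q (restIndex k) ω +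
      ∑ v ∈ Finset.Ico 1 (2 ^ ord Q k), haarCoeff Q a k m v * radType Q (radIndex Q k v) ω := by
  have h1 : blockSum Q a k m ω = ∑ v ∈ Finset.range (2 ^ ord Q k),
      haarCoeff Q a k m v * basisFn Q (columnIndex Q k v) ω := by
    have : ∀ i ∈ Finset.range m,
        a (off (blockSize Q) k + i) * theta Q (off (blockSize Q) k + i) ω =
        ∑ v ∈ Finset.range (2 ^ ord Q k), (a (off (blockSize Q) k + i) * haar (ord Q k) i v) *
          basisFn Q (columnIndex Q k v) ω := fun i hi => by
      rw [theta_off_add ((Finset.mem_range.1 hi).trans_le hm), Finset.mul_sum]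
      exact Finset.sum_congr rfl fun _ _ => by ring
    rw [blockSum, Finset.sum_congr rfl this, Finset.sum_comm]
    exact Finset.sum_congr rfl fun v _ => by rw [haarCoeff, Finset.sum_mul]
  rw [h1, sum_range_two_pow_eq, columnIndex, if_pos rfl]
  refine congrArg (_ + ·) (Finset.sum_congr rfl fun v hv => ?_)
  rw [Finset.mem_Ico] at hv
  rw [columnIndex, if_neg (by omega), basisFn_radType]

lemma blockSum_full (a : ℕ → ℝ) (k : ℕ) (ω : ℕ → Bool) :
    blockSum Q a k (2 ^ ord Q k) ω = restCoeff Q a k * basisFn Q (restIndex k) ω +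
      ∑ i ∈ Finset.range (radSize Q k),
        radCoeff Q a (off (radSize Q) k + i) * radType Q (off (radSize Q) k + i) ω := by
  rw [blockSum_eq a k le_rfl, ← sum_radIndex fun n => radCoeff Q a n * radType Q n ω, restCoeff]
  refine congrArg (_ + ·) (Finset.sum_congr rfl fun v hv => ?_)
  rw [Finset.mem_Ico] at hv
  rw [radCoeff_radIndex a (by omega) hv.2]

/-- At the end of a block the rotation is complete, so the partial sum splits into partial sums of
two unrotated series. Only the oscillation inside a block still involves the Haar matrix. -/
lemma sum_blockSum (a : ℕ → ℝ) (k : ℕ) (ω : ℕ → Bool) :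
    ∑ n ∈ Finset.range (off (blockSize Q) k), a n * theta Q n ω =
      ∑ j ∈ Finset.range k, restCoeff Q a j * basisFn Q (restIndex j) ω +
      ∑ n ∈ Finset.range (off (radSize Q) k), radCoeff Q a n * radType Q n ω := by
  rw [sum_range_off, sum_range_off, ← Finset.sum_add_distrib]
  exact Finset.sum_congr rfl fun j _ => blockSum_full a j ω

lemma sum_range_off_add (a : ℕ → ℝ) (k m : ℕ) (ω : ℕ → Bool) :
    ∑ n ∈ Finset.range (off (blockSize Q) k + m), a n * theta Q n ω =
      ∑ n ∈ Finset.range (off (blockSize Q) k), a n * theta Q n ω + blockSum Q a k m ω :=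
  Finset.sum_range_add _ _ _

variable {P : Measure (ℕ → Bool)} [FlipInvariant P]

lemma measureReal_code_mem (m : ℕ) (p : ℕ → Prop) [DecidablePred p] :
    P.real {ω | p (code m ω)} = (1 / 2) ^ m * ((Finset.range (2 ^ m)).filter p).card := by
  have hm : MeasurableSet {ω | p (code m ω)} := ((cyl_code m).comp p).measurableSet
  have h := integral_code (P := P) m fun i => if p i then (1 : ℝ) else 0
  rw [Finset.sum_ite, Finset.sum_const_zero, add_zero, Finset.sum_const, nsmul_eq_mul, mul_one] at h
  rw [← h, ← integral_indicator_one hm]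
  refine integral_congr_ae (Eventually.of_forall fun ω => ?_)
  by_cases hω : p (code m ω) <;> simp [hω]

lemma measureReal_level_maximal (m : ℕ) (d : ℕ → ℝ) {η : ℝ} (hη : 0 < η) :
    P.real {ω | ∃ i ≤ 2 ^ m, η < |∑ j ∈ Finset.range i, d j * levelBasis Q m j ω|} ≤
      2 * (∑ j ∈ Finset.range (2 ^ m), d j ^ 2) / η ^ 2 := by
  classical
  obtain ⟨Z₁, Z₂, hZ⟩ := levelWeight_two_values (Q := Q) m
  have h := card_peelBasis_maximal (fun i _ => levelWeight_pos m _) (sum_levelWeight_sq (Q := Q) P m)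
    d hη fun i _ => hZ i.testBit
  have h2 := measureReal_code_mem (P := P) m fun x => ∃ i ≤ 2 ^ m, η < |∑ j ∈ Finset.range i,
    d j * peelBasis (2 ^ m) (fun i => levelWeight Q m i.testBit) j x|
  simp only [levelBasis]
  rw [h2, le_div_iff₀ (by positivity)]
  have h3 : (0 : ℝ) < (1 / 2) ^ m := by positivity
  have h4 := mul_le_mul_of_nonneg_left h h3.le
  push_cast at h4
  calc _ ≤ (1 / 2) ^ m * (2 * 2 ^ m * ∑ j ∈ Finset.range (2 ^ m), d j ^ 2) := by
        refine le_trans (le_of_eq ?_) h4; ring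
    _ = (1 / 2 * 2) ^ m * (2 * ∑ j ∈ Finset.range (2 ^ m), d j ^ 2) := by rw [mul_pow]; ring
    _ = _ := by norm_num

lemma tendsto_blk {w : ℕ → ℕ} (hw : ∀ k, 0 < w k) : Tendsto (blk w) atTop atTop := by
  refine tendsto_atTop.2 fun K => ?_
  filter_upwards [eventually_ge_atTop (off w K)] with n hn
  by_contra! h
  have h1 := lt_off_blk_succ hw n
  have h2 := off_mono (w := w) (show blk w n + 1 ≤ K from h)
  omega

/-- A series converges if its sums over full blocks converge and the oscillation inside the blocks
tends to zero. -/
lemma tendsto_of_blocks {w : ℕ → ℕ} (hw : ∀ k, 0 < w k) {f : ℕ → ℝ} {s : ℝ}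
    (h1 : Tendsto (fun k => ∑ n ∈ Finset.range (off w k), f n) atTop (𝓝 s))
    (h2 : ∀ η > 0, ∀ᶠ k in atTop, ∀ m ≤ w k, |∑ i ∈ Finset.range m, f (off w k + i)| ≤ η) :
    Tendsto (fun N => ∑ n ∈ Finset.range N, f n) atTop (𝓝 s) := by
  have h3 : Tendsto (fun N => ∑ i ∈ Finset.range (pos w N), f (off w (blk w N) + i)) atTop
      (𝓝 0) := by
    rw [Metric.tendsto_nhds]
    intro η hη
    filter_upwards [(tendsto_blk hw).eventually (h2 (η / 2) (by linarith))] with N hN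
    rw [Real.dist_eq, sub_zero]
    have := hN _ (pos_lt hw N).le
    linarith
  have h4 := (h1.comp (tendsto_blk hw)).add h3
  rw [add_zero] at h4
  refine h4.congr fun N => ?_
  simp only [Function.comp]
  rw [← Finset.sum_range_add, off_blk_add_pos]

lemma summable_block_sums {w : ℕ → ℕ} {c : ℕ → ℝ} (hc : Summable fun n => c n ^ 2) :
    Summable fun k => ∑ i ∈ Finset.range (w k), c (off w k + i) ^ 2 := by
  refine summable_of_sum_range_le (c := ∑' n, c n ^ 2)
    (fun k => Finset.sum_nonneg fun _ _ => sq_nonneg _) fun n => ?_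
  rw [← sum_range_off fun n => c n ^ 2]
  exact hc.sum_le_tsum _ fun _ _ => sq_nonneg _

lemma integral_sq_levelBasis_sum (m : ℕ) (d : ℕ → ℝ) :
    ∫ ω, (∑ j ∈ Finset.range (2 ^ m), d j * levelBasis Q m j ω) ^ 2 ∂P =
      ∑ j ∈ Finset.range (2 ^ m), d j ^ 2 := by
  have := sum_sq_peelBasis (fun i _ => levelWeight_pos m _) (sum_levelWeight_sq (Q := Q) P m) d
    le_rfl
  simp only [levelBasis]
  rw [integral_code m fun x => (∑ j ∈ Finset.range (2 ^ m),
    d j * peelBasis (2 ^ m) (fun i => levelWeight Q m i.testBit) j x) ^ 2, this]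
  push_cast
  rw [← mul_assoc, ← mul_pow]; norm_num

/-- Square summable series in the functions which are not of Rademacher type converge a.e. -/
lemma ae_tendsto_rest_series {c : ℕ → ℝ} (hc : Summable fun n => c n ^ 2) :
    ∀ᵐ ω ∂P, ∃ s, Tendsto (fun K => ∑ k ∈ Finset.range K, c k * basisFn Q (restIndex k) ω)
      atTop (𝓝 s) := by
  set c' : ℕ → ℝ := fun n => c (n + 1) with hc'
  have hcs : Summable fun n => c' n ^ 2 := (summable_nat_add_iff 1).2 hc
  -- A zero is inserted at the place of the missing Rademacher type function of odd levels, so that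
  -- the whole basis of level m can be used. The shift in c' removes the constant function.
  set d : ℕ → ℕ → ℝ := fun m j => if j < m % 2 then 0 else c' (off restSize m + (j - m % 2)) with hd
  have hsize : ∀ m, m % 2 + restSize m = 2 ^ m := fun m => by
    have h1 : 1 ≤ 2 ^ m := Nat.one_le_two_pow
    unfold restSize; omega
  have hsum : ∀ m i (F : ℕ → ℝ), ∑ j ∈ Finset.range (m % 2 + i), d m j * F j =
      ∑ j ∈ Finset.range i, c' (off restSize m + j) * F (j + m % 2) := fun m i F => by
    rw [Finset.sum_range_add, Finset.sum_eq_zero, zero_add]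
    · refine Finset.sum_congr rfl fun j _ => ?_
      simp only [hd]
      rw [if_neg (by omega), Nat.add_sub_cancel_left, add_comm j]
    · intro j hj
      simp only [hd]
      rw [if_pos (Finset.mem_range.1 hj), zero_mul]
  have hdsq : ∀ m, ∑ j ∈ Finset.range (2 ^ m), d m j ^ 2 =
      ∑ j ∈ Finset.range (restSize m), c' (off restSize m + j) ^ 2 := fun m => by
    rw [← hsize m, Finset.sum_range_add, Finset.sum_eq_zero, zero_add]
    · refine Finset.sum_congr rfl fun j _ => ?_
      simp only [hd]
      rw [if_neg (by omega), Nat.add_sub_cancel_left]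
    · intro j hj
      simp only [hd]
      rw [if_pos (Finset.mem_range.1 hj)]; norm_num
  have hterm : ∀ m j, j < restSize m → ∀ ω, basisFn Q (restIndex (off restSize m + j + 1)) ω =
      rad m ω * levelBasis Q m (j + m % 2) ω := fun m j hj ω => by
    simp only [restIndex, basisFn]
    rw [blk_off_add restSize_pos hj, pos_off_add restSize_pos hj]
  set f : (ℕ → Bool) → ℕ → ℝ := fun ω n => c' n * basisFn Q (restIndex (n + 1)) ω with hf
  have hpart : ∀ ω m i, i ≤ restSize m → ∑ j ∈ Finset.range i, f ω (off restSize m + j) =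
      rad m ω * ∑ j ∈ Finset.range (m % 2 + i), d m j * levelBasis Q m j ω := fun ω m i hi => by
    rw [hsum, Finset.mul_sum]
    refine Finset.sum_congr rfl fun j hj => ?_
    simp only [hf]
    rw [hterm m j ((Finset.mem_range.1 hj).trans_le hi)]
    ring
  -- Whole levels form a martingale with differences `rad m * g m`; the order within a level is
  -- handled by the maximal inequality of the peeling basis.
  set g : ℕ → (ℕ → Bool) → ℝ := fun m ω =>
    ∑ j ∈ Finset.range (2 ^ m), d m j * levelBasis Q m j ω with hg
  have hgc : ∀ m, Cyl m (g m) := fun m => Cyl.sum fun j _ => (cyl_levelBasis m j).const_mul _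
  have hgs : Summable fun m => ∫ ω, g m ω ^ 2 ∂P := by
    simp only [hg, integral_sq_levelBasis_sum, hdsq]
    exact summable_block_sums hcs
  have hbad := ae_eventually_notMem_of_summable (μ := P)
    (B := fun m η => {ω | ∃ i ≤ 2 ^ m, η < |∑ j ∈ Finset.range i, d m j * levelBasis Q m j ω|})
    (fun m η η' h ω ⟨i, hi, hlt⟩ => ⟨i, hi, h.trans_lt hlt⟩) fun η hη => by
      refine Summable.of_nonneg_of_le (fun _ => measureReal_nonneg)
        (fun m => measureReal_level_maximal m (d m) hη) ?_
      simp only [hdsq]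
      exact ((summable_block_sums hcs).mul_left 2).div_const _
  filter_upwards [ae_tendsto_rad_sum hgc hgs, hbad] with ω ⟨s, hs⟩ hω
  have hconv : Tendsto (fun N => ∑ n ∈ Finset.range N, f ω n) atTop (𝓝 s) := by
    refine tendsto_of_blocks restSize_pos ?_ fun η hη => ?_
    · refine hs.congr fun k => ?_
      rw [sum_range_off]
      refine Finset.sum_congr rfl fun m _ => ?_
      rw [hpart ω m _ le_rfl, hsize]
    · filter_upwards [hω η hη] with m hm i hi
      rw [hpart ω m i hi, abs_mul, abs_rad, one_mul]
      by_contra! hlt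
      exact hm ⟨_, by have := hsize m; omega, hlt⟩
  refine ⟨s + c 0 * basisFn Q (restIndex 0) ω, ?_⟩
  rw [← tendsto_add_atTop_iff_nat 1]
  refine (hconv.add_const _).congr fun N => ?_
  rw [Finset.sum_range_succ']

/-- Square summable series in the functions of Rademacher type converge a.e. -/
lemma ae_tendsto_radType_series {b : ℕ → ℝ} (hb : Summable fun n => b n ^ 2) :
    ∀ᵐ ω ∂P, ∃ s, Tendsto (fun K => ∑ n ∈ Finset.range K, b n * radType Q n ω) atTop (𝓝 s) := by
  -- Zero coefficients are interleaved at the even coordinates, which gives a predictable series in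
  -- all Rademacher functions.
  set g : ℕ → (ℕ → Bool) → ℝ := fun m ω => if m % 2 = 0 then 0 else b (m / 2) * weight Q (m / 2) ω
    with hg
  have hodd : ∀ n ω, g (2 * n + 1) ω = b n * weight Q n ω := fun n ω => by
    simp only [hg]
    rw [if_neg (by omega), show (2 * n + 1) / 2 = n by omega]
  have heven : ∀ n ω, g (2 * n) ω = 0 := fun n ω => by simp [hg]
  have hgc : ∀ m, Cyl m (g m) := fun m => by
    rcases Nat.even_or_odd' m with ⟨n, rfl | rfl⟩
    · rw [funext (heven n)]; exact Cyl.const 0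
    · rw [funext (hodd n)]; exact (cyl_weight n).const_mul _
  have hsum : ∀ (F : ℕ → ℝ) (_ : ∀ n, F (2 * n) = 0) K, ∑ m ∈ Finset.range (2 * K), F m =
      ∑ n ∈ Finset.range K, F (2 * n + 1) := fun F hF K => by
    induction K with
    | zero => simp
    | succ K ih =>
      rw [show 2 * (K + 1) = 2 * K + 1 + 1 by ring, Finset.sum_range_succ, Finset.sum_range_succ,
        Finset.sum_range_succ, ih, hF]; ring
  have hgs : Summable fun m => ∫ ω, g m ω ^ 2 ∂P := by
    refine summable_of_sum_range_le (c := ∑' n, b n ^ 2)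
      (fun m => integral_nonneg fun ω => sq_nonneg _) fun n => ?_
    refine (Finset.sum_le_sum_of_subset_of_nonneg (Finset.range_subset_range.2
      (show n ≤ 2 * n by omega)) fun m _ _ => integral_nonneg fun ω => sq_nonneg _).trans ?_
    rw [hsum _ fun n => by simp [heven]]
    simp only [hodd, mul_pow, integral_const_mul, integral_weight_sq, mul_one]
    exact hb.sum_le_tsum _ fun _ _ => sq_nonneg _
  filter_upwards [ae_tendsto_rad_sum hgc hgs] with ω ⟨s, hs⟩
  refine ⟨s, (hs.comp (tendsto_id.const_mul_atTop' (show 0 < 2 by norm_num))).congr fun K => ?_⟩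
  simp only [Function.comp, id]
  rw [hsum _ fun n => by simp [heven]]
  refine Finset.sum_congr rfl fun n _ => ?_
  rw [hodd, radType]; ring

end BitSystem

namespace BitSystem

/-! ### Oscillation inside the blocks -/

variable {Q : ℕ}

/-- The position of the first zero of the code word determines the level, after which the digits
determine the node. -/
lemma spike_unique {k v v' : ℕ} {ω : ℕ → Bool} (h : ω ∈ spike Q k v)
    (h' : ω ∈ spike Q k v') : v = v' := by
  have key : ∀ {v v' : ℕ}, ω ∈ spike Q k v → ω ∈ spike Q k v' →
      ¬ Nat.log 2 v < Nat.log 2 v' := fun {v v'} h h' hlt => by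
    have h1 := h (Nat.log 2 v) (by unfold codeLength; omega)
    have h2 := h' (Nat.log 2 v) (by unfold codeLength; omega)
    rw [h1] at h2
    simp [nodePattern, hlt] at h2
  have hlog : Nat.log 2 v = Nat.log 2 v' := le_antisymm (not_lt.1 (key h' h)) (not_lt.1 (key h h'))
  refine Nat.eq_of_testBit_eq fun j => ?_
  by_cases hj : j ≤ Nat.log 2 v
  · have h1 := h (Nat.log 2 v + 1 + j) (by unfold codeLength; omega)
    have h2 := h' (Nat.log 2 v + 1 + j) (by unfold codeLength; omega)
    rw [h1] at h2
    simp only [nodePattern, ← hlog] at h2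
    rw [if_neg (by omega), if_neg (by omega), if_neg (by omega), if_neg (by omega),
      show Nat.log 2 v + 1 + j - Nat.log 2 v - 1 = j by omega] at h2
    exact h2
  · rw [Nat.testBit_lt_two_pow, Nat.testBit_lt_two_pow]
    · exact (Nat.lt_pow_succ_log_self (by norm_num) v').trans_le
        (Nat.pow_le_pow_right (by norm_num) (by omega))
    · exact (Nat.lt_pow_succ_log_self (by norm_num) v).trans_le
        (Nat.pow_le_pow_right (by norm_num) (by omega))

/-- The value of the weight off the spike. -/
noncomputable def baseWeight (k v : ℕ) : ℝ := if Nat.log 2 v ≤ k then √(1 / 2) else 1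

/-- The excess of the weight on the spike. -/
noncomputable def spikeHeight (k v : ℕ) : ℝ :=
  if Nat.log 2 v ≤ k then √(1 / 2) * (√(1 + 2 ^ codeLength v) - 1) else 0

/-- The constant part is left to the fourth moment inequality and the excess to the weak type
estimate; the full weights have fourth moments that are not uniformly bounded. -/
lemma nodeWeight_eq (k v : ℕ) (ω : ℕ → Bool) : nodeWeight Q k v ω =
    baseWeight k v + spikeHeight k v * (spike Q k v).indicator (fun _ => 1) ω := by
  unfold nodeWeight baseWeight spikeHeight
  split_ifs
  · by_cases hω : ω ∈ spike Q k v
    · rw [Set.indicator_of_mem hω, mul_one]; ring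
    · rw [Set.indicator_of_notMem hω]; simp
  · simp

lemma baseWeight_sq_le (k v : ℕ) : baseWeight k v ^ 2 ≤ 1 := by
  unfold baseWeight
  split_ifs
  · rw [Real.sq_sqrt (by norm_num)]; norm_num
  · norm_num

lemma spikeHeight_sq_le (k v : ℕ) : spikeHeight k v ^ 2 ≤ 2 ^ codeLength v := by
  unfold spikeHeight
  have h1 : (1 : ℝ) ≤ 2 ^ codeLength v := one_le_pow₀ (by norm_num)
  split_ifs
  · rw [mul_pow, Real.sq_sqrt (by norm_num)]
    have h2 : (1 : ℝ) ≤ √(1 + 2 ^ codeLength v) := Real.one_le_sqrt.2 (by linarith)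
    have h3 := Real.sq_sqrt (show (0 : ℝ) ≤ 1 + 2 ^ codeLength v by linarith)
    nlinarith
  · simp

lemma spikeHeight_eq_zero {k v : ℕ} (h : k < Nat.log 2 v) : spikeHeight k v = 0 := by
  rw [spikeHeight, if_neg (by omega)]

variable {P : Measure (ℕ → Bool)} [FlipInvariant P]

/-- By Parseval the variance over an interval of indices is at most the energy there, which is
additive. Khinchin then gives the hypothesis of `exists_maximal_bound` with C = 3, and 7356 = 3 ·
2452. -/
lemma exists_rademacher_bound (a : ℕ → ℝ) (k : ℕ) : ∃ B : (ℕ → Bool) → ℝ, Integrable B P ∧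
    (∀ ω, 0 ≤ B ω) ∧ (∀ m ≤ 2 ^ ord Q k, ∀ ω, (∑ v ∈ Finset.Ico 1 (2 ^ ord Q k),
      haarCoeff Q a k m v * (baseWeight k v * rad (2 * radIndex Q k v + 1) ω)) ^ 4 ≤ B ω) ∧
    ∫ ω, B ω ∂P ≤ 7356 * energy Q a k ^ 2 := by
  set V := Finset.Ico 1 (2 ^ ord Q k) with hV
  set a' : ℕ → ℝ := fun i => a (off (blockSize Q) k + i) with ha'
  set Y : ℕ → (ℕ → Bool) → ℝ := fun i ω => ∑ v ∈ V,
    (a' i * haar (ord Q k) i v * baseWeight k v) * rad (2 * radIndex Q k v + 1) ω with hY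
  have hsum : ∀ (s : Finset ℕ) ω, ∑ i ∈ s, Y i ω = ∑ v ∈ V,
      ((∑ i ∈ s, a' i * haar (ord Q k) i v) * baseWeight k v) * rad (2 * radIndex Q k v + 1) ω :=
    fun s ω => by
      simp only [hY]
      rw [Finset.sum_comm]
      exact Finset.sum_congr rfl fun v _ => by rw [← Finset.sum_mul, ← Finset.sum_mul]
  have hinj : Set.InjOn (fun v => 2 * radIndex Q k v + 1) V := fun v hv v' hv' h => by
    simp only [hV, Finset.coe_Ico, Set.mem_Ico] at hv hv'
    simp only at h
    exact (radIndex_inj (by omega) hv.2 (by omega) hv'.2 (by omega)).2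
  have hcyl : ∀ s : Finset ℕ, Cyl (2 * off (radSize Q) (k + 1)) (fun ω => ∑ i ∈ s, Y i ω) :=
    fun s => by
      rw [funext (hsum s)]
      refine cyl_weighted_rad_sum (n := fun v => 2 * radIndex Q k v + 1) (fun v hv => ?_) _
      have := radIndex_lt (Q := Q) (k := k) (v := v) (by simp [hV] at hv; omega)
      omega
  obtain ⟨B, hB1, hB2, hB3, hB4⟩ := exists_maximal_bound (μ := P) (Y := Y) (q := fun i => a' i ^ 2)
    (N := 2 ^ ord Q k) (C := 3) (fun i => sq_nonneg _) (by norm_num)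
    (fun l m => ((hcyl _).comp (· ^ 4)).integrable P) (fun l m hm => by
      simp only [hsum]
      refine (moments_rad_sum hinj _).2.trans ?_
      have h1 : ∑ v ∈ V, ((∑ i ∈ Finset.Ico l m, a' i * haar (ord Q k) i v) *
          baseWeight k v) ^ 2 ≤ ∑ i ∈ Finset.Ico l m, a' i ^ 2 := by
        rw [← sum_sq_haarCoeff_Ico a k l hm]
        refine (Finset.sum_le_sum fun v _ => ?_).trans (Finset.sum_le_sum_of_subset_of_nonneg
          (s := V) (fun v hv => ?_) fun _ _ _ => sq_nonneg _)
        · rw [mul_pow]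
          exact mul_le_of_le_one_right (sq_nonneg _) (baseWeight_sq_le k v)
        · simp only [hV, Finset.mem_Ico, Finset.mem_range] at *; omega
      have h2 : 0 ≤ ∑ v ∈ V, ((∑ i ∈ Finset.Ico l m, a' i * haar (ord Q k) i v) *
          baseWeight k v) ^ 2 := Finset.sum_nonneg fun _ _ => sq_nonneg _
      have := pow_le_pow_left₀ h2 h1 2
      linarith) (2 ^ ord Q k) 0 (2 ^ ord Q k) le_rfl (Nat.sub_le _ _)
  refine ⟨B, hB1, hB2, fun m hm ω => ?_, ?_⟩
  · have := hB3 m hm ω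
    rw [hsum, ← Finset.range_eq_Ico] at this
    simpa only [haarCoeff, mul_assoc] using this
  · refine hB4.trans_eq ?_
    rw [← Finset.range_eq_Ico, energy]
    ring

/-- The part of the exceptional set of the `k`-th block due to the spikes. -/
def spikeBad (Q : ℕ) (a : ℕ → ℝ) (k : ℕ) (η : ℝ) : Set (ℕ → Bool) :=
  {ω | ∃ v, v ≠ 0 ∧ Nat.log 2 v ≤ k ∧ ω ∈ spike Q k v ∧
    η ^ 2 < 2 ^ codeLength v * nodeEnergy (ord Q k) (fun i => a (off (blockSize Q) k + i))
      (Nat.log 2 v) (v - 2 ^ Nat.log 2 v)}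

/-- A union bound over heavy nodes. A spike of level s has probability 8^(-s)/4, which is why
`sum_heavy_nodes_le` is stated with powers of 8 and is applied with t = η²/4. -/
lemma measureReal_spikeBad_le (a : ℕ → ℝ) (k : ℕ) {η : ℝ} (hη : 0 < η) :
    P.real (spikeBad Q a k η) ≤ 2 * energy Q a k / η ^ 2 := by
  classical
  set E := nodeEnergy (ord Q k) (fun i => a (off (blockSize Q) k + i)) with hE
  set bad : ℕ → Prop := fun v =>
    v ≠ 0 ∧ η ^ 2 < 2 ^ codeLength v * E (Nat.log 2 v) (v - 2 ^ Nat.log 2 v) with hbad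
  have hsub : spikeBad Q a k η ⊆
      ⋃ v ∈ (Finset.range (2 ^ (k + 1))).filter bad, spike Q k v := by
    rintro ω ⟨v, h0, hk, hω, hlt⟩
    simp only [Set.mem_iUnion, exists_prop]
    exact ⟨v, Finset.mem_filter.2 ⟨Finset.mem_range.2 (lt_of_log_le hk), h0, hlt⟩, hω⟩
  refine (measureReal_mono hsub (measure_ne_top _ _)).trans ((measureReal_biUnion_finset_le _ _).trans ?_)
  simp only [measureReal_spike]
  rw [Finset.sum_filter, sum_range_two_pow, if_neg (by simp), zero_add]
  have h1 := sum_heavy_nodes_le (E := E) (fun s q => nodeEnergy_nonneg _ _ _ _) (k := k)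
    (fun s hs q => nodeEnergy_split (hs.trans (lt_ord k)) _ q)
    (show 0 < η ^ 2 / 4 by positivity)
  have h2 : E 0 0 = energy Q a k := nodeEnergy_zero _ _
  rw [h2] at h1
  have h3 : ∀ s ∈ Finset.range (k + 1), ∀ q ∈ Finset.range (2 ^ s),
      (if bad (2 ^ s + q) then (1 / 2 : ℝ) ^ codeLength (2 ^ s + q) else 0) =
      1 / 4 * (if η ^ 2 / 4 < 8 ^ s * E s q then (1 / 8 : ℝ) ^ s else 0) := fun s _ q hq => by
    have hq' := Finset.mem_range.1 hq
    have h0 : 2 ^ s + q ≠ 0 := by positivity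
    have e1 : (2 : ℝ) ^ (3 * s + 2) = 4 * 8 ^ s := by
      rw [pow_add, pow_mul]; norm_num; ring
    have e2 : (1 / 2 : ℝ) ^ (3 * s + 2) = 1 / 4 * (1 / 8) ^ s := by
      rw [pow_add, pow_mul]; norm_num; ring
    simp only [hbad, codeLength, log_two_pow_add hq', Nat.add_sub_cancel_left, e1, e2]
    by_cases hc : η ^ 2 / 4 < 8 ^ s * E s q
    · rw [if_pos hc, if_pos ⟨h0, by linarith⟩]
    · rw [if_neg hc, if_neg, mul_zero]
      rintro ⟨_, h⟩
      exact hc (by linarith)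
  rw [Finset.sum_congr rfl fun s hs => Finset.sum_congr rfl (h3 s hs)]
  simp only [← Finset.mul_sum]
  refine (mul_le_mul_of_nonneg_left h1 (by norm_num)).trans_eq ?_
  field_simp

/-- Disjointness of the spikes leaves at most one nonzero term, and its coefficient is bounded by
the energy of the node uniformly in m. -/
lemma abs_spike_sum_le (a : ℕ → ℝ) (k : ℕ) {η : ℝ} (hη : 0 < η) {ω : ℕ → Bool}
    (hω : ω ∉ spikeBad Q a k η) {m : ℕ} (hm : m ≤ 2 ^ ord Q k) :
    |∑ v ∈ Finset.Ico 1 (2 ^ ord Q k), haarCoeff Q a k m v *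
      (spikeHeight k v * (spike Q k v).indicator (fun _ => 1) ω *
        rad (2 * radIndex Q k v + 1) ω)| ≤ η := by
  by_cases hex : ∃ v ∈ Finset.Ico 1 (2 ^ ord Q k), Nat.log 2 v ≤ k ∧ ω ∈ spike Q k v
  · obtain ⟨v, hv, hvk, hvω⟩ := hex
    have hv' := Finset.mem_Ico.1 hv
    rw [Finset.sum_eq_single_of_mem v hv]
    · rw [Set.indicator_of_mem hvω, mul_one, abs_mul, abs_mul, abs_rad, mul_one, ← abs_mul]
      refine abs_le_of_sq_le_sq ?_ hη.le
      have h1 : ¬ η ^ 2 < 2 ^ codeLength v * nodeEnergy (ord Q k)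
          (fun i => a (off (blockSize Q) k + i)) (Nat.log 2 v) (v - 2 ^ Nat.log 2 v) :=
        fun h => hω ⟨v, by omega, hvk, hvω, h⟩
      obtain ⟨e1, e2⟩ := exists_two_pow_add (show v ≠ 0 by omega)
      have h2 := sq_haar_coeff_le (hvk.trans_lt (lt_ord (Q := Q) k)) e2 hm
        fun i => a (off (blockSize Q) k + i)
      rw [← e1] at h2
      have h3 := spikeHeight_sq_le k v
      rw [mul_pow, mul_comm]
      refine le_trans ?_ (not_lt.1 h1)
      exact mul_le_mul h3 h2 (sq_nonneg _) (by positivity)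
    · intro w hw hne
      have hw' := Finset.mem_Ico.1 hw
      rw [Set.indicator_of_notMem fun hwω => hne (spike_unique hwω hvω)]
      simp
  · push Not at hex
    rw [Finset.sum_eq_zero, abs_zero]
    · exact hη.le
    · intro v hv
      by_cases hvk : Nat.log 2 v ≤ k
      · rw [Set.indicator_of_notMem (hex v hv hvk)]; simp
      · rw [spikeHeight_eq_zero (by omega)]; simp

/-- For square summable coefficients the oscillation inside the blocks tends to zero a.e. -/
lemma ae_blockSum_small {a : ℕ → ℝ} (ha : Summable fun n => a n ^ 2) :
    ∀ᵐ ω ∂P, ∀ η > 0, ∀ᶠ k in atTop, ∀ m ≤ 2 ^ ord Q k, |blockSum Q a k m ω| ≤ η := by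
  have hE : Summable (energy Q a) := (summable_energy_iff a).2 ha
  have h1 := ae_eventually_notMem_of_summable (μ := P)
    (B := fun k η => {ω | η < |√(energy Q a k) * basisFn Q (restIndex k) ω|})
    (fun k η η' h ω (hω : η' < _) => h.trans_lt hω) fun η hη => by
      refine Summable.of_nonneg_of_le (fun _ => measureReal_nonneg) (fun k =>
        measureReal_lt_abs_le ((((cyl_basisFn_restIndex k).const_mul _).comp (· ^ 2)).integrable P)
          hη) ?_
      simp only [mul_pow, integral_const_mul, Real.sq_sqrt (energy_nonneg a _), sq (basisFn Q _ _),
        integral_basisFn_mul (restIndex_valid _) (restIndex_valid _), if_true, mul_one]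
      exact hE.div_const _
  choose B hB1 hB2 hB3 hB4 using exists_rademacher_bound (P := P) (Q := Q) a
  have h2 := ae_eventually_notMem_of_summable (μ := P)
    -- The sets are padded for η ≤ 0 because monotonicity is required for all real η, while even
    -- powers are monotone only on the positive ones.
    (B := fun k η => {ω | 0 < η ∧ η ^ 4 ≤ B k ω} ∪ {_ω | η ≤ 0})
    (fun k η η' h ω hω => by
      by_cases hη : η ≤ 0
      · exact Or.inr hη
      · rcases hω with hω | hω
        · exact Or.inl ⟨not_le.1 hη, (pow_le_pow_left₀ (not_le.1 hη).le h 4).trans hω.2⟩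
        · have : η' ≤ 0 := hω
          exact Or.inr (h.trans this)) fun η hη => by
      have e : ∀ k, ({ω | 0 < η ∧ η ^ 4 ≤ B k ω} ∪ {_ω | η ≤ 0} : Set (ℕ → Bool)) =
          {ω | η ^ 4 ≤ B k ω} := fun k => by
        ext ω; simp [hη, not_le.2 hη]
      simp only [e]
      have hb : ∀ k, P.real {ω | η ^ 4 ≤ B k ω} ≤
          7356 * (∑' k, energy Q a k) / η ^ 4 * energy Q a k := fun k => by
        have h3 := mul_meas_ge_le_integral_of_nonneg (Eventually.of_forall (hB2 k)) (hB1 k) (η ^ 4)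
        have h4 := hE.le_tsum k fun j _ => energy_nonneg a j
        have h5 : energy Q a k ^ 2 ≤ (∑' k, energy Q a k) * energy Q a k := by
          rw [sq]; exact mul_le_mul_of_nonneg_right h4 (energy_nonneg a k)
        have h6 := hB4 k
        rw [div_mul_eq_mul_div, le_div_iff₀ (by positivity), mul_comm]
        linarith
      exact Summable.of_nonneg_of_le (fun _ => measureReal_nonneg) hb (hE.mul_left _)
  have h3 := ae_eventually_notMem_of_summable (μ := P)
    (B := fun k η => {ω | 0 < η ∧ ω ∈ spikeBad Q a k η} ∪ {_ω | η ≤ 0})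
    (fun k η η' h ω hω => by
      by_cases hη : η ≤ 0
      · exact Or.inr hη
      · rcases hω with hω | hω
        · obtain ⟨v, hv0, hvk, hvω, hlt⟩ := hω.2
          exact Or.inl ⟨not_le.1 hη, v, hv0, hvk, hvω,
            (pow_le_pow_left₀ (not_le.1 hη).le h 2).trans_lt hlt⟩
        · have : η' ≤ 0 := hω
          exact Or.inr (h.trans this)) fun η hη => by
      have e : ∀ k, ({ω | 0 < η ∧ ω ∈ spikeBad Q a k η} ∪ {_ω | η ≤ 0} : Set (ℕ → Bool)) =
          spikeBad Q a k η := fun k => by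
        ext ω; simp [hη, not_le.2 hη]
      simp only [e]
      exact Summable.of_nonneg_of_le (fun _ => measureReal_nonneg)
        (fun k => measureReal_spikeBad_le a k hη) ((hE.mul_left 2).div_const _)
  filter_upwards [h1, h2, h3] with ω hω1 hω2 hω3 η hη
  have hη3 : 0 < η / 3 := by positivity
  filter_upwards [hω1 (η / 3) hη3, hω2 (η / 3) hη3, hω3 (η / 3) hη3] with k hk1 hk2 hk3 m hm
  have g1 : |haarCoeff Q a k m 0 * basisFn Q (restIndex k) ω| ≤ η / 3 := by
    refine le_trans ?_ (not_lt.1 hk1)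
    rw [abs_mul, abs_mul, abs_of_nonneg (Real.sqrt_nonneg _)]
    exact mul_le_mul_of_nonneg_right (Real.abs_le_sqrt (sq_haarCoeff_zero_le a k hm))
      (abs_nonneg _)
  have g2 : |∑ v ∈ Finset.Ico 1 (2 ^ ord Q k),
      haarCoeff Q a k m v * (baseWeight k v * rad (2 * radIndex Q k v + 1) ω)| ≤ η / 3 := by
    by_contra! hlt
    refine hk2 (Or.inl ⟨hη3, ?_⟩)
    refine le_trans ?_ (hB3 k m hm ω)
    rw [← Even.pow_abs (show Even 4 by decide) (∑ v ∈ _, _)]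
    exact pow_le_pow_left₀ hη3.le hlt.le 4
  have g3 := abs_spike_sum_le a k hη3 (fun h => hk3 (Or.inl ⟨hη3, h⟩)) hm
  have hdec : blockSum Q a k m ω = haarCoeff Q a k m 0 * basisFn Q (restIndex k) ω +
      (∑ v ∈ Finset.Ico 1 (2 ^ ord Q k),
        haarCoeff Q a k m v * (baseWeight k v * rad (2 * radIndex Q k v + 1) ω) +
      ∑ v ∈ Finset.Ico 1 (2 ^ ord Q k), haarCoeff Q a k m v *
        (spikeHeight k v * (spike Q k v).indicator (fun _ => 1) ω *
          rad (2 * radIndex Q k v + 1) ω)) := by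
    rw [blockSum_eq a k hm, ← Finset.sum_add_distrib]
    refine congrArg (_ + ·) (Finset.sum_congr rfl fun v hv => ?_)
    have hv' := Finset.mem_Ico.1 hv
    rw [radType, weight_radIndex (by omega) hv'.2, nodeWeight_eq]
    ring
  rw [hdec]
  have t1 := abs_add_le (haarCoeff Q a k m 0 * basisFn Q (restIndex k) ω)
    (∑ v ∈ Finset.Ico 1 (2 ^ ord Q k),
        haarCoeff Q a k m v * (baseWeight k v * rad (2 * radIndex Q k v + 1) ω) +
      ∑ v ∈ Finset.Ico 1 (2 ^ ord Q k), haarCoeff Q a k m v *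
        (spikeHeight k v * (spike Q k v).indicator (fun _ => 1) ω *
          rad (2 * radIndex Q k v + 1) ω))
  have t2 := abs_add_le (∑ v ∈ Finset.Ico 1 (2 ^ ord Q k),
        haarCoeff Q a k m v * (baseWeight k v * rad (2 * radIndex Q k v + 1) ω))
      (∑ v ∈ Finset.Ico 1 (2 ^ ord Q k), haarCoeff Q a k m v *
        (spikeHeight k v * (spike Q k v).indicator (fun _ => 1) ω *
          rad (2 * radIndex Q k v + 1) ω))
  linarith

lemma restCoeff_sq_le (a : ℕ → ℝ) (k : ℕ) : restCoeff Q a k ^ 2 ≤ energy Q a k :=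
  sq_haarCoeff_zero_le a k le_rfl

lemma sum_radCoeff_sq (a : ℕ → ℝ) (K : ℕ) :
    ∑ n ∈ Finset.range (off (radSize Q) K), radCoeff Q a n ^ 2 =
      ∑ k ∈ Finset.range K, (energy Q a k - restCoeff Q a k ^ 2) := by
  rw [sum_range_off]
  exact Finset.sum_congr rfl fun k _ => by rw [← restCoeff_sq_add_sum]; ring

/-- The system is a convergence system. -/
theorem ae_tendsto_theta_series {a : ℕ → ℝ} (ha : Summable fun n => a n ^ 2) :
    ∀ᵐ ω ∂P, ∃ s, Tendsto (fun N => ∑ n ∈ Finset.range N, a n * theta Q n ω) atTop (𝓝 s) := by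
  have hE : Summable (energy Q a) := (summable_energy_iff a).2 ha
  have hc : Summable fun k => restCoeff Q a k ^ 2 :=
    Summable.of_nonneg_of_le (fun _ => sq_nonneg _) (restCoeff_sq_le a) hE
  have hb : Summable fun n => radCoeff Q a n ^ 2 := by
    refine summable_of_sum_range_le (c := ∑' k, energy Q a k) (fun n => sq_nonneg _) fun n => ?_
    refine (Finset.sum_le_sum_of_subset_of_nonneg (Finset.range_subset_range.2
      (le_off_radSize (Q := Q) n)) fun _ _ _ => sq_nonneg _).trans ?_
    rw [sum_radCoeff_sq]
    refine (Finset.sum_le_sum fun k _ => sub_le_self _ (sq_nonneg _)).trans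
      (hE.sum_le_tsum _ fun k _ => energy_nonneg a k)
  filter_upwards [ae_tendsto_rest_series (P := P) (Q := Q) hc,
    ae_tendsto_radType_series (P := P) (Q := Q) hb, ae_blockSum_small (P := P) (Q := Q) ha]
    with ω ⟨s, hs⟩ ⟨t, ht⟩ hω
  refine ⟨s + t, tendsto_of_blocks (blockSize_pos (Q := Q)) ?_ hω⟩
  refine (hs.add (ht.comp (tendsto_atTop_mono (le_off_radSize (Q := Q)) tendsto_id))).congr fun k => ?_
  rw [sum_blockSum]
  rfl

end BitSystem

namespace BitSystem

variable {Q : ℕ} {P : Measure (ℕ → Bool)} [FlipInvariant P]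

/-! ### Divergence caused by the functions which are not of Rademacher type -/

lemma half_measureReal_le_of_flip {n : ℕ} {A D : Set (ℕ → Bool)} (hA : MeasurableSet A)
    (h : ∀ ω ∈ D, ω ∈ A ∨ flipBit n ω ∈ A) : 1 / 2 * P.real D ≤ P.real A := by
  have h1 : P.real D ≤ P.real (A ∪ flipBit n ⁻¹' A) :=
    measureReal_mono (fun ω hω => h ω hω) (measure_ne_top _ _)
  have h2 := measureReal_union_le (μ := P) A (flipBit n ⁻¹' A)
  rw [measureReal_flipBit n hA] at h2
  linarith

lemma cyl_blockSum (a : ℕ → ℝ) (k : ℕ) {m : ℕ} (hm : m ≤ 2 ^ ord Q k) :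
    Cyl (2 * off (radSize Q) (k + 1)) (blockSum Q a k m) :=
  Cyl.sum fun _ hi => (cyl_theta_block ((Finset.mem_range.1 hi).trans_le hm)).const_mul _

lemma sqrt_two_pow_le_nodeWeight {k v : ℕ} (h : Nat.log 2 v ≤ k) {ω : ℕ → Bool}
    (hω : ω ∈ spike Q k v) : √2 ^ (3 * Nat.log 2 v) ≤ nodeWeight Q k v ω := by
  refine (pow_le_pow_iff_left₀ (by positivity) (nodeWeight_pos _ _ _).le two_ne_zero).1 ?_
  rw [sq (√2 ^ _), sqrt_two_pow_mul_self, nodeWeight_sq h, Set.indicator_of_mem hω, codeLength,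
    pow_add]
  have : (0 : ℝ) < 2 ^ (3 * Nat.log 2 v) := by positivity
  linarith

lemma sq_le_quarter_pow {c : ℝ} {t : ℕ} (h : |c| * 2 ^ t ≤ 1) : c ^ 2 ≤ (1 / 4) ^ t := by
  have h1 : (|c| * 2 ^ t) ^ 2 ≤ 1 := pow_le_one₀ (by positivity) h
  rw [mul_pow, sq_abs, ← pow_mul, mul_comm t 2, pow_mul] at h1
  rw [one_div, inv_pow, ← one_div, le_div_iff₀ (by positivity)]
  norm_num at h1 ⊢
  exact h1

/-- The points at which the oscillation inside the `k`-th block is at least `1 / 8`. -/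
def oscillating (Q : ℕ) (a : ℕ → ℝ) (k : ℕ) : Set (ℕ → Bool) :=
  {ω | ∃ m ≤ 2 ^ ord Q k, 1 / 8 ≤ |blockSum Q a k m ω|}

lemma cyl_oscillating (a : ℕ → ℝ) (k : ℕ) :
    Cyl (2 * off (radSize Q) (k + 1)) (· ∈ oscillating Q a k) := fun ω ω' H => by
  simp only [oscillating, Set.mem_ofPred_eq, eq_iff_iff]
  refine exists_congr fun m => and_congr_right fun hm => ?_
  rw [cyl_blockSum a k hm ω ω' H]

/-- Flipping the sign of node v turns the block sum X + Y into X - Y and leaves D and the spike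
unchanged. Since |Y| ≥ 1/8 on the spike, one of the two has modulus at least 1/8. -/
lemma half_measureReal_inter_spike_le (a : ℕ → ℝ) {k v m : ℕ} (hv0 : v ≠ 0)
    (hvk : Nat.log 2 v ≤ k) (hm : m ≤ 2 ^ ord Q k)
    (hlarge : 1 / 8 ≤ |haarCoeff Q a k m v| * √2 ^ (3 * Nat.log 2 v))
    {D : Set (ℕ → Bool)} (hD : Cyl (2 * off (radSize Q) k) (· ∈ D)) :
    1 / 2 * P.real (D ∩ spike Q k v) ≤ P.real (D ∩ oscillating Q a k ∩ spike Q k v) := by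
  have hv : v < 2 ^ ord Q k := by
    have := lt_of_log_le hvk
    have := two_pow_ord_ge (Q := Q) k
    omega
  set n := 2 * radIndex Q k v + 1 with hn
  have hoff : 2 * off (radSize Q) k ≤ n := by
    have := off_le_radIndex (Q := Q) k v
    omega
  refine half_measureReal_le_of_flip (n := n) ((hD.measurableSet.inter
    (cyl_oscillating a k).measurableSet).inter (measurableSet_spike k v)) fun ω hω => ?_
  have hDf : flipBit n ω ∈ D ↔ ω ∈ D := (hD.flip hoff ω).to_iff
  have hSf : flipBit n ω ∈ spike Q k v ↔ ω ∈ spike Q k v := spike_flip_odd k v _ ω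
  suffices h : 1 / 8 ≤ |blockSum Q a k m ω| ∨ 1 / 8 ≤ |blockSum Q a k m (flipBit n ω)| from
    h.imp (fun h => ⟨⟨hω.1, m, hm, h⟩, hω.2⟩)
      fun h => ⟨⟨hDf.2 hω.1, m, hm, h⟩, hSf.2 hω.2⟩
  set X : ℝ := haarCoeff Q a k m 0 * basisFn Q (restIndex k) ω +
    ∑ w ∈ (Finset.Ico 1 (2 ^ ord Q k)).erase v,
      haarCoeff Q a k m w * radType Q (radIndex Q k w) ω with hX
  set Y : ℝ := haarCoeff Q a k m v * radType Q (radIndex Q k v) ω with hY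
  have hmem : v ∈ Finset.Ico 1 (2 ^ ord Q k) := Finset.mem_Ico.2 ⟨by omega, hv⟩
  have h1 : blockSum Q a k m ω = X + Y := by
    rw [blockSum_eq a k hm, ← Finset.sum_erase_add _ _ hmem, ← add_assoc]
  have h2 : blockSum Q a k m (flipBit n ω) = X - Y := by
    rw [blockSum_eq a k hm, ← Finset.sum_erase_add _ _ hmem, ← add_assoc, sub_eq_add_neg, hX, hY]
    have e1 : basisFn Q (restIndex k) (flipBit n ω) = basisFn Q (restIndex k) ω := by
      refine (cyl_basisFn_restIndex k).flip ?_ ω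
      have := le_off_radSize (Q := Q) k
      omega
    have e2 : radType Q (radIndex Q k v) (flipBit n ω) = -radType Q (radIndex Q k v) ω := by
      rw [radType, radType, weight_flip_odd, rad_flipBit_same]; ring
    rw [e1, e2, mul_neg]
    refine congrArg (· + _) (congrArg (_ + ·) (Finset.sum_congr rfl fun w hw => ?_))
    have hw' := Finset.mem_Ico.1 (Finset.mem_of_mem_erase hw)
    have hne : radIndex Q k w ≠ radIndex Q k v := fun h =>
      Finset.ne_of_mem_erase hw (radIndex_inj (by omega) hw'.2 hv0 hv h).2
    rw [radType, radType, weight_flip_odd, rad_flipBit_of_ne (by omega)]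
  have h3 : 1 / 8 ≤ |Y| := by
    rw [hY, abs_mul, radType, abs_mul, abs_rad, one_mul, abs_of_pos (weight_pos _ _),
      weight_radIndex hv0 hv]
    exact hlarge.trans (mul_le_mul_of_nonneg_left (sqrt_two_pow_le_nodeWeight hvk hω.2)
      (abs_nonneg _))
  rw [h1, h2]
  by_contra! h
  have h4 := abs_sub (X + Y) (X - Y)
  rw [show X + Y - (X - Y) = 2 * Y by ring, abs_mul, abs_two] at h4
  linarith [h.1, h.2]

/-- Take the first level s with |c| 2^s ≥ 1. At least δ 2^s/4 of its nodes have a partial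
coefficient of size |c|/(8 √2^s), which the peak √2^(3s) raises to 1/8 or more. Their disjoint
spikes have conditional probability 2^(-3s-2), half of which is kept; the total is δ 4^(-s)/32, and
4^(-s) ≥ min 1 (c²/4) by minimality of s. -/
lemma le_measureReal_inter_oscillating (a : ℕ → ℝ) {k : ℕ} {δ : ℝ} (hδ : 0 < δ)
    (hE : δ * energy Q a k ≤ restCoeff Q a k ^ 2) (hc : 1 ≤ |restCoeff Q a k| * 2 ^ k)
    {D : Set (ℕ → Bool)} (hD : Cyl (2 * off (radSize Q) k) (· ∈ D)) :
    δ / 32 * min 1 (restCoeff Q a k ^ 2 / 4) * P.real D ≤ P.real (D ∩ oscillating Q a k) := by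
  classical
  set c := restCoeff Q a k with hcdef
  have hc0 : c ≠ 0 := by
    rintro h
    rw [h, abs_zero, zero_mul] at hc
    linarith
  have hex : ∃ s, 1 ≤ |c| * 2 ^ s := ⟨k, hc⟩
  set s := Nat.find hex with hs
  have hs1 : 1 ≤ |c| * 2 ^ s := Nat.find_spec hex
  have hsk : s ≤ k := Nat.find_min' hex hc
  have hs2 : min 1 (c ^ 2 / 4) ≤ (1 / 4) ^ s := by
    rcases Nat.eq_zero_or_pos s with h0 | h0
    · rw [h0, pow_zero]; exact min_le_left _ _
    · obtain ⟨t, ht⟩ : ∃ t, s = t + 1 := ⟨s - 1, by omega⟩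
      have h1 : ¬ 1 ≤ |c| * 2 ^ t := Nat.find_min hex (by omega)
      refine (min_le_right _ _).trans ?_
      have h2 : |c| * 2 ^ t ≤ 1 := (not_le.1 h1).le
      have h3 := sq_le_quarter_pow h2
      rw [ht, pow_succ (1 / 4 : ℝ) t]
      linarith
  clear_value s c
  set F := (Finset.range (2 ^ s)).filter fun q => ∃ m ≤ 2 ^ ord Q k,
    |c| / (8 * √2 ^ s) ≤ |∑ i ∈ Finset.range m, a (off (blockSize Q) k + i) *
      haar (ord Q k) i (2 ^ s + q)| with hF
  have hcard : δ * 2 ^ s / 4 ≤ (F.card : ℝ) :=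
    card_large_haar_coeff (hsk.trans_lt (lt_ord k)) (fun i => a (off (blockSize Q) k + i))
      hcdef hc0 hE
  have hnode : ∀ q ∈ F, 1 / 2 * ((1 / 2) ^ (3 * s + 2) * P.real D) ≤
      P.real (D ∩ oscillating Q a k ∩ spike Q k (2 ^ s + q)) := fun q hq => by
    obtain ⟨hq, m, hm, hqm⟩ := Finset.mem_filter.1 hq
    have hlog := log_two_pow_add (Finset.mem_range.1 hq)
    have h1 := measureReal_inter_spike (P := P) hD (2 ^ s + q)
    rw [codeLength, hlog] at h1
    rw [← h1]
    refine half_measureReal_inter_spike_le a (by positivity) (by rw [hlog]; exact hsk) hm ?_ hD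
    rw [hlog]
    refine le_trans ?_ (mul_le_mul_of_nonneg_right hqm (by positivity))
    have h2 : |c| / (8 * √2 ^ s) * √2 ^ (3 * s) = |c| * 2 ^ s / 8 := by
      rw [show 3 * s = s + (s + s) by ring, pow_add, pow_add, sqrt_two_pow_mul_self]
      field_simp
    rw [h2]
    linarith
  have hdisj : Set.PairwiseDisjoint (F : Set ℕ)
      fun q => D ∩ oscillating Q a k ∩ spike Q k (2 ^ s + q) := fun q _ q' _ hne => by
    refine Set.disjoint_left.2 fun ω h h' => hne ?_
    have := spike_unique h.2 h'.2
    omega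
  have h1 : ∑ q ∈ F, P.real (D ∩ oscillating Q a k ∩ spike Q k (2 ^ s + q)) ≤
      P.real (D ∩ oscillating Q a k) := by
    rw [← measureReal_biUnion_finset hdisj (fun q _ => (hD.measurableSet.inter
      (cyl_oscillating a k).measurableSet).inter (measurableSet_spike k (2 ^ s + q)))
      fun _ _ => measure_ne_top _ _]
    exact measureReal_mono (Set.iUnion₂_subset fun _ _ => Set.inter_subset_left)
      (measure_ne_top _ _)
  refine le_trans ?_ h1
  refine le_trans ?_ (Finset.sum_le_sum hnode)
  rw [Finset.sum_const, nsmul_eq_mul]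
  have hPD : 0 ≤ P.real D := measureReal_nonneg
  calc δ / 32 * min 1 (c ^ 2 / 4) * P.real D ≤ δ / 32 * (1 / 4) ^ s * P.real D := by gcongr
    _ = δ * 2 ^ s / 4 * (1 / 2 * ((1 / 2) ^ (3 * s + 2) * P.real D)) := by
        have : (1 / 2 : ℝ) ^ (3 * s + 2) = (1 / 4) ^ s * (1 / 2) ^ s * (1 / 4) := by
          rw [pow_add, mul_comm 3 s, show s * 3 = s * 2 + s by ring, pow_add, mul_comm s 2, pow_mul]
          norm_num
        have h2 : (1 / 2 : ℝ) ^ s * 2 ^ s = 1 := by rw [← mul_pow]; norm_num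
        rw [this]
        linear_combination (-δ / 32 * (1 / 4) ^ s * P.real D) * h2
    _ ≤ _ := mul_le_mul_of_nonneg_right hcard (by positivity)

lemma not_tendsto_of_frequently_oscillating {a : ℕ → ℝ} {ω : ℕ → Bool}
    (h : ∃ᶠ k in atTop, ω ∈ oscillating Q a k) :
    ¬ ∃ s, Tendsto (fun N => ∑ n ∈ Finset.range N, a n * theta Q n ω) atTop (𝓝 s) := by
  rintro ⟨s, hs⟩
  obtain ⟨N, hN⟩ := (Metric.tendsto_atTop.1 hs) (1 / 16) (by norm_num)
  obtain ⟨k, hk, m, hm, hkm⟩ := frequently_atTop.1 h N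
  have h1 := le_off (blockSize_pos (Q := Q)) k
  have h2 := hN (off (blockSize Q) k) (by omega)
  have h3 := hN (off (blockSize Q) k + m) (by omega)
  rw [sum_range_off_add, Real.dist_eq] at h3
  rw [Real.dist_eq] at h2
  rw [abs_lt] at h2 h3
  have h4 : |blockSum Q a k m ω| < 1 / 8 := abs_lt.2 ⟨by linarith [h2.1, h2.2, h3.1, h3.2],
    by linarith [h2.1, h2.2, h3.1, h3.2]⟩
  linarith

/-- Used to pass from summable probabilities to summable heavy energies. Blocks whose coefficient is
too small to be detected by a level up to k cost only a geometric series. -/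
lemma le_of_heavy {δ E c : ℝ} {k : ℕ} (hδ : 0 < δ) (hE : δ * E ≤ c ^ 2)
    (h : (if 1 ≤ |c| * 2 ^ k then δ / 32 * min 1 (c ^ 2 / 4) else 0) < δ / 32) :
    E ≤ (1 / 4) ^ k / δ +
      128 / δ ^ 2 * (if 1 ≤ |c| * 2 ^ k then δ / 32 * min 1 (c ^ 2 / 4) else 0) := by
  have h1 : E ≤ c ^ 2 / δ := by rw [le_div_iff₀ hδ]; linarith
  refine h1.trans ?_
  split_ifs at h ⊢ with hc
  · have h3 : min 1 (c ^ 2 / 4) = c ^ 2 / 4 := by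
      refine min_eq_right (le_of_lt ?_)
      by_contra! h4
      rw [min_eq_left h4] at h
      linarith
    have h4 : 128 / δ ^ 2 * (δ / 32 * (c ^ 2 / 4)) = c ^ 2 / δ := by
      field_simp; ring
    rw [h3, h4]
    have : 0 ≤ (1 / 4 : ℝ) ^ k / δ := by positivity
    linarith
  · rw [mul_zero, add_zero]
    exact div_le_div_of_nonneg_right (sq_le_quarter_pow (not_le.1 hc).le) hδ.le

open Classical in
lemma ae_not_tendsto_of_heavy_rest {a : ℕ → ℝ} {δ : ℝ} (hδ : 0 < δ)
    (h : ¬ Summable fun k => if δ * energy Q a k ≤ restCoeff Q a k ^ 2 then energy Q a k else 0) :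
    ∀ᵐ ω ∂P, ¬ ∃ s, Tendsto (fun N => ∑ n ∈ Finset.range N, a n * theta Q n ω) atTop (𝓝 s) := by
  set q : ℕ → ℝ := fun k => if δ * energy Q a k ≤ restCoeff Q a k ^ 2 ∧
    1 ≤ |restCoeff Q a k| * 2 ^ k then δ / 32 * min 1 (restCoeff Q a k ^ 2 / 4) else 0 with hq
  have hq0 : ∀ k, 0 ≤ q k := fun k => by
    simp only [hq]
    split_ifs <;> positivity
  have hdiv : ¬ Summable q := fun hsum => h <| by
    refine Summable.of_norm_bounded_eventually_nat
      (g := fun k => (1 / 4) ^ k / δ + 128 / δ ^ 2 * q k)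
      (((summable_geometric_of_lt_one (by norm_num) (by norm_num)).div_const δ).add
        (hsum.mul_left _)) ?_
    filter_upwards [hsum.tendsto_atTop_zero.eventually_lt_const
      (show 0 < δ / 32 by positivity)] with k hk
    by_cases h1 : δ * energy Q a k ≤ restCoeff Q a k ^ 2
    · rw [if_pos h1, Real.norm_eq_abs, abs_of_nonneg (energy_nonneg a k)]
      simp only [hq, h1, true_and] at hk ⊢
      exact le_of_heavy hδ h1 hk
    · rw [if_neg h1, norm_zero]
      have := hq0 k
      positivity
  filter_upwards [ae_frequently_mem (P := P) (B := oscillating Q a)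
    (N := fun k => 2 * off (radSize Q) k) (fun k l hkl => Nat.mul_le_mul_left 2 (off_mono hkl))
    (cyl_oscillating a) hq0 (fun k D hD => by
      by_cases hk : δ * energy Q a k ≤ restCoeff Q a k ^ 2 ∧ 1 ≤ |restCoeff Q a k| * 2 ^ k
      · simp only [hq, if_pos hk]
        exact le_measureReal_inter_oscillating a hδ hk.1 hk.2 hD
      · simp only [hq, if_neg hk, zero_mul]
        exact measureReal_nonneg) hdiv] with ω hω
  exact not_tendsto_of_frequently_oscillating hω

end BitSystem

namespace BitSystem

variable {Q : ℕ} {P : Measure (ℕ → Bool)} [FlipInvariant P]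

/-! ### Divergence caused by the functions of Rademacher type -/

lemma exists_cyl_sum {ι : Type*} (s : Finset ι) {f : ι → (ℕ → Bool) → ℝ}
    (hc : ∀ i, ∃ n, Cyl n (f i)) (c : ι → ℝ) : ∃ n, Cyl n fun ω => ∑ i ∈ s, c i * f i ω := by
  choose N hN using hc
  exact ⟨s.sup N, Cyl.sum fun i hi => ((hN i).mono (Finset.le_sup hi)).const_mul _⟩

lemma integral_sq_sum_of_orthonormal {ι : Type*} [DecidableEq ι] (s : Finset ι)
    {f : ι → (ℕ → Bool) → ℝ} (hc : ∀ i, ∃ n, Cyl n (f i))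
    (horth : ∀ i j, ∫ ω, f i ω * f j ω ∂P = if i = j then 1 else 0) (c : ι → ℝ) :
    ∫ ω, (∑ i ∈ s, c i * f i ω) ^ 2 ∂P = ∑ i ∈ s, c i ^ 2 := by
  have h1 : ∀ ω, (∑ i ∈ s, c i * f i ω) ^ 2 =
      ∑ i ∈ s, ∑ j ∈ s, c i * c j * (f i ω * f j ω) := fun ω => by
    rw [sq, Finset.sum_mul_sum]
    exact Finset.sum_congr rfl fun i _ => Finset.sum_congr rfl fun j _ => by ring
  have hint : ∀ i j, Integrable (fun ω => c i * c j * (f i ω * f j ω)) P := fun i j => by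
    obtain ⟨n, hn⟩ := hc i
    obtain ⟨m, hm⟩ := hc j
    exact (((hn.mono (le_max_left n m)).mul (hm.mono (le_max_right n m))).const_mul _).integrable P
  simp only [h1]
  rw [integral_finsetSum _ fun i _ => integrable_finsetSum _ fun j _ => hint i j]
  refine Finset.sum_congr rfl fun i hi => ?_
  rw [integral_finsetSum _ fun j _ => hint i j]
  simp only [integral_const_mul, horth]
  rw [Finset.sum_eq_single_of_mem i hi fun j _ hj => by rw [if_neg hj.symm, mul_zero]]
  rw [if_pos rfl, mul_one, sq]

lemma exists_cyl_radType (n : ℕ) : ∃ m, Cyl m (radType Q n) := ⟨_, cyl_radType n.lt_succ_self⟩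

lemma integral_radType_mul (n n' : ℕ) :
    ∫ ω, radType Q n ω * radType Q n' ω ∂P = if n = n' then 1 else 0 := by
  rw [← basisFn_radType, ← basisFn_radType, integral_basisFn_mul (by simp [ValidIndex])
    (by simp [ValidIndex])]
  simp

lemma radType_flip_same (n : ℕ) (ω : ℕ → Bool) :
    radType Q n (flipBit (2 * n + 1) ω) = -radType Q n ω := by
  rw [radType, radType, weight_flip_odd, rad_flipBit_same]; ring

lemma radType_flip_of_ne {n m : ℕ} (h : n ≠ m) (ω : ℕ → Bool) :
    radType Q n (flipBit (2 * m + 1) ω) = radType Q n ω := by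
  rw [radType, radType, weight_flip_odd, rad_flipBit_of_ne (by omega)]

lemma radType_sq (n : ℕ) (ω : ℕ → Bool) : radType Q n ω ^ 2 = weight Q n ω ^ 2 := by
  rw [radType, mul_pow, rad_sq, one_mul]

/-- Within a block the spikes are disjoint; across blocks they are independent, since the code word
of the earlier block ends before the later block begins. -/
lemma measureReal_spike_inter_le {k v k' v' : ℕ} (hne : (k, v) ≠ (k', v')) (h : Nat.log 2 v ≤ k)
    (h' : Nat.log 2 v' ≤ k') :
    P.real (spike Q k v ∩ spike Q k' v') ≤ (1 / 2) ^ codeLength v * (1 / 2) ^ codeLength v' := by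
  wlog hk : k ≤ k' generalizing k v k' v'
  · rw [Set.inter_comm, mul_comm]
    exact this hne.symm h' h (by omega)
  rcases hk.eq_or_lt with rfl | hlt
  · have : spike Q k v ∩ spike Q k v' = ∅ :=
      Set.eq_empty_of_forall_notMem fun ω hω => hne (by rw [spike_unique hω.1 hω.2])
    rw [this, measureReal_empty]
    positivity
  · have hc : Cyl (2 * off (radSize Q) k') (· ∈ spike Q k v) := by
      refine (cyl_spike k v).mono ?_
      have h1 := off_mono (w := radSize Q) (Nat.succ_le_of_lt hlt)
      have h2 := codeLength_le h
      have h3 := two_pow_ord_ge (Q := Q) k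
      rw [Nat.succ_eq_add_one, off_succ] at h1
      have h4 : radSize Q k = 2 ^ ord Q k - 1 := rfl
      have h5 := Nat.one_le_two_pow (n := k)
      omega
    rw [measureReal_inter_spike hc, measureReal_spike, mul_comm]

/-- If both weights have spikes, their squares are (1 + X)/2 and (1 + X')/2 with means of X and X'
equal to 1 and mean of XX' at most 1. So products of distinct functions have norm at most 1,
whatever the height of the spikes. -/
lemma integral_nodeWeight_sq_mul_le {k v k' v' : ℕ} (hne : (k, v) ≠ (k', v')) :
    ∫ ω, nodeWeight Q k v ω ^ 2 * nodeWeight Q k' v' ω ^ 2 ∂P ≤ 1 := by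
  by_cases h : Nat.log 2 v ≤ k
  swap
  · have : ∀ ω, nodeWeight Q k v ω = 1 := fun ω => if_neg h
    simp only [this, one_pow, one_mul, integral_nodeWeight_sq, le_refl]
  by_cases h' : Nat.log 2 v' ≤ k'
  swap
  · have : ∀ ω, nodeWeight Q k' v' ω = 1 := fun ω => if_neg h'
    simp only [this, one_pow, mul_one, integral_nodeWeight_sq, le_refl]
  have e : ∀ ω, nodeWeight Q k v ω ^ 2 * nodeWeight Q k' v' ω ^ 2 =
      1 / 2 * nodeWeight Q k v ω ^ 2 + (1 / 2 * nodeWeight Q k' v' ω ^ 2 + (-1 / 4 +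
        1 / 4 * 2 ^ codeLength v * 2 ^ codeLength v' *
          (spike Q k v ∩ spike Q k' v').indicator (fun _ => 1) ω)) := fun ω => by
    rw [nodeWeight_sq h, nodeWeight_sq h']
    have : (spike Q k v ∩ spike Q k' v').indicator (fun _ => (1 : ℝ)) ω =
      (spike Q k v).indicator (fun _ => 1) ω * (spike Q k' v').indicator (fun _ => 1) ω := by
      rw [← Set.inter_indicator_mul]; simp only [mul_one]
    rw [this]
    ring
  have hi1 : Integrable (fun ω => 1 / 2 * nodeWeight Q k v ω ^ 2) P :=
    ((cyl_nodeWeight k v).comp fun x => 1 / 2 * x ^ 2).integrable P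
  have hi2 : Integrable (fun ω => 1 / 2 * nodeWeight Q k' v' ω ^ 2) P :=
    ((cyl_nodeWeight k' v').comp fun x => 1 / 2 * x ^ 2).integrable P
  have hm := (measurableSet_spike (Q := Q) k v).inter (measurableSet_spike (Q := Q) k' v')
  have hi3 : Integrable (fun ω => 1 / 4 * 2 ^ codeLength v * 2 ^ codeLength v' *
      (spike Q k v ∩ spike Q k' v').indicator (fun _ => (1 : ℝ)) ω) P :=
    ((integrable_const _).indicator hm).const_mul _
  have hi4 : Integrable (fun ω => -1 / 4 + 1 / 4 * 2 ^ codeLength v * 2 ^ codeLength v' *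
      (spike Q k v ∩ spike Q k' v').indicator (fun _ => (1 : ℝ)) ω) P :=
    (integrable_const _).add hi3
  have hi5 : Integrable (fun ω => 1 / 2 * nodeWeight Q k' v' ω ^ 2 + (-1 / 4 +
      1 / 4 * 2 ^ codeLength v * 2 ^ codeLength v' *
      (spike Q k v ∩ spike Q k' v').indicator (fun _ => (1 : ℝ)) ω)) P := hi2.add hi4
  simp only [e]
  rw [integral_add hi1 hi5, integral_add hi2 hi4, integral_add (integrable_const _) hi3,
    integral_const_mul, integral_const_mul, integral_const_mul, integral_nodeWeight_sq,
    integral_nodeWeight_sq, integral_indicator_const _ hm]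
  have h1 := measureReal_spike_inter_le (P := P) (Q := Q) hne h h'
  have h2 : ∀ n : ℕ, (2 : ℝ) ^ n * (1 / 2) ^ n = 1 := fun n => by rw [← mul_pow]; norm_num
  have h3 := mul_le_mul_of_nonneg_left h1
    (show (0 : ℝ) ≤ 2 ^ codeLength v * 2 ^ codeLength v' by positivity)
  rw [mul_mul_mul_comm, h2, h2, mul_one] at h3
  simp only [integral_const, probReal_univ, smul_eq_mul, mul_one, one_mul]
  linarith

lemma integral_weight_sq_mul_le {n n' : ℕ} (hne : n ≠ n') :
    ∫ ω, weight Q n ω ^ 2 * weight Q n' ω ^ 2 ∂P ≤ 1 := by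
  obtain ⟨k, v, h0, hv, rfl⟩ := exists_radIndex (Q := Q) n
  obtain ⟨k', v', h0', hv', rfl⟩ := exists_radIndex (Q := Q) n'
  rw [weight_radIndex h0 hv, weight_radIndex h0' hv']
  refine integral_nodeWeight_sq_mul_le fun h => hne ?_
  simp only [Prod.mk.injEq] at h
  rw [h.1, h.2]

/-- Products of two different functions of Rademacher type. -/
noncomputable def radPair (Q : ℕ) (p : ℕ × ℕ) (ω : ℕ → Bool) : ℝ :=
  if p.1 < p.2 then radType Q p.1 ω * radType Q p.2 ω else 0

lemma exists_cyl_radPair (p : ℕ × ℕ) : ∃ n, Cyl n (radPair Q p) := by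
  unfold radPair
  split_ifs with h
  · exact ⟨_, (cyl_radType (h.trans p.2.lt_succ_self)).mul (cyl_radType p.2.lt_succ_self)⟩
  · exact ⟨0, Cyl.const 0⟩

lemma integral_radPair_mul_of_ne {p p' : ℕ × ℕ} (hne : p ≠ p') :
    ∫ ω, radPair Q p ω * radPair Q p' ω ∂P = 0 := by
  obtain ⟨n, n'⟩ := p
  obtain ⟨m, m'⟩ := p'
  by_cases h : n < n'
  swap
  · simp [radPair, h]
  by_cases h' : m < m'
  swap
  · simp [radPair, h']
  simp only [radPair, h, h', if_true]
  rcases lt_trichotomy n' m' with hlt | rfl | hlt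
  · refine integral_eq_zero_of_flip (n := 2 * m' + 1) fun ω => ?_
    rw [radType_flip_same, radType_flip_of_ne (by omega), radType_flip_of_ne (by omega),
      radType_flip_of_ne (by omega)]
    ring
  · have hnm : n ≠ m := fun e => hne (by rw [e])
    refine integral_eq_zero_of_flip (n := 2 * n + 1) fun ω => ?_
    rw [radType_flip_same, radType_flip_of_ne (by omega), radType_flip_of_ne (by omega)]
    ring
  · refine integral_eq_zero_of_flip (n := 2 * n' + 1) fun ω => ?_
    rw [radType_flip_same, radType_flip_of_ne (by omega), radType_flip_of_ne (by omega),
      radType_flip_of_ne (by omega)]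
    ring

lemma integral_radPair_mul_self_le (p : ℕ × ℕ) :
    ∫ ω, radPair Q p ω * radPair Q p ω ∂P ≤ 1 := by
  by_cases h : p.1 < p.2
  · refine le_trans (le_of_eq (integral_congr_ae (Eventually.of_forall fun ω => ?_)))
      (integral_weight_sq_mul_le (P := P) (Q := Q) h.ne)
    simp only [radPair, if_pos h, ← radType_sq]
    ring
  · simp [radPair, h]

lemma summable_sq_setIntegral_radPair (D : Set (ℕ → Bool)) :
    Summable fun p => (∫ ω in D, radPair Q p ω ∂P) ^ 2 :=
  summable_of_sum_le (c := 1) (fun _ => sq_nonneg _) fun _ =>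
    sum_sq_setIntegral_le exists_cyl_radPair (fun _ _ => integral_radPair_mul_of_ne)
      (fun p _ => integral_radPair_mul_self_le p) D

lemma sq_sum_radType (s : Finset ℕ) (b : ℕ → ℝ) (ω : ℕ → Bool) :
    (∑ n ∈ s, b n * radType Q n ω) ^ 2 = ∑ n ∈ s, b n ^ 2 * radType Q n ω ^ 2 +
      ∑ p ∈ s ×ˢ s, 2 * (b p.1 * b p.2) * radPair Q p ω := by
  have h1 : ∀ n n', b n * radType Q n ω * (b n' * radType Q n' ω) =
      (if n = n' then b n ^ 2 * radType Q n ω ^ 2 else 0) +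
      (b n * b n' * radPair Q (n, n') ω + b n * b n' * radPair Q (n', n) ω) := fun n n' => by
    rcases lt_trichotomy n n' with h | rfl | h
    · simp only [radPair, h, h.ne, not_lt.2 h.le, if_true, if_false]; ring
    · simp only [radPair, lt_irrefl, if_true, if_false]; ring
    · simp only [radPair, h, h.ne', not_lt.2 h.le, if_true, if_false]; ring
  rw [sq, Finset.sum_mul_sum, Finset.sum_product]
  simp only [h1, Finset.sum_add_distrib]
  refine congrArg₂ (· + ·) (Finset.sum_congr rfl fun n hn => ?_) ?_
  · rw [Finset.sum_ite_eq, if_pos hn]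
  · rw [Finset.sum_comm (f := fun n n' => b n * b n' * radPair Q (n', n) ω),
      ← Finset.sum_add_distrib]
    refine Finset.sum_congr rfl fun n _ => ?_
    rw [← Finset.sum_add_distrib]
    exact Finset.sum_congr rfl fun n' _ => by ring

/-- Zygmund's argument. The diagonal gives at least d/2 times the energy because the squared weights
are at least 1/2. The integrals of the pairs over D are square summable by Bessel, so beyond a
finite set of pairs Cauchy–Schwarz bounds the off-diagonal part by 2 · d/8. -/
lemma exists_forall_le_setIntegral_sq {D : Set (ℕ → Bool)}
    (hpos : 0 < P.real D) : ∃ m₀, ∀ (b : ℕ → ℝ) (s : Finset ℕ), (∀ n ∈ s, m₀ ≤ n) →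
      P.real D / 4 * ∑ n ∈ s, b n ^ 2 ≤ ∫ ω in D, (∑ n ∈ s, b n * radType Q n ω) ^ 2 ∂P := by
  set d := P.real D with hd
  obtain ⟨S, hS⟩ := summable_iff_vanishing_norm.1 (summable_sq_setIntegral_radPair (P := P) (Q := Q) D)
    ((d / 8) ^ 2) (by positivity)
  refine ⟨S.sup Prod.fst + 1, fun b s hs => ?_⟩
  set B := ∑ n ∈ s, b n ^ 2 with hB
  have hB0 : 0 ≤ B := Finset.sum_nonneg fun _ _ => sq_nonneg _
  set F : ℕ × ℕ → ℝ := fun p => ∫ ω in D, radPair Q p ω ∂P with hF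
  have hi1 : ∀ n, Integrable (fun ω => b n ^ 2 * radType Q n ω ^ 2) P := fun n => by
    obtain ⟨m, hm⟩ := exists_cyl_radType (Q := Q) n
    exact (hm.comp fun x => b n ^ 2 * x ^ 2).integrable P
  have hi2 : ∀ p : ℕ × ℕ, Integrable (fun ω => 2 * (b p.1 * b p.2) * radPair Q p ω) P := fun p => by
    obtain ⟨m, hm⟩ := exists_cyl_radPair (Q := Q) p
    exact (hm.const_mul _).integrable P
  have h1 : ∫ ω in D, (∑ n ∈ s, b n * radType Q n ω) ^ 2 ∂P =
      ∑ n ∈ s, b n ^ 2 * ∫ ω in D, radType Q n ω ^ 2 ∂P +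
        2 * ∑ p ∈ s ×ˢ s, (b p.1 * b p.2) * F p := by
    simp only [sq_sum_radType]
    rw [integral_add (integrable_finsetSum _ fun n _ => (hi1 n).integrableOn)
      (integrable_finsetSum _ fun p _ => (hi2 p).integrableOn),
      integral_finsetSum _ fun n _ => (hi1 n).integrableOn,
      integral_finsetSum _ fun p _ => (hi2 p).integrableOn, Finset.mul_sum]
    simp only [integral_const_mul, mul_assoc, hF]
  have h2 : ∀ n, d / 2 ≤ ∫ ω in D, radType Q n ω ^ 2 ∂P := fun n => by
    obtain ⟨m, hm⟩ := exists_cyl_radType (Q := Q) n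
    have h3 : ∫ _ω in D, (1 / 2 : ℝ) ∂P ≤ ∫ ω in D, radType Q n ω ^ 2 ∂P :=
      setIntegral_mono (integrable_const _) ((hm.comp (· ^ 2)).integrable P).integrableOn
        fun ω => by
          change 1 / 2 ≤ radType Q n ω ^ 2
          rw [radType_sq]; exact half_le_weight_sq n ω
    rw [setIntegral_const, smul_eq_mul] at h3
    linarith
  have h3 : d / 2 * B ≤ ∑ n ∈ s, b n ^ 2 * ∫ ω in D, radType Q n ω ^ 2 ∂P := by
    rw [hB, Finset.mul_sum]
    refine Finset.sum_le_sum fun n _ => ?_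
    rw [mul_comm]
    exact mul_le_mul_of_nonneg_left (h2 n) (sq_nonneg _)
  have h4 : ∑ p ∈ s ×ˢ s, F p ^ 2 ≤ (d / 8) ^ 2 := by
    have := hS (s ×ˢ s) (Finset.disjoint_left.2 fun p hp hpS => by
      have h5 := hs _ (Finset.mem_product.1 hp).1
      have h6 := Finset.le_sup (f := Prod.fst) hpS
      omega)
    exact (le_abs_self _).trans this.le
  have h5 : ∑ p ∈ s ×ˢ s, (b p.1 * b p.2) ^ 2 = B ^ 2 := by
    rw [Finset.sum_product, sq, hB, Finset.sum_mul_sum]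
    simp only [mul_pow]
  have h6 : |∑ p ∈ s ×ˢ s, (b p.1 * b p.2) * F p| ≤ B * (d / 8) := by
    refine abs_le_of_sq_le_sq ?_ (by positivity)
    refine (Finset.sum_mul_sq_le_sq_mul_sq _ _ _).trans ?_
    rw [h5, mul_pow]
    exact mul_le_mul_of_nonneg_left h4 (sq_nonneg _)
  rw [h1]
  have := (abs_le.1 h6).1
  linarith

end BitSystem

namespace BitSystem

/-! ### Light blocks and the divergence theorem -/

variable {Q : ℕ} {P : Measure (ℕ → Bool)} [FlipInvariant P]

lemma integral_rest_sum_sq (c : ℕ → ℝ) (k : ℕ) :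
    ∫ ω, (∑ j ∈ Finset.range k, c j * basisFn Q (restIndex j) ω) ^ 2 ∂P =
      ∑ j ∈ Finset.range k, c j ^ 2 :=
  integral_sq_sum_of_orthonormal _ (fun j => ⟨_, cyl_basisFn_restIndex j⟩) (fun i j => by
    rw [integral_basisFn_mul (restIndex_valid i) (restIndex_valid j)]
    exact if_congr ⟨restIndex_inj, congrArg _⟩ rfl rfl) c

/-- The points at which the partial sums over whole blocks are bounded by `K`. -/
def blockBounded (Q : ℕ) (a : ℕ → ℝ) (K : ℝ) : Set (ℕ → Bool) :=
  {ω | ∀ k, |∑ n ∈ Finset.range (off (blockSize Q) k), a n * theta Q n ω| ≤ K}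

lemma measurableSet_blockBounded (a : ℕ → ℝ) (K : ℝ) :
    MeasurableSet (blockBounded Q a K) := by
  have : blockBounded Q a K =
      ⋂ k, {ω | |∑ n ∈ Finset.range (off (blockSize Q) k), a n * theta Q n ω| ≤ K} := by
    ext; simp [blockBounded]
  rw [this]
  refine MeasurableSet.iInter fun k => ?_
  obtain ⟨m, hm⟩ := exists_cyl_sum (Finset.range (off (blockSize Q) k)) exists_cyl_theta a
  exact (hm.comp fun x => |x| ≤ K).measurableSet

lemma setIntegral_sq_sub_le {D : Set (ℕ → Bool)} {f g : (ℕ → Bool) → ℝ} {n m : ℕ} (hf : Cyl n f)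
    (hg : Cyl m g) : ∫ ω in D, (f ω - g ω) ^ 2 ∂P ≤
      2 * ∫ ω in D, f ω ^ 2 ∂P + 2 * ∫ ω, g ω ^ 2 ∂P := by
  have h1 : Integrable (fun ω => 2 * f ω ^ 2) P := (hf.comp fun x => 2 * x ^ 2).integrable P
  have h2 : Integrable (fun ω => 2 * g ω ^ 2) P := (hg.comp fun x => 2 * x ^ 2).integrable P
  have h3 : Integrable (fun ω => (f ω - g ω) ^ 2) P :=
    ((hf.mono (le_max_left n m)).comp₂ (hg.mono (le_max_right n m))
      fun x y => (x - y) ^ 2).integrable P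
  have h4 : ∫ ω in D, (f ω - g ω) ^ 2 ∂P ≤ ∫ ω in D, (2 * f ω ^ 2 + 2 * g ω ^ 2) ∂P :=
    setIntegral_mono h3.integrableOn (h1.add h2).integrableOn fun ω => by
      have := sq_nonneg (f ω + g ω)
      change (f ω - g ω) ^ 2 ≤ 2 * f ω ^ 2 + 2 * g ω ^ 2
      linarith
  have h5 : ∫ ω in D, 2 * g ω ^ 2 ∂P ≤ ∫ ω, 2 * g ω ^ 2 ∂P :=
    setIntegral_le_integral h2 (Eventually.of_forall fun ω => by
      change 0 ≤ 2 * g ω ^ 2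
      positivity)
  rw [integral_add h1.integrableOn h2.integrableOn] at h4
  simp only [integral_const_mul] at h4 h5
  linarith

/-- On D the Rademacher part is a bounded function minus the remaining part, whose energy is at most
δE; the lower estimate on D forces (d/8 - 4δ) E to stay bounded. As E tends to infinity, d ≤ 32δ
follows. -/
lemma measureReal_blockBounded_le {a : ℕ → ℝ} {δ : ℝ} (hδ : 0 < δ)
    (hlight : ∀ k, restCoeff Q a k ^ 2 ≤ δ * energy Q a k) (ha : ¬ Summable (energy Q a)) (K : ℝ) :
    P.real (blockBounded Q a K) ≤ 32 * δ := by
  set D := blockBounded Q a K with hD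
  set d := P.real D with hd
  by_contra! hlt
  have hd0 : 0 < d := by linarith
  have hd1 : d ≤ 1 := measureReal_le_one
  obtain ⟨m₀, hm₀⟩ := exists_forall_le_setIntegral_sq (Q := Q) hd0
  set b := radCoeff Q a with hb
  set C₀ := ∑ n ∈ Finset.range m₀, b n ^ 2 with hC₀
  have hC₀0 : 0 ≤ C₀ := Finset.sum_nonneg fun _ _ => sq_nonneg _
  have hbound : ∀ k, (d / 8 - 4 * δ) * ∑ j ∈ Finset.range k, energy Q a j ≤
      4 * K ^ 2 + 2 * C₀ + d / 4 * C₀ := fun k => by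
    set E := ∑ j ∈ Finset.range k, energy Q a j with hE
    have hE0 : 0 ≤ E := Finset.sum_nonneg fun j _ => energy_nonneg a j
    set N := off (radSize Q) k with hN
    set c2 := ∑ j ∈ Finset.range k, restCoeff Q a j ^ 2 with hc2
    have hcE : c2 ≤ δ * E := by
      rw [hc2, hE, Finset.mul_sum]
      exact Finset.sum_le_sum fun j _ => hlight j
    set s := (Finset.range N).filter (m₀ ≤ ·) with hs
    set t := (Finset.range N).filter (¬ m₀ ≤ ·) with ht
    have hst : ∀ f : ℕ → ℝ, ∑ n ∈ s, f n + ∑ n ∈ t, f n = ∑ n ∈ Finset.range N, f n :=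
      fun f => Finset.sum_filter_add_sum_filter_not _ _ _
    have htC : ∑ n ∈ t, b n ^ 2 ≤ C₀ := by
      refine Finset.sum_le_sum_of_subset_of_nonneg (fun n hn => ?_) fun _ _ _ => sq_nonneg _
      simp only [ht, Finset.mem_filter, Finset.mem_range] at hn ⊢
      omega
    have hsum : ∑ n ∈ Finset.range N, b n ^ 2 = E - c2 := by
      rw [hb, hN, sum_radCoeff_sq, Finset.sum_sub_distrib]
    obtain ⟨n₁, hU⟩ := exists_cyl_sum (Finset.range (off (blockSize Q) k))
      (exists_cyl_theta (Q := Q)) a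
    obtain ⟨n₂, hV⟩ := exists_cyl_sum (Finset.range k)
      (fun j => ⟨_, cyl_basisFn_restIndex (Q := Q) j⟩) (restCoeff Q a)
    obtain ⟨n₃, hW⟩ := exists_cyl_sum (Finset.range N) (exists_cyl_radType (Q := Q)) b
    obtain ⟨n₄, hT⟩ := exists_cyl_sum t (exists_cyl_radType (Q := Q)) b
    have h1 : d / 4 * _ ≤ _ := hm₀ b s fun n hn => (Finset.mem_filter.1 hn).2
    have h2 := setIntegral_sq_sub_le (P := P) (D := D) hW hT
    have h3 := setIntegral_sq_sub_le (P := P) (D := D) hU hV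
    have e1 : ∀ ω, ∑ n ∈ Finset.range N, b n * radType Q n ω - ∑ n ∈ t, b n * radType Q n ω =
        ∑ n ∈ s, b n * radType Q n ω := fun ω => by
      rw [← hst fun n => b n * radType Q n ω, add_sub_cancel_right]
    have e2 : ∀ ω, ∑ n ∈ Finset.range (off (blockSize Q) k), a n * theta Q n ω -
        ∑ j ∈ Finset.range k, restCoeff Q a j * basisFn Q (restIndex j) ω =
        ∑ n ∈ Finset.range N, b n * radType Q n ω := fun ω => by
      rw [sum_blockSum, add_sub_cancel_left]
    simp only [e1] at h2
    simp only [e2] at h3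
    rw [integral_sq_sum_of_orthonormal t exists_cyl_radType integral_radType_mul] at h2
    rw [integral_rest_sum_sq] at h3
    have h4 : ∫ ω in D, (∑ n ∈ Finset.range (off (blockSize Q) k), a n * theta Q n ω) ^ 2 ∂P ≤
        K ^ 2 := by
      have h5 : ∫ ω in D, (∑ n ∈ Finset.range (off (blockSize Q) k), a n * theta Q n ω) ^ 2 ∂P ≤
          ∫ _ω in D, K ^ 2 ∂P := by
        refine setIntegral_mono_on ((hU.comp (· ^ 2)).integrable P).integrableOn
          (integrable_const _) (measurableSet_blockBounded a K) fun ω hω => ?_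
        have := hω k
        rw [← sq_abs]
        exact pow_le_pow_left₀ (abs_nonneg _) this 2
      rw [setIntegral_const, smul_eq_mul] at h5
      exact h5.trans (mul_le_of_le_one_left (sq_nonneg K) hd1)
    have h6 := hst fun n => b n ^ 2
    rw [hsum] at h6
    have h7 : d / 4 * (E - c2 - C₀) ≤ d / 4 * ∑ n ∈ s, b n ^ 2 :=
      mul_le_mul_of_nonneg_left (by linarith) (by positivity)
    have h8 : d / 4 * c2 ≤ d / 8 * E := by
      have : δ * E ≤ 1 / 2 * E := mul_le_mul_of_nonneg_right (by linarith) hE0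
      have := mul_le_mul_of_nonneg_left (hcE.trans this) (show 0 ≤ d / 4 by positivity)
      linarith
    change _ ≤ 2 * ∫ ω in D, (∑ n ∈ Finset.range (off (blockSize Q) k), a n * theta Q n ω) ^ 2 ∂P +
      2 * c2 at h3
    clear_value d E c2 C₀ D
    linarith
  refine ha (summable_of_sum_range_le (c := (4 * K ^ 2 + 2 * C₀ + d / 4 * C₀) / (d / 8 - 4 * δ))
    (energy_nonneg a) fun k => ?_)
  rw [le_div_iff₀ (by linarith), mul_comm]
  exact hbound k

/-- The points at which the series converges. -/
def convergenceSet (Q : ℕ) (a : ℕ → ℝ) : Set (ℕ → Bool) :=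
  {ω | ∃ s, Tendsto (fun N => ∑ n ∈ Finset.range N, a n * theta Q n ω) atTop (𝓝 s)}

lemma measureReal_convergenceSet_le {a : ℕ → ℝ} {δ : ℝ} (hδ : 0 < δ)
    (hlight : ∀ k, restCoeff Q a k ^ 2 ≤ δ * energy Q a k) (ha : ¬ Summable (energy Q a)) :
    P.real (convergenceSet Q a) ≤ 32 * δ := by
  have hsub : convergenceSet Q a ⊆ ⋃ K : ℕ, blockBounded Q a K := by
    rintro ω ⟨s, hs⟩
    obtain ⟨C, hC⟩ := (Metric.isBounded_range_of_tendsto _ hs).exists_norm_le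
    obtain ⟨K, hK⟩ := exists_nat_ge C
    exact Set.mem_iUnion.2 ⟨K, fun k => (hC _ ⟨_, rfl⟩).trans hK⟩
  have hmono : Monotone fun K : ℕ => blockBounded Q a K := fun K L hKL ω hω k =>
    (hω k).trans (Nat.cast_le.2 hKL)
  have h1 := tendsto_measure_iUnion_atTop (μ := P) hmono
  have h2 : P (⋃ K : ℕ, blockBounded Q a K) ≤ ENNReal.ofReal (32 * δ) := by
    refine le_of_tendsto' h1 fun K => ?_
    rw [Function.comp_apply, ← ofReal_measureReal]
    exact ENNReal.ofReal_le_ofReal (measureReal_blockBounded_le hδ hlight ha K)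
  exact ENNReal.toReal_le_of_le_ofReal (by positivity) ((measure_mono hsub).trans h2)

/-- The system is a divergence system. -/
theorem ae_not_tendsto_theta_series {a : ℕ → ℝ} (ha : ¬ Summable fun n => a n ^ 2) :
    ∀ᵐ ω ∂P, ¬ ∃ s, Tendsto (fun N => ∑ n ∈ Finset.range N, a n * theta Q n ω) atTop (𝓝 s) := by
  classical
  rw [← summable_energy_iff (Q := Q)] at ha
  have hself : ∀ δ > 0, P.real (convergenceSet Q a) ≤ 32 * δ := fun δ hδ => by
    -- If the heavy energy is summable, the heavy part a₁ converges a.e. by the convergence theorem.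
    -- Up to a null set the series of a then converges only where that of the light part a₂ does.
    by_cases hs : Summable fun k =>
      if δ * energy Q a k ≤ restCoeff Q a k ^ 2 then energy Q a k else 0
    swap
    · have h1 : P.real (convergenceSet Q a) = 0 := by
        have : P (convergenceSet Q a) = 0 := by
          have h2 := ae_not_tendsto_of_heavy_rest (P := P) hδ hs
          rw [ae_iff] at h2
          simp only [not_not] at h2
          exact h2
        rw [Measure.real, this, ENNReal.toReal_zero]
      rw [h1]; positivity
    set H : ℕ → Prop := fun k => δ * energy Q a k ≤ restCoeff Q a k ^ 2 with hH
    set a₁ : ℕ → ℝ := fun n => if H (blk (blockSize Q) n) then a n else 0 with ha₁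
    set a₂ : ℕ → ℝ := fun n => if H (blk (blockSize Q) n) then 0 else a n with ha₂
    have hblk : ∀ {k i}, i ∈ Finset.range (2 ^ ord Q k) →
        blk (blockSize Q) (off (blockSize Q) k + i) = k := fun hi =>
      blk_off_add blockSize_pos (Finset.mem_range.1 hi)
    have e1 : ∀ k, energy Q a₁ k = if H k then energy Q a k else 0 := fun k => by
      have : ∀ i ∈ Finset.range (2 ^ ord Q k), a₁ (off (blockSize Q) k + i) ^ 2 =
          if H k then a (off (blockSize Q) k + i) ^ 2 else 0 := fun i hi => by
        simp only [ha₁, hblk hi]; split_ifs <;> simp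
      rw [energy, Finset.sum_congr rfl this]
      split_ifs <;> simp [energy]
    have e2 : ∀ k, energy Q a₂ k = if H k then 0 else energy Q a k := fun k => by
      have : ∀ i ∈ Finset.range (2 ^ ord Q k), a₂ (off (blockSize Q) k + i) ^ 2 =
          if H k then 0 else a (off (blockSize Q) k + i) ^ 2 := fun i hi => by
        simp only [ha₂, hblk hi]; split_ifs <;> simp
      rw [energy, Finset.sum_congr rfl this]
      split_ifs <;> simp [energy]
    have e3 : ∀ k, ¬ H k → restCoeff Q a₂ k = restCoeff Q a k := fun k hk => by
      unfold restCoeff haarCoeff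
      exact Finset.sum_congr rfl fun i hi => by simp only [ha₂, hblk hi, if_neg hk]
    have hs₁ : Summable (energy Q a₁) := by
      rw [funext e1]; exact hs
    have hs₂ : ¬ Summable (energy Q a₂) := fun h => ha <| by
      refine (hs₁.add h).congr fun k => ?_
      rw [e1, e2]; split_ifs <;> simp
    have hlight : ∀ k, restCoeff Q a₂ k ^ 2 ≤ δ * energy Q a₂ k := fun k => by
      by_cases hk : H k
      · have h1 := restCoeff_sq_le (Q := Q) a₂ k
        rw [e2, if_pos hk] at h1 ⊢
        rwa [mul_zero]
      · rw [e2, if_neg hk, e3 k hk]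
        exact (not_le.1 hk).le
    refine le_trans ?_ (measureReal_convergenceSet_le (P := P) hδ hlight hs₂)
    refine ENNReal.toReal_mono (measure_ne_top _ _) (measure_mono_ae ?_)
    filter_upwards [ae_tendsto_theta_series (P := P) (Q := Q) ((summable_energy_iff a₁).1 hs₁)]
      with ω ⟨t, ht⟩ ⟨s, hs⟩
    refine ⟨s - t, (hs.sub ht).congr fun N => ?_⟩
    rw [← Finset.sum_sub_distrib]
    refine Finset.sum_congr rfl fun n _ => ?_
    simp only [ha₁, ha₂]
    split_ifs <;> ring
  have hzero : P.real (convergenceSet Q a) = 0 := by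
    refine le_antisymm (le_of_forall_pos_le_add fun ε hε => ?_) measureReal_nonneg
    have := hself (ε / 32) (by positivity)
    linarith
  rw [ae_iff]
  simp only [not_not]
  exact (measureReal_eq_zero_iff).1 hzero

end BitSystem

namespace BitSystem

/-! ### Binary digits -/

/-- The binary digits of a real number. -/
noncomputable def digits (x : ℝ) (n : ℕ) : Bool := decide (⌊2 ^ (n + 1) * x⌋₊ % 2 = 1)

lemma measurable_digits : Measurable digits := by
  refine measurable_pi_lambda _ fun n => ?_
  have h : Measurable fun x : ℝ => ⌊2 ^ (n + 1) * x⌋₊ :=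
    Nat.measurable_floor.comp (measurable_const_mul _)
  exact (measurable_of_countable fun m : ℕ => decide (m % 2 = 1)).comp h

lemma floor_two_pow_div (x : ℝ) (n j : ℕ) :
    ⌊2 ^ n * x⌋₊ = ⌊2 ^ (n + j) * x⌋₊ / 2 ^ j := by
  have h := Nat.floor_div_natCast (2 ^ (n + j) * x) (2 ^ j)
  rw [← h]
  congr 1
  push_cast
  rw [pow_add]
  field_simp

lemma digits_injOn : Set.InjOn digits (Set.Ico 0 1) := by
  intro x hx y hy hxy
  have h1 : ∀ n : ℕ, ⌊2 ^ n * x⌋₊ = ⌊2 ^ n * y⌋₊ := fun n => by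
    induction n with
    | zero => simp [Nat.floor_eq_zero.2 hx.2, Nat.floor_eq_zero.2 hy.2]
    | succ n ih =>
      have h2 := congrFun hxy n
      simp only [digits, decide_eq_decide] at h2
      have h3 := floor_two_pow_div x n 1
      have h4 := floor_two_pow_div y n 1
      omega
  have h2 : ∀ n : ℕ, |x - y| ≤ (1 / 2) ^ n := fun n => by
    have hx1 := Nat.floor_le (show 0 ≤ 2 ^ n * x from mul_nonneg (by positivity) hx.1)
    have hy1 := Nat.floor_le (show 0 ≤ 2 ^ n * y from mul_nonneg (by positivity) hy.1)
    have hx2 := Nat.lt_floor_add_one (2 ^ n * x)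
    have hy2 := Nat.lt_floor_add_one (2 ^ n * y)
    rw [h1 n] at hx1 hx2
    have h3 : |2 ^ n * (x - y)| ≤ 1 := abs_le.2 ⟨by linarith, by linarith⟩
    rw [abs_mul, abs_of_pos (by positivity)] at h3
    rw [one_div, inv_pow, ← one_div, le_div_iff₀ (by positivity), mul_comm]
    exact h3
  have h3 : |x - y| ≤ 0 :=
    ge_of_tendsto' (tendsto_pow_atTop_nhds_zero_of_lt_one (by norm_num) (by norm_num)) h2
  exact sub_eq_zero.1 (abs_nonpos_iff.1 h3)

lemma floor_two_pow_mul_add {x : ℝ} (hx : 0 ≤ x) (n j : ℕ) :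
    ⌊2 ^ (n + j) * (x + (1 / 2) ^ n)⌋₊ = ⌊2 ^ (n + j) * x⌋₊ + 2 ^ j := by
  have h : (2 : ℝ) ^ (n + j) * (x + (1 / 2) ^ n) = 2 ^ (n + j) * x + (2 ^ j : ℕ) := by
    have : (2 : ℝ) ^ n * (1 / 2) ^ n = 1 := by rw [← mul_pow]; norm_num
    push_cast
    rw [pow_add]
    linear_combination 2 ^ j * this
  rw [h, Nat.floor_add_natCast (by positivity)]

/-- No carry occurs when the digit is zero. Flip invariance of the digit distribution thus reduces
to translation invariance of Lebesgue measure. -/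
lemma digits_add {x : ℝ} (hx : 0 ≤ x) {n : ℕ} (h : digits x n = false) :
    digits (x + (1 / 2) ^ (n + 1)) = flipBit n (digits x) := by
  have h0 := floor_two_pow_mul_add hx (n + 1) 0
  simp only [add_zero, pow_zero] at h0
  have hev : ⌊2 ^ (n + 1) * x⌋₊ % 2 = 0 := by
    simp only [digits, decide_eq_false_iff_not] at h
    omega
  ext m
  rcases lt_trichotomy m n with hm | rfl | hm
  · rw [flipBit_of_ne hm.ne]
    obtain ⟨j, rfl⟩ : ∃ j, n = m + 1 + j := ⟨n - m - 1, by omega⟩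
    have h1 := floor_two_pow_div (x + (1 / 2) ^ (m + 1 + j + 1)) (m + 1) (j + 1)
    have h2 := floor_two_pow_div x (m + 1) (j + 1)
    rw [← add_assoc, h0, pow_succ' 2 j, ← Nat.div_div_eq_div_mul] at h1
    rw [← add_assoc, pow_succ' 2 j, ← Nat.div_div_eq_div_mul] at h2
    rw [show (⌊2 ^ (m + 1 + j + 1) * x⌋₊ + 1) / 2 = ⌊2 ^ (m + 1 + j + 1) * x⌋₊ / 2 by omega,
      ← h2] at h1
    simp only [digits, h1]
  · rw [flipBit_same, h]
    simp only [digits, h0, Bool.not_false, decide_eq_true_eq]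
    omega
  · rw [flipBit_of_ne hm.ne']
    obtain ⟨j, rfl⟩ : ∃ j, m = n + (j + 1) := ⟨m - n - 1, by omega⟩
    have h1 := floor_two_pow_mul_add hx (n + 1) (j + 1)
    simp only [digits]
    rw [show n + (j + 1) + 1 = n + 1 + (j + 1) by ring, h1, pow_succ, Nat.add_mul_mod_self_right]

lemma mem_shift_iff {x : ℝ} (n : ℕ) :
    (x + (1 / 2) ^ (n + 1) ∈ Set.Ico 0 1 ∧ digits (x + (1 / 2) ^ (n + 1)) n = true) ↔
      (x ∈ Set.Ico 0 1 ∧ digits x n = false) := by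
  have hp : (0 : ℝ) < (1 / 2) ^ (n + 1) := by positivity
  have he : (2 : ℝ) ^ (n + 1) * (1 / 2) ^ (n + 1) = 1 := by rw [← mul_pow]; norm_num
  constructor
  · rintro ⟨⟨h0, h1⟩, hd⟩
    have hx : 0 ≤ x := by
      simp only [digits, decide_eq_true_eq] at hd
      have h2 : 1 ≤ ⌊2 ^ (n + 1) * (x + (1 / 2) ^ (n + 1))⌋₊ := by omega
      have h3 := (Nat.one_le_floor_iff _).1 h2
      rw [mul_add, he] at h3
      exact nonneg_of_mul_nonneg_right (by linarith) (show (0 : ℝ) < 2 ^ (n + 1) by positivity)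
    refine ⟨⟨hx, by linarith⟩, ?_⟩
    by_contra hne
    have h4 := floor_two_pow_mul_add hx (n + 1) 0
    simp only [digits, decide_eq_true_eq, decide_eq_false_iff_not, add_zero, pow_zero,
      not_not] at *
    omega
  · rintro ⟨⟨h0, h1⟩, hd⟩
    have h2 := digits_add h0 hd
    refine ⟨⟨by linarith, ?_⟩, by rw [h2, flipBit_same, hd]; rfl⟩
    have h3 : ⌊2 ^ (n + 1) * x⌋₊ < 2 ^ (n + 1) := by
      rw [Nat.floor_lt (by positivity)]
      push_cast
      exact mul_lt_of_lt_one_right (by positivity) h1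
    simp only [digits, decide_eq_false_iff_not] at hd
    have h4 : ⌊2 ^ (n + 1) * x⌋₊ + 1 + 1 ≤ 2 ^ (n + 1) := by
      have : 2 ^ (n + 1) = 2 * 2 ^ n := pow_succ' _ _
      omega
    have h5 := Nat.lt_floor_add_one (2 ^ (n + 1) * x)
    have h6 : ((⌊2 ^ (n + 1) * x⌋₊ + 1 + 1 : ℕ) : ℝ) ≤ ((2 ^ (n + 1) : ℕ) : ℝ) := Nat.cast_le.2 h4
    push_cast at h6
    have h7 : (2 : ℝ) ^ (n + 1) * (x + (1 / 2) ^ (n + 1)) < 2 ^ (n + 1) * 1 := by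
      rw [mul_add, he]; linarith
    exact lt_of_mul_lt_mul_left h7 (by positivity)

/-- The distribution of the binary digits. -/
noncomputable def bitMeasure : Measure (ℕ → Bool) := unitMeasure.map digits

lemma unitMeasure_eq_restrict_Ico : unitMeasure = volume.restrict (Set.Ico (0 : ℝ) 1) :=
  (Measure.restrict_congr_set Ico_ae_eq_Icc).symm

instance : IsProbabilityMeasure unitMeasure := ⟨by simp⟩

lemma volume_shift (n : ℕ) {S : Set (ℕ → Bool)} :
    volume (Set.Ico (0 : ℝ) 1 ∩ digits ⁻¹' (flipBit n ⁻¹' S ∩ {ω | ω n = false})) =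
      volume (Set.Ico (0 : ℝ) 1 ∩ digits ⁻¹' (S ∩ {ω | ω n = true})) := by
  rw [← measure_preimage_add_right volume ((1 / 2 : ℝ) ^ (n + 1))
    (Set.Ico (0 : ℝ) 1 ∩ digits ⁻¹' (S ∩ {ω | ω n = true}))]
  congr 1
  ext x
  have h := mem_shift_iff (x := x) n
  simp only [Set.mem_inter_iff, Set.mem_preimage, Set.mem_ofPred_eq] at h ⊢
  constructor
  · rintro ⟨hx, hS, hd⟩
    have h1 := h.2 ⟨hx, hd⟩
    refine ⟨h1.1, ?_, h1.2⟩
    rwa [digits_add hx.1 hd]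
  · rintro ⟨hx, hS, hd⟩
    have h1 := h.1 ⟨hx, hd⟩
    refine ⟨h1.1, ?_, h1.2⟩
    rwa [← digits_add h1.1.1 h1.2]

instance : FlipInvariant bitMeasure where
  toIsProbabilityMeasure := Measure.isProbabilityMeasure_map measurable_digits.aemeasurable
  measurePreserving n := by
    refine ⟨measurable_flipBit n, Measure.ext fun S hS => ?_⟩
    have hS' : MeasurableSet (flipBit n ⁻¹' S) := measurable_flipBit n hS
    rw [Measure.map_apply (measurable_flipBit n) hS]
    have key : ∀ S : Set (ℕ → Bool), MeasurableSet S → bitMeasure S =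
        volume (Set.Ico (0 : ℝ) 1 ∩ digits ⁻¹' (S ∩ {ω | ω n = true})) +
        volume (Set.Ico (0 : ℝ) 1 ∩ digits ⁻¹' (S ∩ {ω | ω n = false})) := fun S hS => by
      rw [bitMeasure, Measure.map_apply measurable_digits hS, unitMeasure_eq_restrict_Ico,
        Measure.restrict_apply (measurable_digits hS), ← measure_inter_add_sdiff _
        (measurable_digits (measurableSet_coord n true))]
      congr 2
      · ext x; simp; tauto
      · ext x; simp; tauto
    rw [key _ hS', key _ hS, volume_shift n, ← volume_shift n (S := flipBit n ⁻¹' S)]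
    have e : flipBit n ⁻¹' (flipBit n ⁻¹' S) = S := by
      ext ω; simp [flipBit_flipBit]
    rw [e, add_comm]

end BitSystem

namespace BitSystem

/-! ### The system on the unit interval -/

variable {Q : ℕ}

/-- The bounded orthonormal system, as functions on the unit interval. -/
noncomputable def realTheta (Q n : ℕ) (x : ℝ) : ℝ := theta Q n (digits x)

lemma measurable_realTheta (n : ℕ) : Measurable (realTheta Q n) := by
  obtain ⟨m, hm⟩ := exists_cyl_theta (Q := Q) n
  exact hm.measurable.comp measurable_digits

lemma abs_realTheta_le (n : ℕ) (x : ℝ) : |realTheta Q n x| ≤ 1 + √2 + (1 / 2) ^ Q :=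
  abs_theta_le bitMeasure n _

lemma memLp_realTheta (n : ℕ) : MemLp (realTheta Q n) 2 unitMeasure :=
  MemLp.of_bound (measurable_realTheta n).aestronglyMeasurable _
    (Eventually.of_forall (abs_realTheta_le n))

/-- The bounded orthonormal system, as elements of `L²[0,1]`. -/
noncomputable def lpTheta (Q n : ℕ) : Lp ℝ 2 unitMeasure := (memLp_realTheta (Q := Q) n).toLp _

lemma ae_lpTheta_eq : ∀ᵐ x ∂unitMeasure, ∀ n, lpTheta Q n x = realTheta Q n x :=
  ae_all_iff.2 fun n => (memLp_realTheta n).coeFn_toLp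

lemma integral_comp_digits {n : ℕ} {F : (ℕ → Bool) → ℝ} (hF : Cyl n F) :
    ∫ x, F (digits x) ∂unitMeasure = ∫ ω, F ω ∂bitMeasure :=
  (integral_map measurable_digits.aemeasurable hF.measurable.aestronglyMeasurable).symm

lemma orthonormal_lpTheta : Orthonormal ℝ (lpTheta Q) := by
  rw [orthonormal_iff_ite]
  intro i j
  rw [L2.inner_def, ← integral_theta_mul (P := bitMeasure) (Q := Q) i j]
  obtain ⟨n, hn⟩ := exists_cyl_theta (Q := Q) i
  obtain ⟨m, hm⟩ := exists_cyl_theta (Q := Q) j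
  rw [← integral_comp_digits ((hn.mono (le_max_left n m)).mul (hm.mono (le_max_right n m)))]
  refine integral_congr_ae ?_
  filter_upwards [ae_lpTheta_eq (Q := Q)] with x hx
  rw [hx, hx]
  exact mul_comm _ _

lemma seriesConvergesTo_iff {x : ℝ} (hx : ∀ n, lpTheta Q n x = realTheta Q n x) (a : ℕ → ℝ)
    (s : ℝ) : SeriesConvergesTo (lpTheta Q) a x s ↔
      Tendsto (fun N => ∑ n ∈ Finset.range N, a n * theta Q n (digits x)) atTop (𝓝 s) := by
  simp only [SeriesConvergesTo, hx, realTheta]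

lemma memℓp_two_iff (a : ℕ → ℝ) : Memℓp a 2 ↔ Summable fun n => a n ^ 2 := by
  rw [memℓp_gen_iff (by norm_num)]
  simp

lemma isEuclideanSystem_lpTheta : IsEuclideanSystem (lpTheta Q) := by
  refine ⟨⟨orthonormal_lpTheta, fun a ha => ?_⟩, ⟨orthonormal_lpTheta, fun a ha => ?_⟩⟩
  · filter_upwards [ae_lpTheta_eq (Q := Q), ae_of_ae_map measurable_digits.aemeasurable
      (ae_tendsto_theta_series (P := bitMeasure) (Q := Q) ((memℓp_two_iff a).1 ha))] with x hx hs
    simpa only [seriesConvergesTo_iff hx] using hs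
  · filter_upwards [ae_lpTheta_eq (Q := Q), ae_of_ae_map measurable_digits.aemeasurable
      (ae_not_tendsto_theta_series (P := bitMeasure) (Q := Q) (mt (memℓp_two_iff a).2 ha))]
      with x hx hs
    simpa only [seriesConvergesTo_iff hx] using hs

lemma eLpNorm_lpTheta_le {M : ℝ} (hM : 1 + √2 + (1 / 2) ^ Q ≤ M) (n : ℕ) :
    eLpNorm (lpTheta Q n) ⊤ unitMeasure ≤ ENNReal.ofReal M := by
  rw [eLpNorm_exponent_top]
  refine eLpNormEssSup_le_of_ae_bound ?_
  filter_upwards [ae_lpTheta_eq (Q := Q)] with x hx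
  rw [hx]
  exact (abs_realTheta_le n x).trans hM

/-! ### Completeness -/

lemma exists_cyl_of_mem_measurableCylinders {T : Set (ℕ → Bool)}
    (hT : T ∈ measurableCylinders fun _ : ℕ => Bool) : ∃ n, Cyl n (· ∈ T) := by
  obtain ⟨s, S, -, rfl⟩ := (mem_measurableCylinders _).1 hT
  refine ⟨s.sup id + 1, fun ω ω' H => ?_⟩
  have : s.restrict ω = s.restrict ω' := funext fun i =>
    H i (Nat.lt_succ_of_le (Finset.le_sup (f := id) i.2))
  simp only [mem_cylinder, this]

lemma integral_mul_eq_zero_of_orthogonal {g : ℝ → ℝ} (hg : Integrable g unitMeasure)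
    (h : ∀ n, ∫ x, realTheta Q n x * g x ∂unitMeasure = 0) {n : ℕ} {F : (ℕ → Bool) → ℝ}
    (hF : Cyl n F) : ∫ x, F (digits x) * g x ∂unitMeasure = 0 := by
  have key : Integrable (fun x => F (digits x) * g x) unitMeasure ∧
      ∫ x, F (digits x) * g x ∂unitMeasure = 0 := by
    refine Submodule.span_induction (p := fun F _ =>
      Integrable (fun x => F (digits x) * g x) unitMeasure ∧
        ∫ x, F (digits x) * g x ∂unitMeasure = 0) ?_ ?_ ?_ ?_ (cyl_mem_span (Q := Q) bitMeasure hF)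
    · rintro _ ⟨n, rfl⟩
      exact ⟨hg.bdd_mul (measurable_realTheta n).aestronglyMeasurable
        (Eventually.of_forall (abs_realTheta_le n)), h n⟩
    · simp
    · rintro F G - - ⟨hF1, hF2⟩ ⟨hG1, hG2⟩
      simp only [Pi.add_apply, add_mul]
      exact ⟨hF1.add hG1, by rw [integral_add hF1 hG1, hF2, hG2, add_zero]⟩
    · rintro c F - ⟨hF1, hF2⟩
      simp only [Pi.smul_apply, smul_eq_mul, mul_assoc]
      exact ⟨hF1.const_mul c, by rw [integral_const_mul, hF2, mul_zero]⟩
  exact key.2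

lemma setIntegral_preimage_digits_eq_zero {g : ℝ → ℝ} (hg : Integrable g unitMeasure)
    (h : ∀ n, ∫ x, realTheta Q n x * g x ∂unitMeasure = 0) {T : Set (ℕ → Bool)}
    (hT : MeasurableSet T) : ∫ x in digits ⁻¹' T, g x ∂unitMeasure = 0 := by
  have hcyl : ∀ T : Set (ℕ → Bool), ∀ n, Cyl n (· ∈ T) →
      ∫ x in digits ⁻¹' T, g x ∂unitMeasure = 0 := fun T n hT => by
    classical
    have h1 := integral_mul_eq_zero_of_orthogonal hg h (hT.comp fun p => if p then (1 : ℝ) else 0)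
    have hm : MeasurableSet T := hT.measurableSet
    rw [← integral_indicator (measurable_digits hm), ← h1]
    refine integral_congr_ae (Eventually.of_forall fun x => ?_)
    by_cases hx : digits x ∈ T <;> simp [hx]
  induction T, hT using MeasurableSpace.induction_on_inter
    (generateFrom_measurableCylinders (α := fun _ : ℕ => Bool)).symm
    isPiSystem_measurableCylinders with
  | empty => simp
  | basic T hT =>
    obtain ⟨n, hn⟩ := exists_cyl_of_mem_measurableCylinders hT
    exact hcyl T n hn
  | compl T hT ih =>
    have h1 := integral_add_compl (measurable_digits hT) hg
    have h2 := hcyl Set.univ 0 fun _ _ _ => rfl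
    rw [Set.preimage_univ, setIntegral_univ] at h2
    rw [ih, h2, zero_add] at h1
    exact h1
  | iUnion f hf hm ih =>
    rw [Set.preimage_iUnion]
    have h1 := hasSum_integral_iUnion (fun i => measurable_digits (hm i))
      (fun i j hij => (hf hij).preimage digits) hg.integrableOn
    simp only [ih] at h1
    exact h1.unique hasSum_zero

lemma isCompleteSystem_lpTheta : IsCompleteSystem (lpTheta Q) := by
  rw [IsCompleteSystem, Submodule.topologicalClosure_eq_top_iff, eq_bot_iff]
  intro g hg
  have hgi : Integrable g unitMeasure := (Lp.memLp g).integrable (by norm_num)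
  have h1 : ∀ n, ∫ x, realTheta Q n x * g x ∂unitMeasure = 0 := fun n => by
    have := (Submodule.mem_orthogonal _ _).1 hg (lpTheta Q n) (Submodule.subset_span ⟨n, rfl⟩)
    rw [L2.inner_def] at this
    rw [← this]
    refine integral_congr_ae ?_
    filter_upwards [ae_lpTheta_eq (Q := Q)] with x hx
    rw [hx]
    exact mul_comm _ _
  have h2 : g =ᵐ[unitMeasure] 0 := by
    refine hgi.ae_eq_zero_of_forall_setIntegral_eq_zero fun S hS _ => ?_
    -- A measurable injective image of a Borel set is measurable (Lusin–Souslin), so up to a null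
    -- set S is the preimage of a measurable set of bit sequences.
    have hinj : Set.InjOn digits (S ∩ Set.Ico 0 1) := digits_injOn.mono Set.inter_subset_right
    have hT := (hS.inter measurableSet_Ico).image_of_measurable_injOn measurable_digits hinj
    rw [← setIntegral_preimage_digits_eq_zero hgi h1 hT]
    refine setIntegral_congr_set ?_
    have hIco : ∀ᵐ x ∂unitMeasure, x ∈ Set.Ico (0 : ℝ) 1 := by
      rw [unitMeasure_eq_restrict_Ico]
      exact ae_restrict_mem measurableSet_Ico
    filter_upwards [hIco] with x hx
    refine propext ⟨fun hxS => ⟨x, ⟨hxS, hx⟩, rfl⟩, ?_⟩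
    rintro ⟨y, ⟨hyS, hy⟩, hxy⟩
    rwa [← digits_injOn hy hx hxy]
  exact (Submodule.mem_bot ℝ).2 ((Lp.eq_zero_iff_ae_eq_zero).2 h2)

/-! ### Failure of the representation property -/

lemma lintegral_sq_sum_le (a : ℕ → ℝ) (ha : Summable fun n => a n ^ 2) (N : ℕ) :
    ∫⁻ x, ENNReal.ofReal ((∑ n ∈ Finset.range N, a n * realTheta Q n x) ^ 2) ∂unitMeasure ≤
      ENNReal.ofReal (∑' n, a n ^ 2) := by
  obtain ⟨m, hm⟩ := exists_cyl_sum (Finset.range N) (exists_cyl_theta (Q := Q)) a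
  have hc := hm.comp (· ^ 2)
  have h1 : Integrable (fun x => (∑ n ∈ Finset.range N, a n * realTheta Q n x) ^ 2) unitMeasure :=
    (hc.integrable bitMeasure).comp_measurable measurable_digits
  rw [← ofReal_integral_eq_lintegral_ofReal h1 (Eventually.of_forall fun _ => sq_nonneg _)]
  refine ENNReal.ofReal_le_ofReal ?_
  have h2 := integral_comp_digits hc
  rw [integral_sq_sum_of_orthonormal _ exists_cyl_theta integral_theta_mul] at h2
  exact h2.trans_le (ha.sum_le_tsum _ fun _ _ => sq_nonneg _)

lemma not_integrable_inv_unitMeasure : ¬ Integrable (fun x : ℝ => x⁻¹) unitMeasure := fun h => by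
  have h1 : IntervalIntegrable (fun x : ℝ => x⁻¹) volume 0 1 :=
    (intervalIntegrable_iff_integrableOn_Icc_of_le zero_le_one).2 h
  rw [intervalIntegrable_inv_iff] at h1
  simp at h1

lemma not_hasMenshovRepresentation_lpTheta : ¬ HasMenshovRepresentation (lpTheta Q) := by
  intro h
  -- A finite function outside L²: by the divergence property its coefficients would be square
  -- summable, and Fatou's lemma would make its square 1/x integrable.
  obtain ⟨a, ha⟩ := h (fun x => ((√x)⁻¹ : ℝ))
    (measurable_coe_real_ereal.comp Real.continuous_sqrt.measurable.inv)
    (Eventually.of_forall fun x => ⟨EReal.coe_ne_top _, EReal.coe_ne_bot _⟩)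
  have ha2 : Summable fun n => a n ^ 2 := by
    rw [← memℓp_two_iff]
    by_contra hna
    obtain ⟨x, hx1, s, -, hx2⟩ := ((isEuclideanSystem_lpTheta.2.2 a hna).and ha).exists
    exact hx1 ⟨s, hx2⟩
  have hlim : ∀ᵐ x ∂unitMeasure, Tendsto (fun N => ENNReal.ofReal
      ((∑ n ∈ Finset.range N, a n * realTheta Q n x) ^ 2)) atTop (𝓝 (ENNReal.ofReal x⁻¹)) := by
    filter_upwards [ha, ae_lpTheta_eq (Q := Q), ae_restrict_mem measurableSet_Icc]
      with x ⟨s, hs, hconv⟩ hx hx01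
    have h1 := ((seriesConvergesTo_iff hx a s).1 hconv).pow 2
    have h2 : s ^ 2 = x⁻¹ := by
      rw [← EReal.coe_eq_coe_iff.1 hs, inv_pow, Real.sq_sqrt hx01.1]
    rw [h2] at h1
    exact ENNReal.tendsto_ofReal h1
  have hmeas : ∀ N, Measurable fun x => ENNReal.ofReal
      ((∑ n ∈ Finset.range N, a n * realTheta Q n x) ^ 2) := fun N =>
    ((Finset.measurable_sum _ fun n _ => (measurable_realTheta n).const_mul _).pow_const
      2).ennreal_ofReal
  have hfin : ∫⁻ x, ENNReal.ofReal x⁻¹ ∂unitMeasure ≤ ENNReal.ofReal (∑' n, a n ^ 2) := by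
    calc ∫⁻ x, ENNReal.ofReal x⁻¹ ∂unitMeasure
        = ∫⁻ x, liminf (fun N => ENNReal.ofReal
            ((∑ n ∈ Finset.range N, a n * realTheta Q n x) ^ 2)) atTop ∂unitMeasure :=
          lintegral_congr_ae (hlim.mono fun x hx => hx.liminf_eq.symm)
      _ ≤ liminf (fun N => ∫⁻ x, ENNReal.ofReal
            ((∑ n ∈ Finset.range N, a n * realTheta Q n x) ^ 2) ∂unitMeasure) atTop :=
          lintegral_liminf_le hmeas
      _ ≤ liminf (fun _ : ℕ => ENNReal.ofReal (∑' n, a n ^ 2)) atTop :=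
          liminf_le_liminf (Eventually.of_forall (lintegral_sq_sum_le a ha2))
      _ = _ := liminf_const _
  refine not_integrable_inv_unitMeasure
    ((lintegral_ofReal_ne_top_iff_integrable measurable_inv.aestronglyMeasurable ?_).1
      (hfin.trans_lt ENNReal.ofReal_lt_top).ne)
  filter_upwards [ae_restrict_mem measurableSet_Icc] with x hx using inv_nonneg.2 hx.1

end BitSystem

theorem theorem1 (M : ℝ) (hM : 1 + Real.sqrt 2 < M) :
    ∃ θ : ℕ → Lp ℝ 2 unitMeasure,
      IsEuclideanSystem θ ∧
      IsCompleteSystem θ ∧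
      (∀ n, eLpNorm (θ n) ⊤ unitMeasure ≤ ENNReal.ofReal M) ∧
      ¬ HasMenshovRepresentation θ := by
  -- The parameter Q makes the blocks so large that the error (1/2)^Q fits into the gap between M
  -- and 1 + √2.
  obtain ⟨Q, hQ⟩ := exists_pow_lt_of_lt_one (sub_pos.2 hM) (show (1 / 2 : ℝ) < 1 by norm_num)
  exact ⟨BitSystem.lpTheta Q, BitSystem.isEuclideanSystem_lpTheta,
    BitSystem.isCompleteSystem_lpTheta, BitSystem.eLpNorm_lpTheta_le (by linarith),
    BitSystem.not_hasMenshovRepresentation_lpTheta⟩
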